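/- Let $n\ge 1$, $0\le m\le n+1$, $t=(t_1,\dots,t_n)\in\mathbb R^n$, $I_1=\{2,\dots,n-m+1\}\cap\{2,\dots,n\}$, $I_2=\{n-m+2,\dots,n\}\cap\{2,\dots,n\}$, $\kappa_1=\lfloor (n+3-m)/2\rfloor$, $\kappa_2=\lfloor m/2\rfloor$. **Phase space.** $\mathcal M$ is the set of $\xi=(\lambda,\mu)\in\mathbb R^{2n}$ with pairwise distinct $\lambda_i$ and $\lambda_i^m\neq 0$, with the canonical bracket $\{F,H\}=\sum_i(\partial_{\lambda_i}F\,\partial_{\mu_i}H-\partial_{\mu_i}F\,\partial_{\lambda_i}H)$. Put $u(x)=\prod_k(x-\lambda_k)=\sum_{k=0}^n\rho_kx^{n-k}$, $\Delta_i=\prod_{j\ne i}(\lambda_i-\lambda_j)$, and let $v$ be the polynomial of degree $<n$ with $v(\lambda_i)=\lambda_i^m\mu_i$. For a Laurent polynomial $b$ and a polynomial $a$, $[b/a]_+$ is the Laurent polynomial $q$ with $b/a=q+r/a$, where $r$ is a polynomial, $\deg r<\deg a$, and the pole of $q$ at $0$ is no worse than that of $b$; and $[b/a]_-=b/a-[b/a]_+$.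 **Coefficients.** Let $d_0,\dots,d_{n+1},e$ be $C^2$ functions of $t$ and let $\zeta_{r,j}$ be functions of $t$ with $\zeta_{r,r}=1$ such that $\zeta_{r,j}$ ($1\le j\le r$) depends only on $t_1,\dots,t_{r-1}$ if $r\in\{1\}\cup I_1$, and $\zeta_{r,j}$ ($r\le j\le n$) depends only on $t_{r+1},\dots,t_n$ if $r\in I_2$. Suppose that, for $1\le r\le n$ and $0\le\gamma\le n+1$: * if $r\in\{1\}\cup I_1$: $\partial d_\gamma/\partial t_r=0$ unless $m\le\gamma\le m+r-1$, and for these $\gamma$ it equals $(\gamma-m+1)\,d_{n-m+2+\gamma-r}$ when $r\le\kappa_1$ and $(\gamma-m+1)\sum_{j=\gamma-m+1}^{r}\zeta_{r,j}\,d_{n-m+2+\gamma-j}$ when $r>\kappa_1$; * if $r\in I_2$: $\partial d_\gamma/\partial t_r=0$ unless $r-(n-m+2)\le\gamma\le m-2$, and for these $\gamma$ it equals $-(\gamma-m+1)\,d_{n-m+2+\gamma-r}$ when $r>n-\kappa_2$ and $-(\gamma-m+1)\sum_{j=0}^{n-m+2+\gamma-r}\zeta_{r,r+j}\,d_{n-m+2+\gamma-r-j}$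 when $r\le n-\kappa_2$; * $\partial e/\partial t_r=e$ if $m=n+1$ and $r=1$, and $\partial e/\partial t_r=0$ otherwise. Let $c_\alpha(t)$, $-m\le\alpha\le 2n-m+2$, be given by the identity $$\sum_\alpha c_\alpha x^\alpha=\tfrac12x^m\Big(\sum_{\gamma=0}^{n+1}d_\gamma x^{\gamma-m}\Big)^2+(e-d_{n+1})x^n .$$ **Hamiltonians.** Put $\Psi(x,y,t)=\frac12x^my^2-\sum_\alpha c_\alpha(t)x^\alpha$ and $\Phi(x,y,t)=\frac12x^my^2-\sum_{\gamma=0}^{n+1} d_\gamma(t)x^\gamma y-e(t)x^n$. Let $h'_r$ and $h_r$ be the solutions of $\sum_{r=1}^nh'_r\lambda_i^{n-r}=\Psi(\lambda_i,\mu_i,t)$ and $\sum_{r=1}^nh_r\lambda_i^{n-r}=\Phi(\lambda_i,\mu_i,t)$, $i=1,\dots,n$. Put $h_r^A=h_r'+W_r$ and $h_r^B=h_r+W_r$, where $W_1=0$, $$W_r=-\sum_i\Big(\sum_{k=1}^{r-1}k\rho_{r-k-1}\frac{\lambda_i^{m+k-1}}{\Delta_i}\Big)\mu_i\ (r\in I_1),\qquad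 W_r=-\sum_i\Big(\sum_{k=1}^{n-r+1}k\rho_{r+k-1}\frac{\lambda_i^{m-k-1}}{\Delta_i}\Big)\mu_i\ (r\in I_2).$$ For quantities $X_1,\dots,X_n$ define their deformations $\overline X_r$ as follows. For $r\in\{1\}\cup I_1$: $\overline X_r=X_r$ if $r\le\kappa_1$, and $\overline X_r=\sum_{j=1}^r\zeta_{r,j}X_j$ otherwise. For $r\in I_2$: $\overline X_r=X_r$ if $r>n-\kappa_2$, and $\overline X_r=\sum_{j=0}^{n-r}\zeta_{r,r+j}X_{r+j}$ otherwise. The non-magnetic Hamiltonians are $H_r^A=\overline{h^A}_r$, the magnetic ones are $H_r^B=\overline{h^B}_r$. **Lax matrices.** Put $$L=\begin{pmatrix}v&u\\ w&-v\end{pmatrix},\qquad w=-2x^m\Big[\frac{\Psi(x,v(x)x^{-m},t)}{u(x)}\Big]_+,$$ $U_r=[B_r/u]_+$ (entrywise) with $B_r=\frac12\big[\frac{u}{x^{n+1-r}}\big]_+L$ for $r\in\{1\}\cup I_1$ and $B_r=-\frac12\big[\frac{u}{x^{n+1-r}}\big]_-L$ for $r\in I_2$. Let $\overline U_r$ be the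 deformations of the $U_r$, with the same $\zeta_{r,j}$ as for the Hamiltonians. **Claim.** (1) For all $1\le r\le n$, $\xi\in\mathcal M$, $t\in\mathbb R^n$ and $x\in\mathbb R$ with $x^m\ne0$, $H_r^A$ is differentiable in $\xi$, $L$ is differentiable in $(\xi,t)$, $\overline U_r$ is differentiable in $x$, and the flow of $H_r^A$ has the isomonodromic Lax representation $$\frac{d}{dt_r}L=[\overline U_r,L]+2x^m\frac{\partial}{\partial x}\overline U_r,\qquad \frac{d}{dt_r}=\frac{\partial}{\partial t_r}+\{\,\cdot\,,H_r^A\}.$$ (2) The non-magnetic system is obtained from the magnetic one by a multitime-dependent canonical transformation: for $$F(\lambda,\mu',t)=\sum_i\Big(\lambda_i\mu_i'+\sum_{\gamma\ne m-1}\frac{d_\gamma(t)}{\gamma-m+1}\lambda_i^{\gamma-m+1}+d_{m-1}(t)\ln|\lambda_i|\Big)$$ (where $0\le\gamma\le n+1$, and the last term is absent for $m=0$) one has $\partial F/\partial\mu_i'=\lambda_i$ and $\partial F/\partial\lambda_i=\mu_i$ with $\mu_i:=\mu_i'+\sum_{\gamma=0}^{n+1}d_\gamma(t)\lambda_i^{\gamma-m}$,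 and, up to a term that depends only on $r$ and $t$, $H_r^A(\lambda,\mu',t)=H_r^B(\lambda,\mu,t)+\partial F(\lambda,\mu',t)/\partial t_r$. -/

import Mathlib

open scoped LaurentPolynomial Polynomial

noncomputable section

namespace PainleveLax

/-! ### The operation `[b/a]₊` -/

/-- `q = [b/a]₊`: the Laurent polynomial part of the division of the Laurent polynomial `b` by the
polynomial `a`. One has `b / a = q + r / a` with a polynomial remainder `r` of degree less than
that of `a`, and `q` has no worse pole at `0` than `b` has (in particular, `q` is a polynomial when
`b` is one). -/
def IsPlusPart (b : ℝ[T;T⁻¹]) (a : ℝ[X]) (q : ℝ[T;T⁻¹]) : Prop :=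
  (∃ r : ℝ[X], r.degree < a.degree ∧ b = q * a.toLaurent + r.toLaurent) ∧
    ∀ k : ℕ, (∃ p : ℝ[X], LaurentPolynomial.T k * b = p.toLaurent) →
      ∃ p : ℝ[X], LaurentPolynomial.T k * q = p.toLaurent

/-- `[b/a]₊` -/
def plusPart (b : ℝ[T;T⁻¹]) (a : ℝ[X]) : ℝ[T;T⁻¹] :=
  Classical.epsilon (IsPlusPart b a)

theorem toLaurent_of_mul (Q : ℝ[T;T⁻¹]) (a g : ℝ[X]) (ha : a.coeff 0 ≠ 0)
    (h : Q * a.toLaurent = g.toLaurent) : ∃ p : ℝ[X], Q = p.toLaurent := by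
  obtain ⟨j, Q0, hQ⟩ := LaurentPolynomial.exists_T_pow Q
  have h1 : Q0 * a = Polynomial.X ^ j * g := by
    apply Polynomial.toLaurent_injective
    rw [map_mul, map_mul, hQ, Polynomial.toLaurent_X_pow, ← h]
    ring
  have hcop : IsCoprime (Polynomial.X ^ j) a := by
    apply IsCoprime.pow_left
    refine (Polynomial.irreducible_X.coprime_iff_not_dvd).2 ?_
    rw [Polynomial.X_dvd_iff]
    exact ha
  have h2 : Polynomial.X ^ j ∣ Q0 := hcop.dvd_of_dvd_mul_right ⟨g, h1⟩
  obtain ⟨p, hp⟩ := h2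
  refine ⟨p, ?_⟩
  have h3 : Q * LaurentPolynomial.T j = p.toLaurent * LaurentPolynomial.T j := by
    rw [← hQ, hp, map_mul, Polynomial.toLaurent_X_pow, mul_comm]
  exact (LaurentPolynomial.isUnit_T (R := ℝ) j).mul_right_cancel h3

/-- `[b/a]₊` exists and is unique when `a` is monic and either `b` is a polynomial or `a 0 ≠ 0`. -/
theorem existsUnique_isPlusPart (b : ℝ[T;T⁻¹]) (a : ℝ[X]) (ha : a.Monic)
    (hab : (∃ p : ℝ[X], b = p.toLaurent) ∨ a.coeff 0 ≠ 0) : ∃! q, IsPlusPart b a q := by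
  have hex : ∃ q, IsPlusPart b a q := by
    by_cases hb : ∃ p : ℝ[X], b = p.toLaurent
    · obtain ⟨p, rfl⟩ := hb
      refine ⟨(p /ₘ a).toLaurent, ⟨p %ₘ a, Polynomial.degree_modByMonic_lt p ha, ?_⟩, ?_⟩
      · rw [← map_mul, ← map_add]
        congr 1
        rw [mul_comm, add_comm]
        exact (Polynomial.modByMonic_add_div p a).symm
      · intro k _
        exact ⟨Polynomial.X ^ k * (p /ₘ a), by rw [map_mul, Polynomial.toLaurent_X_pow]⟩
    · have ha0 : a.coeff 0 ≠ 0 := hab.resolve_left hb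
      obtain ⟨k, p, hp⟩ := LaurentPolynomial.exists_T_pow b
      have hcop : IsCoprime a (Polynomial.X ^ k) := by
        apply IsCoprime.symm
        apply IsCoprime.pow_left
        refine (Polynomial.irreducible_X.coprime_iff_not_dvd).2 ?_
        rw [Polynomial.X_dvd_iff]
        exact ha0
      obtain ⟨s, t, hst⟩ := hcop
      have hbq : b = (LaurentPolynomial.T (-(k : ℤ)) * (p * s).toLaurent
          + ((p * t) /ₘ a).toLaurent) * a.toLaurent + ((p * t) %ₘ a).toLaurent := by
        have e1 : (p * t) %ₘ a + a * ((p * t) /ₘ a) = p * t := Polynomial.modByMonic_add_div _ a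
        have e2 : p = p * s * a + p * t * Polynomial.X ^ k := by
          linear_combination (-p) * hst
        have e3 : b = LaurentPolynomial.T (-(k : ℤ)) * p.toLaurent := by
          rw [hp, mul_comm, mul_assoc, ← LaurentPolynomial.T_add]
          simp
        have e4 : (LaurentPolynomial.T (-(k : ℤ)) : ℝ[T;T⁻¹]) * LaurentPolynomial.T (k : ℤ) = 1 := by
          rw [← LaurentPolynomial.T_add]; simp
        have e5 := congrArg Polynomial.toLaurent e1
        have e6 := congrArg Polynomial.toLaurent e2
        simp only [map_add, map_mul, Polynomial.toLaurent_X_pow] at e5 e6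
        simp only [map_mul]
        linear_combination e3 + LaurentPolynomial.T (-(k : ℤ)) * e6 +
          (p.toLaurent * t.toLaurent) * e4 - e5
      refine ⟨_, ⟨_, Polynomial.degree_modByMonic_lt (p * t) ha, hbq⟩, ?_⟩
      rintro j ⟨g, hg⟩
      refine toLaurent_of_mul _ a (g - Polynomial.X ^ j * ((p * t) %ₘ a)) ha0 ?_
      rw [map_sub, map_mul Polynomial.toLaurent (Polynomial.X ^ j), Polynomial.toLaurent_X_pow, ← hg]
      linear_combination (-(LaurentPolynomial.T (j : ℤ))) * hbq
  obtain ⟨q, hq⟩ := hex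
  refine ⟨q, hq, fun q' hq' => ?_⟩
  obtain ⟨⟨r, hr, hbr⟩, hpol⟩ := hq
  obtain ⟨⟨r', hr', hbr'⟩, hpol'⟩ := hq'
  have hdiff : (q' - q) * a.toLaurent = (r - r').toLaurent := by
    rw [map_sub]
    linear_combination hbr - hbr'
  have hD : ∃ D : ℝ[X], q' - q = D.toLaurent := by
    rcases hab with hb | ha0
    · have hb0 : ∃ p : ℝ[X], LaurentPolynomial.T ((0 : ℕ) : ℤ) * b = p.toLaurent := by
        simpa using hb
      obtain ⟨p, h1⟩ := hpol 0 hb0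
      obtain ⟨p', h2⟩ := hpol' 0 hb0
      refine ⟨p' - p, ?_⟩
      rw [map_sub, ← h1, ← h2]
      simp
    · exact toLaurent_of_mul _ a _ ha0 hdiff
  obtain ⟨D, hD⟩ := hD
  have h1 : D * a = r - r' := by
    apply Polynomial.toLaurent_injective
    rw [map_mul, ← hD, hdiff]
  have h2 : D = 0 := by
    by_contra hne
    have h3 : (r - r').degree < a.degree :=
      lt_of_le_of_lt (Polynomial.degree_sub_le r r') (max_lt hr hr')
    rw [← h1, ha.degree_mul] at h3
    have h4 : (0 : WithBot ℕ) ≤ D.degree := Polynomial.zero_le_degree_iff.2 hne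
    have h5 : a.degree ≤ D.degree + a.degree := le_add_of_nonneg_left h4
    exact absurd h3 (not_lt.2 h5)
  rw [h2, map_zero] at hD
  exact sub_eq_zero.1 hD

theorem isPlusPart_plusPart (b : ℝ[T;T⁻¹]) (a : ℝ[X]) (ha : a.Monic)
    (hab : (∃ p : ℝ[X], b = p.toLaurent) ∨ a.coeff 0 ≠ 0) : IsPlusPart b a (plusPart b a) :=
  Classical.epsilon_spec (existsUnique_isPlusPart b a ha hab).exists

/-- The value of a Laurent polynomial at a real number `x` (for `x = 0` this is the correct value
whenever there are no negative powers). -/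
def evalAt (b : ℝ[T;T⁻¹]) (x : ℝ) : ℝ := b.coeff.sum fun k a => a * x ^ k

/-! ### Separation coordinates

Points of phase space are pairs `(lam, mu)` of vectors in `ℝⁿ`, and `t` in `ℝⁿ` is the vector of
times. The indices `r, j, k` are 1-based natural numbers as in the usual notation, so that the time
`t_r` is the coordinate `t i` with `i + 1 = r`. -/

variable {n : ℕ}

/-- The configuration space: the `λᵢ` are distinct and `f(λᵢ) = λᵢᵐ ≠ 0` (that is, the metric with
diagonal entries `f(λᵢ)/Δᵢ` is defined and nondegenerate). -/
def config (n m : ℕ) : Set (Fin n → ℝ) :=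
  {lam | Function.Injective lam ∧ ∀ i, lam i ^ m ≠ 0}

/-- `u(x) = ∏ₖ (x - λₖ)` -/
def u (lam : Fin n → ℝ) : ℝ[X] := ∏ k, (Polynomial.X - Polynomial.C (lam k))

/-- `ρₖ`, where `u(x) = ∑_{k=0}^n ρₖ x^{n-k}` -/
def rho (lam : Fin n → ℝ) (k : ℕ) : ℝ := (u lam).coeff (n - k)

/-- `Δᵢ = ∏_{j ≠ i} (λᵢ - λⱼ)` -/
def Delta (lam : Fin n → ℝ) (i : Fin n) : ℝ := ∏ j ∈ Finset.univ.erase i, (lam i - lam j)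

/-- `v(x)`: the polynomial of degree less than `n` with `v(λᵢ) = λᵢᵐ μᵢ` -/
def v (m : ℕ) (lam mu : Fin n → ℝ) : ℝ[X] :=
  Lagrange.interpolate Finset.univ lam fun i => lam i ^ m * mu i

/-- The right-hand side `½ xᵐ y² - ∑_α c_α x^α` of the separation curve with ordinary potentials.
Here `xpow α` stands for `x^α`, and `x` is a real number or the Laurent polynomial variable. -/
def Psi {R : Type*} [CommRing R] [Algebra ℝ R] (n m : ℕ) (c : ℤ → ℝ) (xpow : ℤ → R) (y : R) : R :=
  (1 / 2 : ℝ) • (xpow m * y ^ 2) -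
    ∑ α ∈ Finset.Icc (-(m : ℤ)) (2 * n - m + 2), c α • xpow α

/-- The right-hand side `½ xᵐ y² - ∑_γ d_γ x^γ y - e xⁿ` of the separation curve with magnetic
potentials. -/
def Phi (n m : ℕ) (d : ℕ → ℝ) (e : ℝ) (x y : ℝ) : ℝ :=
  1 / 2 * x ^ m * y ^ 2 - (∑ γ ∈ Finset.range (n + 2), d γ * x ^ γ) * y - e * x ^ n

/-- The solution `s₁, …, sₙ` of the separation relations `∑_{r=1}^n s_r λᵢ^{n-r} = aᵢ`,
`i = 1, …, n`: the coefficients of the polynomial of degree less than `n` with values `aᵢ` at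
`λᵢ`. -/
def sepSol (lam : Fin n → ℝ) (a : Fin n → ℝ) (r : ℕ) : ℝ :=
  (Lagrange.interpolate Finset.univ lam a).coeff (n - r)

theorem sepSol_spec (lam : Fin n → ℝ) (hlam : Function.Injective lam) (a : Fin n → ℝ)
    (i : Fin n) : ∑ r ∈ Finset.Icc 1 n, sepSol lam a r * lam i ^ (n - r) = a i := by
  have hinj : Set.InjOn lam (Finset.univ : Finset (Fin n)) := hlam.injOn
  have h1 := Lagrange.eval_interpolate_at_node a hinj (Finset.mem_univ i)
  have h2 : (Lagrange.interpolate Finset.univ lam a).degree < (n : ℕ) := by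
    simpa using Lagrange.degree_interpolate_lt a hinj
  have hn : 0 < n := i.pos
  have h3 : (Lagrange.interpolate Finset.univ lam a).natDegree < n := by
    by_cases h0 : Lagrange.interpolate Finset.univ lam a = 0
    · rw [h0]; simpa using hn
    · exact (Polynomial.natDegree_lt_iff_degree_lt h0).2 h2
  rw [← h1, Polynomial.eval_eq_sum_range' h3]
  refine Finset.sum_bij' (fun r _ => n - r) (fun k _ => n - k) ?_ ?_ ?_ ?_ ?_
  · intro r hr; simp only [Finset.mem_Icc, Finset.mem_range] at *; omega
  · intro r hr; simp only [Finset.mem_Icc, Finset.mem_range] at *; omega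
  · intro r hr; simp only [Finset.mem_Icc] at hr; omega
  · intro r hr; simp only [Finset.mem_range] at hr; omega
  · intro r hr; rfl

/-- `I₁ᵐ = {2, …, n-m+1}` (within `{2, …, n}`) -/
def I1 (n m r : ℕ) : Prop := 2 ≤ r ∧ r ≤ n ∧ r + m ≤ n + 1

/-- `I₂ᵐ = {n-m+2, …, n}` (within `{2, …, n}`) -/
def I2 (n m r : ℕ) : Prop := 2 ≤ r ∧ r ≤ n ∧ n + 2 ≤ r + m

/-- `κ₁ = ⌊(n+3-m)/2⌋` -/
def kappa1 (n m : ℕ) : ℕ := (n + 3 - m) / 2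

/-- `κ₂ = ⌊m/2⌋` -/
def kappa2 (m : ℕ) : ℕ := m / 2

open Classical in
/-- The quasi-Stäckel terms `W_r` (with `W₁ = 0`) -/
def W (m r : ℕ) (lam mu : Fin n → ℝ) : ℝ :=
  if I1 n m r then
    -∑ i, (∑ k ∈ Finset.Icc 1 (r - 1),
      (k : ℝ) * rho lam (r - k - 1) * (lam i ^ (m + k - 1) / Delta lam i)) * mu i
  else if I2 n m r then
    -∑ i, (∑ k ∈ Finset.Icc 1 (n - r + 1),
      (k : ℝ) * rho lam (r + k - 1) * (lam i ^ ((m : ℤ) - k - 1) / Delta lam i)) * mu i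
  else 0

/-! ### Multitime-dependent deformations and Hamiltonians -/

open Classical in
/-- The passage from `X₁, …, Xₙ` to their deformations with the coefficients `ζ_{r,j}`, used both
for Hamiltonians and for auxiliary matrices. -/
def deform {E : Type*} [AddCommGroup E] [Module ℝ E] (n m : ℕ) (ζ : ℕ → ℕ → ℝ) (X : ℕ → E)
    (r : ℕ) : E :=
  if r = 1 ∨ I1 n m r then
    if r ≤ kappa1 n m then X r else ∑ j ∈ Finset.Icc 1 r, ζ r j • X j
  else
    if r ≤ n - kappa2 m then ∑ j ∈ Finset.range (n - r + 1), ζ r (r + j) • X (r + j) else X r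

/-- `h_r^A = h'_r + W_r`, with `h'_r` generated by the curve with ordinary potentials -/
def hA (m : ℕ) (c : ℤ → ℝ) (r : ℕ) (lam mu : Fin n → ℝ) : ℝ :=
  sepSol lam (fun i => Psi n m c (fun α : ℤ => lam i ^ α) (mu i)) r + W m r lam mu

/-- `h_r^B = h_r + W_r`, with `h_r` generated by the curve with magnetic potentials -/
def hB (m : ℕ) (d : ℕ → ℝ) (e : ℝ) (r : ℕ) (lam mu : Fin n → ℝ) : ℝ :=
  sepSol lam (fun i => Phi n m d e (lam i) (mu i)) r + W m r lam mu

/-- The non-magnetic Hamiltonians `H_r^A(λ, μ, t)` -/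
def HA (m : ℕ) (ζ : ℕ → ℕ → (Fin n → ℝ) → ℝ) (c : ℤ → (Fin n → ℝ) → ℝ) (r : ℕ)
    (lam mu t : Fin n → ℝ) : ℝ :=
  deform n m (fun a b => ζ a b t) (fun j => hA m (fun α => c α t) j lam mu) r

/-- The magnetic Hamiltonians `H_r^B(λ, μ, t)` -/
def HB (m : ℕ) (ζ : ℕ → ℕ → (Fin n → ℝ) → ℝ) (d : ℕ → (Fin n → ℝ) → ℝ) (e : (Fin n → ℝ) → ℝ)
    (r : ℕ) (lam mu t : Fin n → ℝ) : ℝ :=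
  deform n m (fun a b => ζ a b t) (fun j => hB m (fun γ => d γ t) (e t) j lam mu) r

/-! ### Derivatives -/

/-- The partial derivative `∂/∂t_r` (with `1 ≤ r ≤ n`) -/
def timeDeriv (r : ℕ) (F : (Fin n → ℝ) → ℝ) (t : Fin n → ℝ) : ℝ :=
  lineDeriv ℝ F t fun i => if i.val + 1 = r then 1 else 0

/-- The canonical Poisson bracket `∑ᵢ (∂F/∂λᵢ ∂H/∂μᵢ - ∂F/∂μᵢ ∂H/∂λᵢ)`, for which the flow of `H`
is `dλᵢ/dt = ∂H/∂μᵢ`, `dμᵢ/dt = -∂H/∂λᵢ` -/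
def poisson (F H : (Fin n → ℝ) → (Fin n → ℝ) → ℝ) (lam mu : Fin n → ℝ) : ℝ :=
  ∑ i, (lineDeriv ℝ (fun l => F l mu) lam (Pi.single i 1)
        * lineDeriv ℝ (fun p => H lam p) mu (Pi.single i 1)
      - lineDeriv ℝ (fun p => F lam p) mu (Pi.single i 1)
        * lineDeriv ℝ (fun l => H l mu) lam (Pi.single i 1))

/-- The evolutionary derivative `d/dt_r = ∂/∂t_r + {·, H}` along the Hamiltonian flow of `H` -/
def evolDeriv (r : ℕ) (H F : (Fin n → ℝ) → (Fin n → ℝ) → (Fin n → ℝ) → ℝ)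
    (lam mu t : Fin n → ℝ) : ℝ :=
  timeDeriv r (F lam mu) t + poisson (fun l p => F l p t) (fun l p => H l p t) lam mu

/-! ### The coefficient functions -/

/-- The functions `ζ_{r,j}`, `d_γ`, `e` of the times: the linear first order system for the `d_γ`
and `e` that determines the magnetic system (the equality of the mixed second derivatives of the
`d_γ` is automatic, these functions being of class `C²`). -/
structure IsMagneticData (n m : ℕ) (ζ : ℕ → ℕ → (Fin n → ℝ) → ℝ) (d : ℕ → (Fin n → ℝ) → ℝ)
    (e : (Fin n → ℝ) → ℝ) : Prop where
  contDiff_d : ∀ γ ≤ n + 1, ContDiff ℝ 2 (d γ)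
  contDiff_e : ContDiff ℝ 2 e
  zeta_diag : ∀ r, 1 ≤ r → r ≤ n → ∀ t, ζ r r t = 1
  /-- For `r ∈ {1} ∪ I₁ᵐ`, the `ζ_{r,j}` are functions of `t₁, …, t_{r-1}`. -/
  zeta_dep₁ : ∀ r, (r = 1 ∨ I1 n m r) → ∀ j, 1 ≤ j → j ≤ r → ∀ t t' : Fin n → ℝ,
    (∀ i : Fin n, i.val + 1 < r → t i = t' i) → ζ r j t = ζ r j t'
  /-- For `r ∈ I₂ᵐ`, the `ζ_{r,j}` are functions of `t_{r+1}, …, tₙ`. -/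
  zeta_dep₂ : ∀ r, I2 n m r → ∀ j, r ≤ j → j ≤ n → ∀ t t' : Fin n → ℝ,
    (∀ i : Fin n, r < i.val + 1 → t i = t' i) → ζ r j t = ζ r j t'
  /-- For `r ∈ {1} ∪ I₁ᵐ`, `d_γ` does not depend on `t_r` unless `m ≤ γ ≤ m+r-1`. -/
  deriv_d_zero₁ : ∀ r, (r = 1 ∨ I1 n m r) → ∀ γ ≤ n + 1, ¬ (m ≤ γ ∧ γ ≤ m + r - 1) →
    ∀ t, timeDeriv r (d γ) t = 0
  deriv_d₁ : ∀ r, (r = 1 ∨ I1 n m r) → r ≤ kappa1 n m → ∀ γ, m ≤ γ → γ ≤ m + r - 1 →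
    ∀ t, timeDeriv r (d γ) t = ((γ : ℝ) - m + 1) * d (n + 2 + γ - m - r) t
  deriv_d₂ : ∀ r, (r = 1 ∨ I1 n m r) → kappa1 n m < r → ∀ γ, m ≤ γ → γ ≤ m + r - 1 →
    ∀ t, timeDeriv r (d γ) t =
      ((γ : ℝ) - m + 1) * ∑ j ∈ Finset.Icc (γ + 1 - m) r, ζ r j t * d (n + 2 + γ - m - j) t
  /-- For `r ∈ I₂ᵐ`, `d_γ` does not depend on `t_r` unless `r-(n-m+2) ≤ γ ≤ m-2`. -/
  deriv_d_zero₂ : ∀ r, I2 n m r → ∀ γ ≤ n + 1, ¬ (r + m ≤ n + 2 + γ ∧ γ + 2 ≤ m) →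
    ∀ t, timeDeriv r (d γ) t = 0
  deriv_d₃ : ∀ r, I2 n m r → r ≤ n - kappa2 m → ∀ γ, r + m ≤ n + 2 + γ → γ + 2 ≤ m →
    ∀ t, timeDeriv r (d γ) t =
      -((γ : ℝ) - m + 1) * ∑ j ∈ Finset.range (n + 2 + γ - m - r + 1),
        ζ r (r + j) t * d (n + 2 + γ - m - r - j) t
  deriv_d₄ : ∀ r, I2 n m r → n - kappa2 m < r → ∀ γ, r + m ≤ n + 2 + γ → γ + 2 ≤ m →
    ∀ t, timeDeriv r (d γ) t = -((γ : ℝ) - m + 1) * d (n + 2 + γ - m - r) t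
  deriv_e : ∀ r, 1 ≤ r → r ≤ n → ∀ t,
    timeDeriv r e t = if m = n + 1 ∧ r = 1 then e t else 0

/-- The relation
`∑_α c_α x^α = ½ xᵐ (∑_γ d_γ x^{γ-m})² + (e - d_{n+1}) xⁿ` between the coefficients of the ordinary
and of the magnetic potentials, as an identity of Laurent polynomials in `x` for every `t` -/
def CoeffRelation (n m : ℕ) (c : ℤ → (Fin n → ℝ) → ℝ) (d : ℕ → (Fin n → ℝ) → ℝ)
    (e : (Fin n → ℝ) → ℝ) : Prop :=
  ∀ t, ∑ α ∈ Finset.Icc (-(m : ℤ)) (2 * n - m + 2), c α t • LaurentPolynomial.T (R := ℝ) α =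
    (1 / 2 : ℝ) • (LaurentPolynomial.T (R := ℝ) m *
      (∑ γ ∈ Finset.range (n + 2), d γ t • LaurentPolynomial.T (R := ℝ) ((γ : ℤ) - m)) ^ 2) +
    (e t - d (n + 1) t) • LaurentPolynomial.T (R := ℝ) n

/-! ### The Lax matrices -/

/-- `w(x) = -2 xᵐ [Ψ(x, v(x) x^{-m}, t) / u(x)]₊` -/
def w (m : ℕ) (c : ℤ → ℝ) (lam mu : Fin n → ℝ) : ℝ[T;T⁻¹] :=
  (-2 : ℝ) • (LaurentPolynomial.T m *
    plusPart (Psi n m c (fun α => LaurentPolynomial.T α)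
      ((v m lam mu).toLaurent * LaurentPolynomial.T (-(m : ℤ)))) (u lam))

/-- The Lax matrix `L`, with Laurent polynomials in `x` as entries -/
def lax (m : ℕ) (c : ℤ → ℝ) (lam mu : Fin n → ℝ) : Matrix (Fin 2) (Fin 2) ℝ[T;T⁻¹] :=
  !![(v m lam mu).toLaurent, (u lam).toLaurent; w m c lam mu, -(v m lam mu).toLaurent]

/-- `[u(x)/x^{n+1-r}]₊` -/
def uPlus (r : ℕ) (lam : Fin n → ℝ) : ℝ[T;T⁻¹] :=
  plusPart (u lam).toLaurent (Polynomial.X ^ (n + 1 - r))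

/-- `[u(x)/x^{n+1-r}]₋ = u(x)/x^{n+1-r} - [u(x)/x^{n+1-r}]₊` -/
def uMinus (r : ℕ) (lam : Fin n → ℝ) : ℝ[T;T⁻¹] :=
  (u lam).toLaurent * LaurentPolynomial.T (-((n : ℤ) + 1 - r)) - uPlus r lam

open Classical in
/-- The matrix `B_r` -/
def B (m : ℕ) (c : ℤ → ℝ) (r : ℕ) (lam mu : Fin n → ℝ) : Matrix (Fin 2) (Fin 2) ℝ[T;T⁻¹] :=
  if r = 1 ∨ I1 n m r then (1 / 2 : ℝ) • uPlus r lam • lax m c lam mu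
  else (-(1 / 2) : ℝ) • uMinus r lam • lax m c lam mu

/-- `U_r = [B_r/u]₊` (entrywise) -/
def U (m : ℕ) (c : ℤ → ℝ) (r : ℕ) (lam mu : Fin n → ℝ) : Matrix (Fin 2) (Fin 2) ℝ[T;T⁻¹] :=
  (B m c r lam mu).map fun b => plusPart b (u lam)

/-- `L(x, ξ, t)` with `ξ = (λ, μ)` -/
def L (m : ℕ) (c : ℤ → (Fin n → ℝ) → ℝ) (x : ℝ) (lam mu t : Fin n → ℝ) :
    Matrix (Fin 2) (Fin 2) ℝ :=
  (lax m (fun α => c α t) lam mu).map fun b => evalAt b x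

/-- `Ū_r(x, ξ, t)` with `ξ = (λ, μ)` -/
def Ubar (m : ℕ) (ζ : ℕ → ℕ → (Fin n → ℝ) → ℝ) (c : ℤ → (Fin n → ℝ) → ℝ) (r : ℕ) (x : ℝ)
    (lam mu t : Fin n → ℝ) : Matrix (Fin 2) (Fin 2) ℝ :=
  (deform n m (fun a b => ζ a b t) (fun j => U m (fun α => c α t) j lam mu) r).map
    fun b => evalAt b x

/-! ### The canonical transformation -/

/-- The generating function
`F(λ, μ', t) = ∑ᵢ (λᵢ μ'ᵢ + ∑_{γ ≠ m-1} d_γ λᵢ^{γ-m+1}/(γ-m+1) + d_{m-1} ln λᵢ)`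
(`Real.log` is `ln |λᵢ|`) -/
def genF (m : ℕ) (d : ℕ → (Fin n → ℝ) → ℝ) (lam mu' t : Fin n → ℝ) : ℝ :=
  ∑ i, (lam i * mu' i + ∑ γ ∈ Finset.range (n + 2),
    if γ + 1 = m then d γ t * Real.log (lam i)
    else 1 / ((γ : ℝ) - m + 1) * d γ t * lam i ^ ((γ : ℤ) - m + 1))

/-- The new momenta `μᵢ = μ'ᵢ + ∑_γ d_γ(t) λᵢ^{γ-m}` -/
def shiftMu (m : ℕ) (d : ℕ → (Fin n → ℝ) → ℝ) (lam mu' t : Fin n → ℝ) : Fin n → ℝ :=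
  fun i => mu' i + ∑ γ ∈ Finset.range (n + 2), d γ t * lam i ^ ((γ : ℤ) - m)

end PainleveLax

end

/-! ### Calculus of real Laurent polynomials and their truncations -/

noncomputable section

namespace PainleveLax

open LaurentPolynomial (T)

/-! ### Laurent polynomials: coefficients, degree and order -/

/-! Both ranges of the index r are treated at once. Let `tau σ` be the nonnegative part for σ = 0 (r
in {1} ∪ I₁) and minus the negative part for σ = 1 (r in I₂), and let φ = `phi σ (n+1-r) (u lam)` be
`tau σ` of u/x^{n+1-r}. Then B_r = ½ φ L in both cases (`B_eq`). The two truncations differ by the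
identity map, so they obey the same rule: φ of (x-a)p is (x-a) times φ of p plus a constant
(`phi_linear_mul`). Hence φ(λᵢ) is the coefficient through which interpolation expresses h'_r, and
φ'(λᵢ) produces W_r (`W_eq`). This gives Hamilton's equations in closed form
(`hasLineDerivAt_hA_mu`, `hasLineDerivAt_hA_lam`).

Lax equation. Write N = xᵐ ∑ c_α x^α and let h = ∑ h'_r x^{n-r}. The spectral curve is u w + v² = 2N
+ 2xᵐh (`wpoly_mul_u`), and U_r has rows (A, φ/2) and (Q, -A), where φv = 2Au + R and φw = 2Qu + S
with R, S of degree less than n. With a dot for d/dt_r and a prime for d/dx, the entries of the Lax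
equation read u̇ = xᵐφ' - R, v̇ = ½S + 2xᵐA' and ẇ = 2Qv - 2Aw + 2xᵐQ'. The sides of the first two
are polynomials of degree less than n, so it suffices to compare them at the λᵢ, where they are
Hamilton's equations (`IsLaxData.deriv_u`, `IsLaxData.deriv_v`).

For the third, let Y be the difference of its sides. Differentiating the spectral curve yields uY =
xᵐZ, where Z is 2ḣ minus 2 tr(U_r'L) plus a potential term. If Z is a polynomial of degree less than
n, then its vanishing at the λᵢ forces Z = 0, hence Y = 0 (`IsLaxData.deriv_w`). The degree and pole
bounds on Z are the heart of the matter (`trace_mem_degLE`, `trace_mem_ordGE`). With P = ∑ d_γ x^γ,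
the system for the d_γ says exactly that Ṗ = xᵐψ', where ψ is the same truncation of P/x^{n+1-r}
(`IsMagneticData.toLaurent_deriv`). The trace, multiplied by u², is a bilinear `bracket` of φ with M
= uw + v² plus harmless Wronskians (`trace_identity`). On the untruncated x^{-k}u and on P² this
bracket returns 2Pu²(x^{-k}P)' (`bracket_main`), which matches the potential term; the truncation
error contributes too little to matter, because its leading coefficient cancels
(`bracket_mem_degLE_of_neg`). All conditions are linear in the flow, so the deformations follow by
taking combinations (`IsLaxData.sum`).

Canonical transformation. Substituting μ = μ' + P/λᵐ turns Φ into Ψ - d_{n+1}λⁿ, shifts W_r by -∑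
P(λᵢ)φ'(λᵢ)/Δᵢ, and ∂F/∂t_r is ∑ ψ(λᵢ) up to a function of t. That these contributions cancel is the
interpolation identity `sum_evalAt_phi`, obtained by evaluating ∑ b(λᵢ)/Δᵢ for b = ψu' - Pφ'
corrected by a multiple of u. -/

theorem coeff_toLaurent_natCast (p : ℝ[X]) (k : ℕ) : p.toLaurent.coeff (k : ℤ) = p.coeff k := by
  induction p using Polynomial.induction_on' with
  | add p q hp hq => simp only [map_add, AddMonoidAlgebra.coeff_add, Finsupp.add_apply,
      Polynomial.coeff_add, hp, hq]
  | monomial n a =>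
    rw [Polynomial.toLaurent_C_mul_T, ← LaurentPolynomial.single_eq_C_mul_T,
      AddMonoidAlgebra.coeff_single, Finsupp.single_apply, Polynomial.coeff_monomial]
    simp

theorem coeff_toLaurent_neg (p : ℝ[X]) (k : ℤ) (hk : k < 0) : p.toLaurent.coeff k = 0 := by
  induction p using Polynomial.induction_on' with
  | add p q hp hq => simp only [map_add, AddMonoidAlgebra.coeff_add, Finsupp.add_apply,
      hp, hq, add_zero]
  | monomial n a =>
    rw [Polynomial.toLaurent_C_mul_T, ← LaurentPolynomial.single_eq_C_mul_T,
      AddMonoidAlgebra.coeff_single, Finsupp.single_apply, if_neg (by omega)]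

theorem coeff_T_mul (j : ℤ) (b : ℝ[T;T⁻¹]) (k : ℤ) : (T j * b).coeff k = b.coeff (k - j) := by
  rw [T, AddMonoidAlgebra.coeff_single_mul_apply, one_mul, neg_add_eq_sub]

theorem coeff_C_mul (a : ℝ) (b : ℝ[T;T⁻¹]) (k : ℤ) :
    (LaurentPolynomial.C a * b).coeff k = a * b.coeff k := by
  rw [← LaurentPolynomial.smul_eq_C_mul, AddMonoidAlgebra.coeff_smul_apply, smul_eq_mul]

/-- Laurent polynomials without powers above the `N`-th -/
def degLE (N : ℤ) : Submodule ℝ ℝ[T;T⁻¹] where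
  carrier := {b | ∀ k, N < k → b.coeff k = 0}
  add_mem' := fun {a b} ha hb k hk => by
    rw [AddMonoidAlgebra.coeff_add, Finsupp.add_apply, ha k hk, hb k hk, add_zero]
  zero_mem' := fun _ _ => rfl
  smul_mem' := fun c b hb k hk => by
    rw [AddMonoidAlgebra.coeff_smul_apply, hb k hk, smul_zero]

/-- Laurent polynomials without powers below the `N`-th -/
def ordGE (N : ℤ) : Submodule ℝ ℝ[T;T⁻¹] where
  carrier := {b | ∀ k, k < N → b.coeff k = 0}
  add_mem' := fun {a b} ha hb k hk => by
    rw [AddMonoidAlgebra.coeff_add, Finsupp.add_apply, ha k hk, hb k hk, add_zero]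
  zero_mem' := fun _ _ => rfl
  smul_mem' := fun c b hb k hk => by
    rw [AddMonoidAlgebra.coeff_smul_apply, hb k hk, smul_zero]

theorem degLE_mono {M N : ℤ} (h : M ≤ N) {b : ℝ[T;T⁻¹]} (hb : b ∈ degLE M) : b ∈ degLE N :=
  fun k hk => hb k (by omega)

theorem T_mem_degLE {j N : ℤ} (h : j ≤ N) : (T j : ℝ[T;T⁻¹]) ∈ degLE N := fun k hk => by
  rw [LaurentPolynomial.T_apply, if_neg (by omega)]

theorem T_mem_ordGE {j N : ℤ} (h : N ≤ j) : (T j : ℝ[T;T⁻¹]) ∈ ordGE N := fun k hk => by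
  rw [LaurentPolynomial.T_apply, if_neg (by omega)]

theorem C_mem_degLE (a : ℝ) : LaurentPolynomial.C a ∈ degLE 0 := fun k hk => by
  rw [LaurentPolynomial.C_apply, if_neg (by omega)]

theorem C_mem_ordGE (a : ℝ) : LaurentPolynomial.C a ∈ ordGE 0 := fun k hk => by
  rw [LaurentPolynomial.C_apply, if_neg (by omega)]

theorem toLaurent_mem_ordGE (p : ℝ[X]) : p.toLaurent ∈ ordGE 0 :=
  fun k hk => coeff_toLaurent_neg p k hk

theorem toLaurent_mem_degLE {p : ℝ[X]} {N : ℤ} (h : ∀ k : ℕ, N < k → p.coeff k = 0) :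
    p.toLaurent ∈ degLE N := fun k hk => by
  rcases lt_or_ge k 0 with h0 | h0
  · exact coeff_toLaurent_neg p k h0
  · lift k to ℕ using h0
    rw [coeff_toLaurent_natCast, h k hk]

theorem toLaurent_mem_degLE_of_natDegree {p : ℝ[X]} {N : ℤ} (h : (p.natDegree : ℤ) ≤ N) :
    p.toLaurent ∈ degLE N :=
  toLaurent_mem_degLE fun k hk => Polynomial.coeff_eq_zero_of_natDegree_lt (by omega)

theorem toLaurent_mem_degLE_of_degree {p : ℝ[X]} {n : ℕ} (h : p.degree < n) :
    p.toLaurent ∈ degLE (n - 1) :=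
  toLaurent_mem_degLE fun k hk => Polynomial.coeff_eq_zero_of_degree_lt
    (lt_of_lt_of_le h (by exact_mod_cast (by omega : n ≤ k)))

theorem mul_mem_degLE {M N K : ℤ} (hK : M + N ≤ K) {a b : ℝ[T;T⁻¹]} (ha : a ∈ degLE M)
    (hb : b ∈ degLE N) : a * b ∈ degLE K := fun k hk => by
  rw [AddMonoidAlgebra.coeff_mul_apply_left]
  refine Finset.sum_eq_zero fun i _ => ?_
  rcases lt_or_ge M i with h | h
  · simp only [ha i h, zero_mul]
  · simp only [hb (-i + k) (by omega), mul_zero]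

theorem mul_mem_ordGE {M N K : ℤ} (hK : K ≤ M + N) {a b : ℝ[T;T⁻¹]} (ha : a ∈ ordGE M)
    (hb : b ∈ ordGE N) : a * b ∈ ordGE K := fun k hk => by
  rw [AddMonoidAlgebra.coeff_mul_apply_left]
  refine Finset.sum_eq_zero fun i _ => ?_
  rcases lt_or_ge i M with h | h
  · simp only [ha i h, zero_mul]
  · simp only [hb (-i + k) (by omega), mul_zero]

theorem coeff_mul_degLE {M N K : ℤ} (hK : M + N = K) {a b : ℝ[T;T⁻¹]} (ha : a ∈ degLE M)
    (hb : b ∈ degLE N) : (a * b).coeff K = a.coeff M * b.coeff N := by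
  rw [AddMonoidAlgebra.coeff_mul_apply_left, Finsupp.sum, Finset.sum_eq_single M]
  · rw [← hK, neg_add_cancel_left]
  · intro i _ hi
    rcases lt_or_gt_of_ne hi with h | h
    · rw [hb (-i + K) (by omega), mul_zero]
    · rw [ha i h, zero_mul]
  · intro h
    rw [Finsupp.notMem_support_iff.1 h, zero_mul]

theorem coeff_mul_ordGE {M N K : ℤ} (hK : M + N = K) {a b : ℝ[T;T⁻¹]} (ha : a ∈ ordGE M)
    (hb : b ∈ ordGE N) : (a * b).coeff K = a.coeff M * b.coeff N := by
  rw [AddMonoidAlgebra.coeff_mul_apply_left, Finsupp.sum, Finset.sum_eq_single M]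
  · rw [← hK, neg_add_cancel_left]
  · intro i _ hi
    rcases lt_or_gt_of_ne hi with h | h
    · rw [ha i h, zero_mul]
    · rw [hb (-i + K) (by omega), mul_zero]
  · intro h
    rw [Finsupp.notMem_support_iff.1 h, zero_mul]

theorem exists_mem_degLE (b : ℝ[T;T⁻¹]) (N : ℤ) : ∃ j : ℕ, b ∈ degLE (N + j) := by
  obtain ⟨M, hM⟩ := b.coeff.support.bddAbove
  refine ⟨(M - N).toNat, fun k hk => ?_⟩
  by_contra h
  have := hM (Finsupp.mem_support_iff.2 h)
  omega

theorem exists_mem_ordGE (b : ℝ[T;T⁻¹]) (N : ℤ) : ∃ j : ℕ, b ∈ ordGE (N - j) := by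
  obtain ⟨M, hM⟩ := b.coeff.support.bddBelow
  refine ⟨(N - M).toNat, fun k hk => ?_⟩
  by_contra h
  have := hM (Finsupp.mem_support_iff.2 h)
  omega

/-- A factor with nonzero top coefficient can be cancelled from a degree bound. -/
theorem mem_degLE_of_mul {a b : ℝ[T;T⁻¹]} {M N : ℤ} (ha : a ∈ degLE M) (ha0 : a.coeff M ≠ 0)
    (h : a * b ∈ degLE (M + N)) : b ∈ degLE N := by
  obtain ⟨j, hj⟩ := exists_mem_degLE b N
  induction j with
  | zero => simpa using hj
  | succ j ih =>
    refine ih fun k hk => ?_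
    rcases eq_or_ne k (N + (j + 1 : ℕ)) with rfl | hne
    · have h1 := coeff_mul_degLE rfl ha hj
      rw [h _ (by omega)] at h1
      exact (mul_eq_zero.1 h1.symm).resolve_left ha0
    · exact hj k (by push_cast at hne ⊢; omega)

/-- A factor with nonzero bottom coefficient can be cancelled from an order bound. -/
theorem mem_ordGE_of_mul {a b : ℝ[T;T⁻¹]} {M N : ℤ} (ha : a ∈ ordGE M) (ha0 : a.coeff M ≠ 0)
    (h : a * b ∈ ordGE (M + N)) : b ∈ ordGE N := by
  obtain ⟨j, hj⟩ := exists_mem_ordGE b N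
  induction j with
  | zero => simpa using hj
  | succ j ih =>
    refine ih fun k hk => ?_
    rcases eq_or_ne k (N - (j + 1 : ℕ)) with rfl | hne
    · have h1 := coeff_mul_ordGE rfl ha hj
      rw [h _ (by omega)] at h1
      exact (mul_eq_zero.1 h1.symm).resolve_left ha0
    · exact hj k (by push_cast at hne ⊢; omega)

theorem coeff_trunc (b : ℝ[T;T⁻¹]) (k : ℕ) :
    (LaurentPolynomial.trunc b).coeff k = b.coeff (k : ℤ) := by
  induction b using LaurentPolynomial.induction_on' with
  | add p q hp hq => simp only [map_add, AddMonoidAlgebra.coeff_add, Finsupp.add_apply,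
      Polynomial.coeff_add, hp, hq]
  | C_mul_T j a =>
    rw [LaurentPolynomial.trunc_C_mul_T, coeff_C_mul, LaurentPolynomial.T_apply]
    split_ifs with h1 h2 h2
    · rw [Polynomial.coeff_monomial, if_pos (by omega), mul_one]
    · rw [Polynomial.coeff_monomial, if_neg (by omega), mul_zero]
    · omega
    · simp

theorem toLaurent_trunc {b : ℝ[T;T⁻¹]} (hb : b ∈ ordGE 0) :
    (LaurentPolynomial.trunc b).toLaurent = b := by
  ext k
  rcases lt_or_ge k 0 with h0 | h0
  · rw [coeff_toLaurent_neg _ k h0, hb k h0]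
  · lift k to ℕ using h0
    rw [coeff_toLaurent_natCast, coeff_trunc]

/-! ### The derivative of a Laurent polynomial -/

/-- Multiplication of the `k`-th coefficient by `g k` -/
def mult (g : ℤ → ℝ) : ℝ[T;T⁻¹] →ₗ[ℝ] ℝ[T;T⁻¹] where
  toFun b := b.coeff.sum fun k a => (g k * a) • T k
  map_add' a b := by
    rw [AddMonoidAlgebra.coeff_add]
    exact Finsupp.sum_add_index' (fun k => by simp) fun k x y => by rw [mul_add, add_smul]
  map_smul' c b := by
    rw [AddMonoidAlgebra.coeff_smul, Finsupp.sum_smul_index fun k => by simp, Finsupp.smul_sum,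
      RingHom.id_apply]
    refine Finset.sum_congr rfl fun k _ => ?_
    simp only [smul_smul, mul_left_comm]

theorem mult_C_mul_T (g : ℤ → ℝ) (a : ℝ) (k : ℤ) :
    mult g (LaurentPolynomial.C a * T k) = LaurentPolynomial.C (g k * a) * T k := by
  rw [← LaurentPolynomial.single_eq_C_mul_T]
  change (Finsupp.single k a).sum (fun k a => (g k * a) • (T k : ℝ[T;T⁻¹])) = _
  rw [Finsupp.sum_single_index (by simp), LaurentPolynomial.smul_eq_C_mul]

theorem coeff_mult (g : ℤ → ℝ) (b : ℝ[T;T⁻¹]) (k : ℤ) :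
    (mult g b).coeff k = g k * b.coeff k := by
  induction b using LaurentPolynomial.induction_on' with
  | add p q hp hq => simp only [map_add, AddMonoidAlgebra.coeff_add, Finsupp.add_apply,
      mul_add, hp, hq]
  | C_mul_T j a =>
    rw [mult_C_mul_T, coeff_C_mul, coeff_C_mul, LaurentPolynomial.T_apply]
    split_ifs with h
    · rw [h]; ring
    · ring

/-- The derivation `x d/dx` -/
def euler : Derivation ℝ ℝ[T;T⁻¹] ℝ[T;T⁻¹] :=
  Derivation.mk' (mult fun k => k) fun a b => by
    induction a using LaurentPolynomial.induction_on' with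
    | add p q hp hq => simp only [add_mul, map_add, hp, hq, smul_add, add_smul]; abel
    | C_mul_T i x =>
      induction b using LaurentPolynomial.induction_on' with
      | add p q hp hq => simp only [mul_add, map_add, hp, hq, smul_add, add_smul]; abel
      | C_mul_T j y =>
        have h : LaurentPolynomial.C x * T i * (LaurentPolynomial.C y * T j) =
            LaurentPolynomial.C (x * y) * T (i + j) := by
          rw [LaurentPolynomial.T_add, map_mul]; ring
        rw [h, mult_C_mul_T, mult_C_mul_T, mult_C_mul_T, LaurentPolynomial.T_add]
        push_cast
        simp only [map_mul, map_add, smul_eq_mul]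
        ring

/-- The derivation `d/dx` -/
def D : Derivation ℝ ℝ[T;T⁻¹] ℝ[T;T⁻¹] := (T (-1) : ℝ[T;T⁻¹]) • euler

theorem coeff_D (b : ℝ[T;T⁻¹]) (k : ℤ) : (D b).coeff k = (k + 1) * b.coeff (k + 1) := by
  change (T (-1) * mult (fun k => (k : ℝ)) b).coeff k = _
  rw [coeff_T_mul, coeff_mult]
  push_cast
  ring_nf

theorem D_mul (a b : ℝ[T;T⁻¹]) : D (a * b) = D a * b + a * D b := by
  rw [Derivation.leibniz, smul_eq_mul, smul_eq_mul]; ring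

theorem D_C (a : ℝ) : D (LaurentPolynomial.C a) = 0 := by
  rw [LaurentPolynomial.C_eq_algebraMap, Derivation.map_algebraMap]

theorem D_T (k : ℤ) : D (T k) = LaurentPolynomial.C (k : ℝ) * T (k - 1) := by
  ext j
  rw [coeff_D, coeff_C_mul, LaurentPolynomial.T_apply, LaurentPolynomial.T_apply]
  by_cases h : k = j + 1
  · rw [if_pos h, if_pos (by omega), h]; push_cast; ring
  · rw [if_neg h, if_neg (by omega)]; ring

theorem D_toLaurent (p : ℝ[X]) : D p.toLaurent = (Polynomial.derivative p).toLaurent := by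
  ext k
  rw [coeff_D]
  rcases lt_or_ge k 0 with h0 | h0
  · rw [coeff_toLaurent_neg _ k h0]
    rcases eq_or_ne k (-1) with rfl | h1
    · push_cast; ring
    · rw [coeff_toLaurent_neg _ _ (by omega), mul_zero]
  · lift k to ℕ using h0
    rw [coeff_toLaurent_natCast, Polynomial.coeff_derivative,
      show ((k : ℤ) + 1) = ((k + 1 : ℕ) : ℤ) by push_cast; ring, coeff_toLaurent_natCast]
    push_cast; ring

theorem D_mem_degLE {N K : ℤ} (hK : N - 1 ≤ K) {b : ℝ[T;T⁻¹]} (hb : b ∈ degLE N) :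
    D b ∈ degLE K := fun k hk => by
  rw [coeff_D, hb (k + 1) (by omega), mul_zero]

theorem D_mem_ordGE {N K : ℤ} (hK : K ≤ N - 1) {b : ℝ[T;T⁻¹]} (hb : b ∈ ordGE N) :
    D b ∈ ordGE K := fun k hk => by
  rw [coeff_D, hb (k + 1) (by omega), mul_zero]

/-- The coefficient of x^{-1} in a derivative carries the factor 0, so no pole arises. The general
bound `D_mem_ordGE` would lose one order here. -/
theorem D_mem_ordGE_zero {b : ℝ[T;T⁻¹]} (hb : b ∈ ordGE 0) : D b ∈ ordGE 0 := fun k hk => by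
  rw [coeff_D]
  rcases eq_or_ne k (-1) with rfl | h1
  · push_cast; ring
  · rw [hb (k + 1) (by omega), mul_zero]

theorem coeff_T_one_mul_D (b : ℝ[T;T⁻¹]) (k : ℤ) : (T 1 * D b).coeff k = k * b.coeff k := by
  rw [coeff_T_mul, coeff_D]
  push_cast
  ring_nf

/-- `x b' - N b` has no `N`-th coefficient. -/
theorem euler_sub_mem_degLE {N : ℤ} {b : ℝ[T;T⁻¹]} (hb : b ∈ degLE N) :
    T 1 * D b - (N : ℝ) • b ∈ degLE (N - 1) := fun k hk => by
  rw [AddMonoidAlgebra.coeff_sub, Finsupp.sub_apply, AddMonoidAlgebra.coeff_smul_apply,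
    coeff_T_one_mul_D, smul_eq_mul]
  rcases eq_or_ne k N with rfl | h
  · ring
  · rw [hb k (by omega)]; ring

/-! ### Evaluation -/

theorem evalAt_add (a b : ℝ[T;T⁻¹]) (x : ℝ) : evalAt (a + b) x = evalAt a x + evalAt b x := by
  rw [evalAt, AddMonoidAlgebra.coeff_add]
  exact Finsupp.sum_add_index' (fun k => by simp) fun k y z => by rw [add_mul]

theorem evalAt_smul (c : ℝ) (b : ℝ[T;T⁻¹]) (x : ℝ) : evalAt (c • b) x = c * evalAt b x := by
  rw [evalAt, AddMonoidAlgebra.coeff_smul, Finsupp.sum_smul_index fun k => by simp, evalAt,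
    Finsupp.mul_sum]
  exact Finsupp.sum_congr fun k _ => by rw [mul_assoc]

/-- Evaluation as a linear map -/
def evalL (x : ℝ) : ℝ[T;T⁻¹] →ₗ[ℝ] ℝ where
  toFun b := evalAt b x
  map_add' a b := evalAt_add a b x
  map_smul' c b := evalAt_smul c b x

theorem evalAt_eq_evalL (b : ℝ[T;T⁻¹]) (x : ℝ) : evalAt b x = evalL x b := rfl

theorem evalAt_neg (b : ℝ[T;T⁻¹]) (x : ℝ) : evalAt (-b) x = -evalAt b x := (evalL x).map_neg b

theorem evalAt_sub (a b : ℝ[T;T⁻¹]) (x : ℝ) : evalAt (a - b) x = evalAt a x - evalAt b x :=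
  (evalL x).map_sub a b

theorem evalAt_sum {ι : Type*} (s : Finset ι) (f : ι → ℝ[T;T⁻¹]) (x : ℝ) :
    evalAt (∑ i ∈ s, f i) x = ∑ i ∈ s, evalAt (f i) x := map_sum (evalL x) f s

theorem evalAt_C_mul_T (a : ℝ) (k : ℤ) (x : ℝ) :
    evalAt (LaurentPolynomial.C a * T k) x = a * x ^ k := by
  rw [← LaurentPolynomial.single_eq_C_mul_T]
  change (Finsupp.single k a).sum _ = _
  rw [Finsupp.sum_single_index (by simp)]

theorem evalAt_T (k : ℤ) (x : ℝ) : evalAt (T k) x = x ^ k := by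
  simpa using evalAt_C_mul_T 1 k x

theorem evalAt_C (a x : ℝ) : evalAt (LaurentPolynomial.C a) x = a := by
  simpa using evalAt_C_mul_T a 0 x

theorem evalAt_toLaurent (p : ℝ[X]) (x : ℝ) : evalAt p.toLaurent x = p.eval x := by
  induction p using Polynomial.induction_on' with
  | add p q hp hq => rw [map_add, evalAt_add, hp, hq, Polynomial.eval_add]
  | monomial k a =>
    rw [Polynomial.toLaurent_C_mul_T, evalAt_C_mul_T, Polynomial.eval_monomial, zpow_natCast]

/-- The Laurent polynomials that are regular at `x` -/
def reg (x : ℝ) : Subalgebra ℝ ℝ[T;T⁻¹] where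
  carrier := {b | x ≠ 0 ∨ b ∈ ordGE 0}
  mul_mem' := fun ha hb => by
    rcases ha with h | ha
    · exact Or.inl h
    · rcases hb with h | hb
      · exact Or.inl h
      · exact Or.inr (mul_mem_ordGE (by norm_num) ha hb)
  add_mem' := fun ha hb => by
    rcases ha with h | ha
    · exact Or.inl h
    · rcases hb with h | hb
      · exact Or.inl h
      · exact Or.inr (add_mem ha hb)
  algebraMap_mem' := fun a => Or.inr (C_mem_ordGE a)

theorem toLaurent_mem_reg (p : ℝ[X]) (x : ℝ) : p.toLaurent ∈ reg x :=
  Or.inr (toLaurent_mem_ordGE p)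

theorem D_mem_reg {b : ℝ[T;T⁻¹]} {x : ℝ} (hb : b ∈ reg x) : D b ∈ reg x :=
  hb.imp_right D_mem_ordGE_zero

/-- In Lean a negative power of 0 is 0, so evaluation at x = 0 is multiplicative only away from
poles. This matters because m = 0 allows x = 0 and some λᵢ = 0. -/
theorem evalAt_mul {x : ℝ} {a b : ℝ[T;T⁻¹]} (ha : a ∈ reg x) (hb : b ∈ reg x) :
    evalAt (a * b) x = evalAt a x * evalAt b x := by
  by_cases hx : x = 0
  · have ha' := ha.resolve_left (not_not.2 hx)
    have hb' := hb.resolve_left (not_not.2 hx)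
    rw [← toLaurent_trunc ha', ← toLaurent_trunc hb', ← map_mul, evalAt_toLaurent,
      evalAt_toLaurent, evalAt_toLaurent, Polynomial.eval_mul]
  · clear ha hb
    induction a using LaurentPolynomial.induction_on' with
    | add p q hp hq => simp only [add_mul, evalAt_add, hp, hq]
    | C_mul_T i y =>
      induction b using LaurentPolynomial.induction_on' with
      | add p q hp hq => simp only [mul_add, evalAt_add, hp, hq]
      | C_mul_T j z =>
        have h : LaurentPolynomial.C y * T i * (LaurentPolynomial.C z * T j) =
            LaurentPolynomial.C (y * z) * T (i + j) := by
          rw [LaurentPolynomial.T_add, map_mul]; ring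
        rw [h, evalAt_C_mul_T, evalAt_C_mul_T, evalAt_C_mul_T, zpow_add₀ hx]
        ring

theorem hasDerivAt_evalAt {x : ℝ} {b : ℝ[T;T⁻¹]} (hb : b ∈ reg x) :
    HasDerivAt (fun y => evalAt b y) (evalAt (D b) x) x := by
  by_cases hx : x = 0
  · have hb' := hb.resolve_left (not_not.2 hx)
    rw [← toLaurent_trunc hb', D_toLaurent]
    simp only [evalAt_toLaurent]
    exact Polynomial.hasDerivAt _ x
  · clear hb
    induction b using LaurentPolynomial.induction_on' with
    | add p q hp hq =>
      simp only [map_add, evalAt_add]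
      exact hp.add hq
    | C_mul_T j z =>
      rw [D_mul, D_C, zero_mul, zero_add, D_T, ← mul_assoc, ← map_mul]
      simp only [evalAt_C_mul_T]
      rw [mul_assoc]
      exact (hasDerivAt_zpow j x (Or.inl hx)).const_mul z

/-! ### Positive and negative parts -/

/-- The positive part for `σ = 0`, minus the negative part for `σ = 1` -/
def tau (σ : ℝ) : ℝ[T;T⁻¹] →ₗ[ℝ] ℝ[T;T⁻¹] := mult fun i => (if 0 ≤ i then 1 else 0) - σ

theorem coeff_tau (σ : ℝ) (b : ℝ[T;T⁻¹]) (k : ℤ) :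
    (tau σ b).coeff k = ((if 0 ≤ k then 1 else 0) - σ) * b.coeff k := coeff_mult _ b k

/-- Only the coefficient of x^{-1} crosses the threshold under multiplication by x. The part of
`tau` depending on σ is a multiple of the identity and commutes with everything, so the correction
does not involve σ. -/
theorem tau_linear_mul (σ a : ℝ) (b : ℝ[T;T⁻¹]) :
    tau σ ((T 1 - LaurentPolynomial.C a) * b) =
      (T 1 - LaurentPolynomial.C a) * tau σ b + LaurentPolynomial.C (b.coeff (-1)) := by
  ext k
  rw [coeff_tau, sub_mul _ _ b, sub_mul _ _ (tau σ b), AddMonoidAlgebra.coeff_add, Finsupp.add_apply,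
    AddMonoidAlgebra.coeff_sub, Finsupp.sub_apply, AddMonoidAlgebra.coeff_sub, Finsupp.sub_apply,
    coeff_T_mul, coeff_T_mul, coeff_C_mul, coeff_C_mul, coeff_tau, coeff_tau,
    LaurentPolynomial.C_apply]
  rcases eq_or_ne k 0 with rfl | h
  · simp; ring
  · have h1 : (0 ≤ k - 1) ↔ (0 ≤ k) := by omega
    simp only [h1, if_neg h]; ring

theorem tau_zero_mem_ordGE (b : ℝ[T;T⁻¹]) : tau 0 b ∈ ordGE 0 := fun k hk => by
  rw [coeff_tau, if_neg (by omega)]; ring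

theorem tau_zero_sub_mem_degLE (b : ℝ[T;T⁻¹]) : b - tau 0 b ∈ degLE (-1) := fun k hk => by
  rw [AddMonoidAlgebra.coeff_sub, Finsupp.sub_apply, coeff_tau, if_pos (by omega)]; ring

theorem tau_one_mem_degLE (b : ℝ[T;T⁻¹]) : tau 1 b ∈ degLE (-1) := fun k hk => by
  rw [coeff_tau, if_pos (by omega)]; ring

theorem tau_one_add_mem_ordGE (b : ℝ[T;T⁻¹]) : b + tau 1 b ∈ ordGE 0 := fun k hk => by
  rw [AddMonoidAlgebra.coeff_add, Finsupp.add_apply, coeff_tau, if_neg (by omega)]; ring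

theorem tau_mem_degLE (σ : ℝ) {N : ℤ} {b : ℝ[T;T⁻¹]} (hb : b ∈ degLE N) : tau σ b ∈ degLE N :=
  fun k hk => by rw [coeff_tau, hb k hk, mul_zero]

theorem tau_mem_ordGE (σ : ℝ) {N : ℤ} {b : ℝ[T;T⁻¹]} (hb : b ∈ ordGE N) : tau σ b ∈ ordGE N :=
  fun k hk => by rw [coeff_tau, hb k hk, mul_zero]

/-- `phi σ k p`: the part `tau σ` of `p / x^k` -/
def phi (σ : ℝ) (k : ℕ) (p : ℝ[X]) : ℝ[T;T⁻¹] := tau σ (T (-(k : ℤ)) * p.toLaurent)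

theorem phi_C_mul (σ : ℝ) (k : ℕ) (a : ℝ) (p : ℝ[X]) :
    phi σ k (Polynomial.C a * p) = LaurentPolynomial.C a * phi σ k p := by
  rw [phi, map_mul Polynomial.toLaurent, Polynomial.toLaurent_C, mul_left_comm,
    ← LaurentPolynomial.smul_eq_C_mul,
    map_smul, LaurentPolynomial.smul_eq_C_mul]; rfl

theorem phi_sub (σ : ℝ) (k : ℕ) (p q : ℝ[X]) : phi σ k (p - q) = phi σ k p - phi σ k q := by
  rw [phi, map_sub, mul_sub, map_sub]; rfl

theorem coeff_phi (σ : ℝ) (k : ℕ) (p : ℝ[X]) (j : ℤ) :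
    (phi σ k p).coeff j = ((if 0 ≤ j then 1 else 0) - σ) * p.toLaurent.coeff (j + k) := by
  rw [phi, coeff_tau, coeff_T_mul, sub_neg_eq_add]

/-- The rule from which all properties of φ follow. Since the correction is the same for both
truncations, the two ranges of r never need separate computations at the nodes. -/
theorem phi_linear_mul (σ : ℝ) {k : ℕ} (hk : 1 ≤ k) (a : ℝ) (p : ℝ[X]) :
    phi σ k ((Polynomial.X - Polynomial.C a) * p) =
      (T 1 - LaurentPolynomial.C a) * phi σ k p + LaurentPolynomial.C (p.coeff (k - 1)) := by
  rw [phi, map_mul Polynomial.toLaurent, map_sub Polynomial.toLaurent,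
    Polynomial.toLaurent_X, Polynomial.toLaurent_C, mul_left_comm,
    tau_linear_mul, coeff_T_mul, ← coeff_toLaurent_natCast p (k - 1)]
  congr 4
  omega

end PainleveLax
end

/-! ### Interpolation at the λᵢ, the quasi-Stäckel terms, and the computation of B_r -/

noncomputable section

namespace PainleveLax

open LaurentPolynomial (T C)

variable {n : ℕ}

/-! ### The polynomial `u` and its cofactors -/

/-- `∏_{k ≠ i} (x - λₖ)` -/
def uE (lam : Fin n → ℝ) (i : Fin n) : ℝ[X] :=
  ∏ k ∈ Finset.univ.erase i, (Polynomial.X - Polynomial.C (lam k))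

/-- `∏_{k ≠ i, j} (x - λₖ)` -/
def uEE (lam : Fin n → ℝ) (i j : Fin n) : ℝ[X] :=
  ∏ k ∈ (Finset.univ.erase i).erase j, (Polynomial.X - Polynomial.C (lam k))

theorem u_eq_mul (lam : Fin n → ℝ) (i : Fin n) :
    u lam = (Polynomial.X - Polynomial.C (lam i)) * uE lam i :=
  (Finset.mul_prod_erase _ _ (Finset.mem_univ i)).symm

theorem uE_eq_mul (lam : Fin n → ℝ) {i j : Fin n} (h : j ≠ i) :
    uE lam i = (Polynomial.X - Polynomial.C (lam j)) * uEE lam i j :=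
  (Finset.mul_prod_erase _ _ (Finset.mem_erase.2 ⟨h, Finset.mem_univ j⟩)).symm

theorem uEE_comm (lam : Fin n → ℝ) (i j : Fin n) : uEE lam i j = uEE lam j i := by
  rw [uEE, uEE, Finset.erase_right_comm]

theorem u_monic (lam : Fin n → ℝ) : (u lam).Monic := Polynomial.monic_prod_X_sub_C _ _

theorem natDegree_u (lam : Fin n → ℝ) : (u lam).natDegree = n := by
  rw [u, Polynomial.natDegree_finsetProd_X_sub_C_eq_card, Finset.card_univ, Fintype.card_fin]

theorem degree_u (lam : Fin n → ℝ) : (u lam).degree = n := by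
  rw [Polynomial.degree_eq_natDegree (u_monic lam).ne_zero, natDegree_u]

theorem uE_monic (lam : Fin n → ℝ) (i : Fin n) : (uE lam i).Monic :=
  Polynomial.monic_prod_X_sub_C _ _

theorem natDegree_uE (lam : Fin n → ℝ) (i : Fin n) : (uE lam i).natDegree = n - 1 := by
  rw [uE, Polynomial.natDegree_finsetProd_X_sub_C_eq_card,
    Finset.card_erase_of_mem (Finset.mem_univ i), Finset.card_univ, Fintype.card_fin]

theorem degree_uE_lt (lam : Fin n → ℝ) (i : Fin n) : (uE lam i).degree < n := by
  rw [Polynomial.degree_eq_natDegree (uE_monic lam i).ne_zero, natDegree_uE]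
  have := i.pos
  exact_mod_cast (by omega : n - 1 < n)

theorem coeff_u_self (lam : Fin n → ℝ) : (u lam).coeff n = 1 := by
  have h := (u_monic lam).coeff_natDegree
  rwa [natDegree_u] at h

theorem toLaurent_u_mem (lam : Fin n → ℝ) : (u lam).toLaurent ∈ degLE n :=
  toLaurent_mem_degLE_of_natDegree (by rw [natDegree_u])

theorem coeff_toLaurent_u (lam : Fin n → ℝ) : (u lam).toLaurent.coeff (n : ℤ) = 1 := by
  rw [coeff_toLaurent_natCast, coeff_u_self]

theorem toLaurent_u_ne_zero (lam : Fin n → ℝ) : (u lam).toLaurent ≠ 0 :=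
  Polynomial.toLaurent_ne_zero.2 (u_monic lam).ne_zero

theorem eval_u (lam : Fin n → ℝ) (i : Fin n) : (u lam).eval (lam i) = 0 := by
  rw [u_eq_mul lam i]; simp

theorem eval_uE_self (lam : Fin n → ℝ) (i : Fin n) : (uE lam i).eval (lam i) = Delta lam i := by
  rw [uE, Polynomial.eval_prod, Delta]; simp

theorem eval_uE_of_ne (lam : Fin n → ℝ) {i j : Fin n} (h : j ≠ i) :
    (uE lam i).eval (lam j) = 0 := by
  rw [uE_eq_mul lam h]; simp

theorem Delta_eq_mul (lam : Fin n → ℝ) {i j : Fin n} (h : j ≠ i) :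
    Delta lam i = (lam i - lam j) * (uEE lam i j).eval (lam i) := by
  rw [← eval_uE_self, uE_eq_mul lam h]; simp

theorem Delta_ne_zero {lam : Fin n → ℝ} (h : Function.Injective lam) (i : Fin n) :
    Delta lam i ≠ 0 := by
  refine Finset.prod_ne_zero_iff.2 fun j hj => sub_ne_zero.2 fun h' => ?_
  exact (Finset.mem_erase.1 hj).1 (h h').symm

theorem eval_derivative_u (lam : Fin n → ℝ) (i : Fin n) :
    (Polynomial.derivative (u lam)).eval (lam i) = Delta lam i := by
  rw [u_eq_mul lam i]; simp [eval_uE_self]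

theorem coeff_zero_u_ne_zero {lam : Fin n → ℝ} (h : ∀ i, lam i ≠ 0) : (u lam).coeff 0 ≠ 0 := by
  rw [Polynomial.coeff_zero_eq_eval_zero, u, Polynomial.eval_prod]
  refine Finset.prod_ne_zero_iff.2 fun i _ => ?_
  simpa using h i

/-- The Lagrange basis polynomials are the cofactors `uE lam i` divided by `Delta lam i`. In this
form the dependence on λ can be differentiated and the rule for `phi` can be applied. -/
theorem interpolate_eq_sum {lam : Fin n → ℝ} (h : Function.Injective lam) (a : Fin n → ℝ) :
    Lagrange.interpolate Finset.univ lam a =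
      ∑ i, Polynomial.C (a i / Delta lam i) * uE lam i := by
  symm
  refine Lagrange.eq_interpolate_of_eval_eq a h.injOn ?_ ?_
  · rw [Finset.card_univ, Fintype.card_fin, ← Polynomial.mem_degreeLT]
    refine Submodule.sum_mem _ fun i _ => ?_
    rw [← Polynomial.smul_eq_C_mul]
    exact Submodule.smul_mem _ _ (Polynomial.mem_degreeLT.2 (degree_uE_lt lam i))
  · intro j _
    rw [Polynomial.eval_finsetSum, Finset.sum_eq_single j]
    · rw [Polynomial.eval_mul, Polynomial.eval_C, eval_uE_self,
        div_mul_cancel₀ _ (Delta_ne_zero h j)]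
    · intro i _ hij
      rw [Polynomial.eval_mul, eval_uE_of_ne lam hij.symm, mul_zero]
    · simp

theorem degree_interpolate_lt {lam : Fin n → ℝ} (h : Function.Injective lam) (a : Fin n → ℝ) :
    (Lagrange.interpolate Finset.univ lam a).degree < n := by
  simpa using Lagrange.degree_interpolate_lt a (s := Finset.univ) h.injOn

theorem eval_interpolate {lam : Fin n → ℝ} (h : Function.Injective lam) (a : Fin n → ℝ)
    (i : Fin n) : (Lagrange.interpolate Finset.univ lam a).eval (lam i) = a i :=
  Lagrange.eval_interpolate_at_node a h.injOn (Finset.mem_univ i)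

theorem eq_interpolate_of_eval {lam : Fin n → ℝ} (h : Function.Injective lam) {a : Fin n → ℝ}
    {p : ℝ[X]} (hp : p.degree < n) (hpa : ∀ i, p.eval (lam i) = a i) :
    p = Lagrange.interpolate Finset.univ lam a :=
  Lagrange.eq_interpolate_of_eval_eq a h.injOn (by simpa using hp) fun i _ => hpa i

/-- A polynomial of degree less than `n` in terms of its values at the `λᵢ` -/
theorem eq_sum_of_degree_lt {lam : Fin n → ℝ} (h : Function.Injective lam) {p : ℝ[X]}
    (hp : p.degree < n) :
    p = ∑ i, Polynomial.C (p.eval (lam i) / Delta lam i) * uE lam i := by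
  rw [← interpolate_eq_sum h]
  exact eq_interpolate_of_eval h hp fun _ => rfl

/-- A Laurent polynomial with exponents in `[0, n)` that vanishes at the `λᵢ` is zero. -/
theorem eq_zero_of_evalAt {lam : Fin n → ℝ} (h : Function.Injective lam) {b : ℝ[T;T⁻¹]}
    (hd : b ∈ degLE (n - 1)) (ho : b ∈ ordGE 0) (hb : ∀ i, evalAt b (lam i) = 0) : b = 0 := by
  rw [← toLaurent_trunc ho]
  have h1 : (LaurentPolynomial.trunc b).degree < n := by
    rw [Polynomial.degree_lt_iff_coeff_zero]
    intro k hk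
    rw [coeff_trunc]
    exact hd k (by omega)
  rw [eq_sum_of_degree_lt h h1]
  have h2 : ∀ i, (LaurentPolynomial.trunc b).eval (lam i) = 0 := fun i => by
    rw [← evalAt_toLaurent, toLaurent_trunc ho, hb]
  simp [h2]

/-- `∑ᵢ b(λᵢ)/Δᵢ` is the coefficient of `x^{n-1}` for `b` with exponents in `[0, n)`. -/
theorem sum_evalAt_div_Delta {lam : Fin n → ℝ} (h : Function.Injective lam) {b : ℝ[T;T⁻¹]}
    (hd : b ∈ degLE (n - 1)) (ho : b ∈ ordGE 0) (hn : 1 ≤ n) :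
    ∑ i, evalAt b (lam i) / Delta lam i = b.coeff (n - 1) := by
  have h1 : (LaurentPolynomial.trunc b).degree < n := by
    rw [Polynomial.degree_lt_iff_coeff_zero]
    intro k hk
    rw [coeff_trunc]
    exact hd k (by omega)
  have h2 : ∀ i, (LaurentPolynomial.trunc b).eval (lam i) = evalAt b (lam i) := fun i => by
    rw [← evalAt_toLaurent, toLaurent_trunc ho]
  have h3 : b.coeff (n - 1) = (LaurentPolynomial.trunc b).coeff (n - 1) := by
    rw [coeff_trunc]; congr 1; omega
  rw [h3, eq_sum_of_degree_lt h h1, Polynomial.finsetSum_coeff]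
  refine Finset.sum_congr rfl fun i _ => ?_
  have h4 := (uE_monic lam i).coeff_natDegree
  rw [natDegree_uE] at h4
  rw [Polynomial.coeff_C_mul, h4, mul_one, h2]

/-! ### The functions `phi` for the two ranges of the index -/

/-- The two ranges `{1} ∪ I₁` (with `σ = 0`) and `I₂` (with `σ = 1`) of the index `r` -/
def Sector (n m r : ℕ) (σ : ℝ) : Prop :=
  (σ = 0 ∧ 1 ≤ r ∧ r ≤ n ∧ (r = 1 ∨ r + m ≤ n + 1)) ∨ (σ = 1 ∧ 2 ≤ r ∧ r ≤ n ∧ n + 2 ≤ r + m)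

theorem Sector.bounds {m r : ℕ} {σ : ℝ} (h : Sector n m r σ) : 1 ≤ r ∧ r ≤ n := by
  rcases h with ⟨-, h1, h2, -⟩ | ⟨-, h1, h2, -⟩ <;> omega

theorem exists_sector (m : ℕ) {r : ℕ} (h1 : 1 ≤ r) (h2 : r ≤ n) : ∃ σ, Sector n m r σ := by
  by_cases h : r = 1 ∨ r + m ≤ n + 1
  · exact ⟨0, Or.inl ⟨rfl, h1, h2, h⟩⟩
  · exact ⟨1, Or.inr ⟨rfl, by omega, h2, by omega⟩⟩

/-- A pole at 0 occurs only for σ = 1, and that range is empty unless m > 0; then xᵐ ≠ 0 excludes x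
= 0. -/
theorem Sector.phi_mem_reg {m r : ℕ} {σ : ℝ} (h : Sector n m r σ) {x : ℝ} (hx : x ^ m ≠ 0) (k : ℕ)
    (p : ℝ[X]) : phi σ k p ∈ reg x := by
  rcases h with ⟨rfl, -⟩ | ⟨-, h1, h2, h3⟩
  · exact Or.inr (tau_zero_mem_ordGE _)
  · refine Or.inl fun h0 => hx ?_
    rw [h0, zero_pow (by omega)]

/-- `phi` of `u` in terms of `phi` of a cofactor -/
theorem phi_u (σ : ℝ) {r : ℕ} (h2 : r ≤ n) (lam : Fin n → ℝ) (i : Fin n) :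
    phi σ (n + 1 - r) (u lam) = (T 1 - C (lam i)) * phi σ (n + 1 - r) (uE lam i) +
      C ((uE lam i).coeff (n - r)) := by
  rw [u_eq_mul lam i, phi_linear_mul σ (by omega), show n + 1 - r - 1 = n - r by omega]

theorem phi_uE (σ : ℝ) {r : ℕ} (h2 : r ≤ n) (lam : Fin n → ℝ) {i j : Fin n} (h : j ≠ i) :
    phi σ (n + 1 - r) (uE lam i) = (T 1 - C (lam j)) * phi σ (n + 1 - r) (uEE lam i j) +
      C ((uEE lam i j).coeff (n - r)) := by
  rw [uE_eq_mul lam h, phi_linear_mul σ (by omega), show n + 1 - r - 1 = n - r by omega]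

theorem linear_mem_reg (a x : ℝ) : T 1 - C a ∈ reg x :=
  Or.inr (sub_mem (T_mem_ordGE (by norm_num)) (C_mem_ordGE a))

theorem evalAt_linear (a x : ℝ) : evalAt (T 1 - C a) x = x - a := by
  rw [evalAt_sub, evalAt_T, evalAt_C, zpow_one]

theorem C_mem_reg (a x : ℝ) : C a ∈ reg x := Or.inr (C_mem_ordGE a)

theorem D_linear (a : ℝ) : D (T 1 - C a) = 1 := by
  rw [map_sub, D_T, D_C]; simp

section

variable {m r : ℕ} {σ : ℝ} {lam : Fin n → ℝ}

/-- The factor x - λᵢ of u removes everything but the constant in `phi_u`. That constant is the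
weight of the i-th node in the coefficient of x^{n-r} of an interpolation polynomial. -/
theorem evalAt_phi_u (h : Sector n m r σ) (hlam : lam ∈ config n m) (i : Fin n) :
    evalAt (phi σ (n + 1 - r) (u lam)) (lam i) = (uE lam i).coeff (n - r) := by
  rw [phi_u σ h.bounds.2 lam i, evalAt_add, evalAt_C,
    evalAt_mul (linear_mem_reg _ _) (h.phi_mem_reg (hlam.2 i) _ _), evalAt_linear]
  ring

/-- Differentiating (x - λᵢ)·phi(`uE`) + const at λᵢ leaves the cofactor. This removes a derivative
from W_r and makes it accessible to differentiation in λ. -/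
theorem evalAt_D_phi_u (h : Sector n m r σ) (hlam : lam ∈ config n m) (i : Fin n) :
    evalAt (D (phi σ (n + 1 - r) (u lam))) (lam i) =
      evalAt (phi σ (n + 1 - r) (uE lam i)) (lam i) := by
  have h1 := h.phi_mem_reg (hlam.2 i) (n + 1 - r) (uE lam i)
  rw [phi_u σ h.bounds.2 lam i, map_add, D_C, add_zero, D_mul, D_linear, one_mul, evalAt_add,
    evalAt_mul (linear_mem_reg _ _) (D_mem_reg h1), evalAt_linear]
  ring

/-- The inner sum of W_r for r in I₁, up to the factor λᵢᵐ: the weights k come from differentiating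
xᵏ. For r = 1 the sum is empty, in agreement with W₁ = 0. -/
theorem D_phi_zero (h1 : 1 ≤ r) (h2 : r ≤ n) :
    D (phi 0 (n + 1 - r) (u lam)) =
      ∑ k ∈ Finset.Icc 1 (r - 1), C ((k : ℝ) * rho lam (r - k - 1)) * T ((k : ℤ) - 1) := by
  ext j
  rw [coeff_D, coeff_phi, AddMonoidAlgebra.coeff_sum, Finset.sum_apply']
  simp only [coeff_C_mul, LaurentPolynomial.T_apply, mul_ite, mul_one, mul_zero, sub_zero]
  by_cases hj : 0 ≤ j ∧ j + 2 ≤ r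
  · obtain ⟨k, rfl⟩ : ∃ k : ℕ, j = (k : ℤ) := ⟨j.toNat, by omega⟩
    rw [Finset.sum_eq_single (k + 1), if_pos (by omega), if_pos (by omega), rho, one_mul,
      show ((k : ℤ) + 1 + (n + 1 - r : ℕ)) = ((n - (r - (k + 1) - 1) : ℕ) : ℤ) by omega,
      coeff_toLaurent_natCast]
    · push_cast; ring
    · intro b hb hbk
      rw [if_neg (by omega)]
    · intro hk
      exact absurd (Finset.mem_Icc.2 ⟨by omega, by omega⟩) hk
  · rw [Finset.sum_eq_zero]
    · rcases lt_trichotomy j (-1) with h0 | h0 | h0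
      · rw [if_neg (by omega)]; ring
      · rw [h0]; push_cast; ring
      · rw [toLaurent_u_mem lam _ (by omega), mul_zero, mul_zero]
    · intro k hk
      rw [Finset.mem_Icc] at hk
      rw [if_neg (by omega)]

/-- The inner sum of W_r for r in I₂, up to the factor λᵢᵐ. The sign in `tau 1` cancels the one from
differentiating x^{-k}. -/
theorem D_phi_one (h1 : 1 ≤ r) (h2 : r ≤ n) :
    D (phi 1 (n + 1 - r) (u lam)) =
      ∑ k ∈ Finset.Icc 1 (n - r + 1), C ((k : ℝ) * rho lam (r + k - 1)) * T (-(k : ℤ) - 1) := by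
  ext j
  rw [coeff_D, coeff_phi, AddMonoidAlgebra.coeff_sum, Finset.sum_apply']
  simp only [coeff_C_mul, LaurentPolynomial.T_apply, mul_ite, mul_one, mul_zero]
  by_cases hj : j ≤ -2 ∧ 0 ≤ j + n + 2 - r
  · obtain ⟨k, rfl⟩ : ∃ k : ℕ, j = -(k : ℤ) - 1 := ⟨(-j - 1).toNat, by omega⟩
    rw [Finset.sum_eq_single k, if_neg (by omega), if_pos (by omega), rho,
      show (-(k : ℤ) - 1 + 1 + (n + 1 - r : ℕ)) = ((n - (r + k - 1) : ℕ) : ℤ) by omega,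
      coeff_toLaurent_natCast]
    · push_cast; ring
    · intro b hb hbk
      rw [if_neg (by omega)]
    · intro hk
      exact absurd (Finset.mem_Icc.2 ⟨by omega, by omega⟩) hk
  · rw [Finset.sum_eq_zero]
    · rcases lt_or_ge (-2) j with h0 | h0
      · rcases eq_or_ne j (-1) with rfl | h3
        · push_cast; ring
        · rw [if_pos (by omega)]; ring
      · rw [toLaurent_mem_ordGE (u lam) _ (by omega), mul_zero, mul_zero]
    · intro k hk
      rw [Finset.mem_Icc] at hk
      rw [if_neg (by omega)]

/-- The quasi-Stäckel terms in terms of `phi` -/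
theorem W_eq (h : Sector n m r σ) (hlam : lam ∈ config n m) (mu : Fin n → ℝ) :
    W m r lam mu = -∑ i, lam i ^ m * mu i *
      (evalAt (phi σ (n + 1 - r) (uE lam i)) (lam i) / Delta lam i) := by
  have key : W m r lam mu = -∑ i, lam i ^ m * mu i *
      (evalAt (D (phi σ (n + 1 - r) (u lam))) (lam i) / Delta lam i) := by
    rcases h with ⟨rfl, h1, h2, h3⟩ | ⟨rfl, h1, h2, h3⟩
    · rw [D_phi_zero h1 h2]
      have h4 : ¬ I2 n m r := fun h => by have := h.1; have := h.2.2; omega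
      by_cases h5 : I1 n m r
      · rw [W, if_pos h5]
        congr 1
        refine Finset.sum_congr rfl fun i _ => ?_
        rw [evalAt_sum, Finset.sum_div, Finset.mul_sum, Finset.sum_mul]
        refine Finset.sum_congr rfl fun k hk => ?_
        rw [Finset.mem_Icc] at hk
        rw [evalAt_C_mul_T, show ((k : ℤ) - 1) = ((k - 1 : ℕ) : ℤ) by omega, zpow_natCast,
          show m + k - 1 = m + (k - 1) by omega, pow_add]
        ring
      · have h6 : r = 1 := by
          by_contra h7
          exact h5 ⟨by omega, h2, by omega⟩
        rw [W, if_neg h5, if_neg h4, h6]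
        simp [evalAt_eq_evalL]
    · rw [D_phi_one (by omega) h2]
      have h4 : ¬ I1 n m r := fun h => by have := h.2.2; omega
      have h5 : I2 n m r := ⟨h1, h2, h3⟩
      rw [W, if_neg h4, if_pos h5]
      congr 1
      refine Finset.sum_congr rfl fun i _ => ?_
      rw [evalAt_sum, Finset.sum_div, Finset.mul_sum, Finset.sum_mul]
      refine Finset.sum_congr rfl fun k hk => ?_
      have hi : lam i ≠ 0 := fun h0 => hlam.2 i (by rw [h0, zero_pow (by omega)])
      rw [evalAt_C_mul_T, show ((m : ℤ) - k - 1) = (m : ℤ) + (-(k : ℤ) - 1) by ring,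
        zpow_add₀ hi, zpow_natCast]
      ring
  rw [key]
  simp only [evalAt_D_phi_u h hlam]

end

/-! ### Computing `[b/a]₊` -/

/-- By uniqueness, any decomposition of the right shape computes `[b/a]₊`. If a(0) ≠ 0, the pole
condition is automatic, as x is then coprime to a; otherwise b and q must be polynomials. -/
theorem plusPart_eq {a r : ℝ[X]} {q b : ℝ[T;T⁻¹]} (ha : a.Monic) (hr : r.degree < a.degree)
    (hb : b = q * a.toLaurent + r.toLaurent)
    (h : (b ∈ ordGE 0 ∧ q ∈ ordGE 0) ∨ a.coeff 0 ≠ 0) : plusPart b a = q := by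
  have hab : (∃ p : ℝ[X], b = p.toLaurent) ∨ a.coeff 0 ≠ 0 :=
    h.imp_left fun h => ⟨_, (toLaurent_trunc h.1).symm⟩
  refine (existsUnique_isPlusPart b a ha hab).unique (isPlusPart_plusPart b a ha hab)
    ⟨⟨r, hr, hb⟩, fun k ⟨p, hp⟩ => ?_⟩
  rcases h with h | h
  · refine ⟨LaurentPolynomial.trunc (T k * q), (toLaurent_trunc ?_).symm⟩
    exact mul_mem_ordGE (by omega : (0 : ℤ) ≤ k + 0) (T_mem_ordGE le_rfl) h.2
  · refine toLaurent_of_mul _ a (p - Polynomial.X ^ k * r) h ?_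
    rw [map_sub, map_mul, ← hp, hb, Polynomial.toLaurent_X_pow]
    ring

theorem plusPart_spec {a : ℝ[X]} {b : ℝ[T;T⁻¹]} {N : ℕ} (ha : a.Monic)
    (hb : b ∈ ordGE (-(N : ℤ))) (h : N = 0 ∨ a.coeff 0 ≠ 0) :
    plusPart b a ∈ ordGE (-(N : ℤ)) ∧ ∃ r : ℝ[X], r.degree < a.degree ∧
      b = plusPart b a * a.toLaurent + r.toLaurent := by
  have hab : (∃ p : ℝ[X], b = p.toLaurent) ∨ a.coeff 0 ≠ 0 := by
    refine h.imp_left fun h => ?_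
    rw [h] at hb
    exact ⟨_, (toLaurent_trunc (by simpa using hb)).symm⟩
  obtain ⟨h1, h2⟩ := isPlusPart_plusPart b a ha hab
  refine ⟨?_, h1⟩
  obtain ⟨p, hp⟩ := h2 N ⟨LaurentPolynomial.trunc (T N * b),
    (toLaurent_trunc (mul_mem_ordGE (by omega : (0 : ℤ) ≤ N + -N) (T_mem_ordGE le_rfl) hb)).symm⟩
  intro k hk
  have h3 := toLaurent_mem_ordGE p (k + N) (by omega)
  rw [← hp, coeff_T_mul] at h3
  simpa using h3

/-- Here the divisor is a power of x, so the remainder is xᵏ times the negative part of u/xᵏ, which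
is a polynomial of degree less than k. -/
theorem uPlus_eq {r : ℕ} (lam : Fin n → ℝ) :
    uPlus r lam = phi 0 (n + 1 - r) (u lam) := by
  set k := n + 1 - r
  have h1 : T k * (T (-(k : ℤ)) * (u lam).toLaurent - phi 0 k (u lam)) ∈ degLE ((k : ℤ) - 1) :=
    mul_mem_degLE (by omega : (k : ℤ) + -1 ≤ k - 1) (T_mem_degLE le_rfl)
      (tau_zero_sub_mem_degLE _)
  have h2 : (T k : ℝ[T;T⁻¹]) * T (-(k : ℤ)) = 1 := by
    rw [← LaurentPolynomial.T_add, add_neg_cancel, LaurentPolynomial.T_zero]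
  have h3 : T k * (T (-(k : ℤ)) * (u lam).toLaurent - phi 0 k (u lam)) =
      (u lam).toLaurent - phi 0 k (u lam) * T k := by linear_combination (u lam).toLaurent * h2
  rw [h3] at h1
  have h4 : (u lam).toLaurent - phi 0 k (u lam) * T k ∈ ordGE 0 :=
    sub_mem (toLaurent_mem_ordGE _)
      (mul_mem_ordGE (by omega : (0 : ℤ) ≤ 0 + k) (tau_zero_mem_ordGE _) (T_mem_ordGE le_rfl))
  refine plusPart_eq (r := LaurentPolynomial.trunc ((u lam).toLaurent - phi 0 k (u lam) * T k))
    (Polynomial.monic_X_pow k) ?_ ?_ (Or.inl ⟨toLaurent_mem_ordGE _, tau_zero_mem_ordGE _⟩)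
  · rw [Polynomial.degree_X_pow, Polynomial.degree_lt_iff_coeff_zero]
    intro j hj
    rw [coeff_trunc, h1 j (by omega)]
  · rw [toLaurent_trunc h4, Polynomial.toLaurent_X_pow]
    ring

theorem tau_one_eq (b : ℝ[T;T⁻¹]) : tau 1 b = tau 0 b - b := by
  ext k
  rw [AddMonoidAlgebra.coeff_sub, Finsupp.sub_apply, coeff_tau, coeff_tau]
  ring

theorem uMinus_eq {r : ℕ} (h2 : r ≤ n) (lam : Fin n → ℝ) :
    uMinus r lam = -phi 1 (n + 1 - r) (u lam) := by
  rw [uMinus, uPlus_eq, phi, phi, tau_one_eq,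
    show -((n : ℤ) + 1 - r) = -((n + 1 - r : ℕ) : ℤ) by omega]
  ring

/-- The minus sign in the definition of B_r on I₂ is absorbed by the sign convention of `tau 1`;
this is what permits a uniform treatment. -/
theorem B_eq {m r : ℕ} {σ : ℝ} (h : Sector n m r σ) (c : ℤ → ℝ) (lam mu : Fin n → ℝ) :
    B m c r lam mu = (1 / 2 : ℝ) • phi σ (n + 1 - r) (u lam) • lax m c lam mu := by
  rcases h with ⟨rfl, h1, h2, h3⟩ | ⟨rfl, h1, h2, h3⟩
  · rw [B, if_pos, uPlus_eq]
    by_cases h6 : r = 1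
    · exact Or.inl h6
    · exact Or.inr ⟨by omega, h2, by omega⟩
  · rw [B, if_neg, uMinus_eq h2, neg_smul, neg_smul, smul_neg, neg_neg]
    rintro (h6 | h6)
    · omega
    · have := h6.2.2; omega

end PainleveLax
end

/-! ### Explicit polynomial form of the Lax matrix and of the matrices U_r -/

noncomputable section

namespace PainleveLax

open LaurentPolynomial (T C)

variable {n : ℕ}

/-! ### The potentials as polynomials -/

/-- `∑_γ d_γ x^γ` -/
def magPoly (n : ℕ) (d : ℕ → ℝ) : ℝ[X] :=
  ∑ γ ∈ Finset.range (n + 2), Polynomial.C (d γ) * Polynomial.X ^ γ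

/-- `xᵐ ∑_α c_α x^α` in terms of the coefficients of the magnetic potentials -/
def potPoly (n m : ℕ) (d : ℕ → ℝ) (e : ℝ) : ℝ[X] :=
  Polynomial.C (1 / 2) * magPoly n d ^ 2 + Polynomial.C (e - d (n + 1)) * Polynomial.X ^ (n + m)

theorem coeff_magPoly (d : ℕ → ℝ) (k : ℕ) :
    (magPoly n d).coeff k = if k < n + 2 then d k else 0 := by
  rw [magPoly, Polynomial.finsetSum_coeff]
  simp [Polynomial.coeff_X_pow]

theorem natDegree_magPoly_le (d : ℕ → ℝ) : (magPoly n d).natDegree ≤ n + 1 := by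
  rw [Polynomial.natDegree_le_iff_coeff_eq_zero]
  intro k hk
  rw [coeff_magPoly, if_neg (by omega)]

theorem natDegree_potPoly_le {m : ℕ} (hm : m ≤ n + 1) (d : ℕ → ℝ) (e : ℝ) :
    (potPoly n m d e).natDegree ≤ 2 * n + 2 := by
  refine (Polynomial.natDegree_add_le _ _).trans (max_le ?_ ?_)
  · refine (Polynomial.natDegree_C_mul_le _ _).trans (Polynomial.natDegree_pow_le.trans ?_)
    have := natDegree_magPoly_le (n := n) d
    omega
  · exact (Polynomial.natDegree_C_mul_X_pow_le _ _).trans (by omega)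

/-- The relation between the coefficients, at a fixed time -/
def PotRelation (n m : ℕ) (c : ℤ → ℝ) (N : ℝ[X]) : Prop :=
  ∑ α ∈ Finset.Icc (-(m : ℤ)) (2 * n - m + 2), c α • (T α : ℝ[T;T⁻¹]) =
    T (-(m : ℤ)) * N.toLaurent

theorem two_eq_C : (2 : ℝ[T;T⁻¹]) = C 2 := (map_ofNat C 2).symm

theorem T_mul_T_neg (k : ℤ) : (T k : ℝ[T;T⁻¹]) * T (-k) = 1 := by
  rw [← LaurentPolynomial.T_add, add_neg_cancel, LaurentPolynomial.T_zero]

theorem toLaurent_magPoly (d : ℕ → ℝ) :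
    (magPoly n d).toLaurent = ∑ γ ∈ Finset.range (n + 2), d γ • (T (γ : ℤ) : ℝ[T;T⁻¹]) := by
  rw [magPoly, map_sum]
  refine Finset.sum_congr rfl fun γ _ => ?_
  rw [Polynomial.toLaurent_C_mul_X_pow, LaurentPolynomial.smul_eq_C_mul]

theorem CoeffRelation.potRelation {m : ℕ} {c : ℤ → (Fin n → ℝ) → ℝ} {d : ℕ → (Fin n → ℝ) → ℝ}
    {e : (Fin n → ℝ) → ℝ} (hc : CoeffRelation n m c d e) (t : Fin n → ℝ) :
    PotRelation n m (fun α => c α t) (potPoly n m (fun γ => d γ t) (e t)) := by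
  have h1 : ∑ γ ∈ Finset.range (n + 2), d γ t • (T ((γ : ℤ) - m) : ℝ[T;T⁻¹]) =
      T (-(m : ℤ)) * (magPoly n fun γ => d γ t).toLaurent := by
    rw [toLaurent_magPoly, Finset.mul_sum]
    refine Finset.sum_congr rfl fun γ _ => ?_
    rw [mul_smul_comm, ← LaurentPolynomial.T_add, neg_add_eq_sub]
  rw [PotRelation, hc t, h1, potPoly, map_add, map_mul, map_mul, map_pow,
    Polynomial.toLaurent_X_pow, Polynomial.toLaurent_C, Polynomial.toLaurent_C,
    LaurentPolynomial.smul_eq_C_mul, LaurentPolynomial.smul_eq_C_mul]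
  have h2 := T_mul_T_neg (m : ℤ)
  have h3 : (T ((n + m : ℕ) : ℤ) : ℝ[T;T⁻¹]) = T n * T m := by
    rw [← LaurentPolynomial.T_add]; push_cast; rfl
  rw [h3]
  linear_combination (C (1 / 2) * T (-(m : ℤ)) * (magPoly n fun γ => d γ t).toLaurent ^ 2 -
    C (e t - d (n + 1) t) * T n) * h2

theorem T_neg_mem_reg {m : ℕ} {x : ℝ} (hx : x ^ m ≠ 0) : (T (-(m : ℤ)) : ℝ[T;T⁻¹]) ∈ reg x := by
  rcases Nat.eq_zero_or_pos m with rfl | h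
  · exact Or.inr (T_mem_ordGE (by simp))
  · exact Or.inl fun h0 => hx (by rw [h0, zero_pow (by omega)])

theorem PotRelation.sum_eq {m : ℕ} {c : ℤ → ℝ} {N : ℝ[X]} (h : PotRelation n m c N) {x : ℝ}
    (hx : x ^ m ≠ 0) :
    ∑ α ∈ Finset.Icc (-(m : ℤ)) (2 * n - m + 2), c α * x ^ α = N.eval x / x ^ m := by
  have h1 := congrArg (fun b => evalAt b x) h
  simp only [evalAt_sum, evalAt_smul, evalAt_T] at h1
  rw [h1, evalAt_mul (T_neg_mem_reg hx) (toLaurent_mem_reg _ _), evalAt_T, evalAt_toLaurent,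
    zpow_neg, zpow_natCast, div_eq_inv_mul]

/-! ### The Hamiltonian polynomial and the entry `w` of the Lax matrix -/

/-- The polynomial `∑_r h'_r x^{n-r}` -/
def hpoly (m : ℕ) (N : ℝ[X]) (lam mu : Fin n → ℝ) : ℝ[X] :=
  Lagrange.interpolate Finset.univ lam fun i =>
    1 / 2 * lam i ^ m * mu i ^ 2 - N.eval (lam i) / lam i ^ m

/-- The entry `w` of the Lax matrix, as a polynomial -/
def wpoly (m : ℕ) (N : ℝ[X]) (lam mu : Fin n → ℝ) : ℝ[X] :=
  (Polynomial.C 2 * N + Polynomial.C 2 * Polynomial.X ^ m * hpoly m N lam mu -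
    v m lam mu ^ 2) /ₘ u lam

section

variable {m : ℕ} {N : ℝ[X]} {lam mu : Fin n → ℝ}

theorem Psi_eq {c : ℤ → ℝ} (h : PotRelation n m c N) {x : ℝ} (hx : x ^ m ≠ 0) (y : ℝ) :
    Psi n m c (fun α : ℤ => x ^ α) y = 1 / 2 * x ^ m * y ^ 2 - N.eval x / x ^ m := by
  rw [Psi, ← h.sum_eq hx]
  simp only [smul_eq_mul, zpow_natCast]
  ring

theorem sepSol_Psi_eq {c : ℤ → ℝ} (h : PotRelation n m c N) (hlam : lam ∈ config n m) (r : ℕ) :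
    sepSol lam (fun i => Psi n m c (fun α : ℤ => lam i ^ α) (mu i)) r =
      (hpoly m N lam mu).coeff (n - r) := by
  simp only [Psi_eq h (hlam.2 _)]
  rfl

theorem degree_v_lt (hlam : lam ∈ config n m) : (v m lam mu).degree < n :=
  degree_interpolate_lt hlam.1 _

theorem degree_hpoly_lt (hlam : lam ∈ config n m) : (hpoly m N lam mu).degree < n :=
  degree_interpolate_lt hlam.1 _

theorem eval_v (hlam : lam ∈ config n m) (i : Fin n) :
    (v m lam mu).eval (lam i) = lam i ^ m * mu i :=
  eval_interpolate hlam.1 _ i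

theorem eval_hpoly (hlam : lam ∈ config n m) (i : Fin n) :
    (hpoly m N lam mu).eval (lam i) = 1 / 2 * lam i ^ m * mu i ^ 2 - N.eval (lam i) / lam i ^ m :=
  eval_interpolate hlam.1 _ i

theorem u_dvd_of_eval (h : Function.Injective lam) {p : ℝ[X]} (hp : ∀ i, p.eval (lam i) = 0) :
    u lam ∣ p := by
  refine Finset.prod_dvd_of_coprime ?_ fun i _ => Polynomial.dvd_iff_isRoot.2 (hp i)
  exact fun i _ j _ hij => Polynomial.pairwise_coprime_X_sub_C h hij

/-- The spectral curve of the Lax matrix -/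
theorem wpoly_mul_u (hlam : lam ∈ config n m) :
    wpoly m N lam mu * u lam = Polynomial.C 2 * N +
      Polynomial.C 2 * Polynomial.X ^ m * hpoly m N lam mu - v m lam mu ^ 2 := by
  obtain ⟨q, hq⟩ := u_dvd_of_eval hlam.1 (p := Polynomial.C 2 * N +
      Polynomial.C 2 * Polynomial.X ^ m * hpoly m N lam mu - v m lam mu ^ 2) fun i => by
    have := hlam.2 i
    simp only [Polynomial.eval_sub, Polynomial.eval_add, Polynomial.eval_mul, Polynomial.eval_C,
      Polynomial.eval_pow, Polynomial.eval_X, eval_v hlam, eval_hpoly hlam]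
    field_simp
    ring
  rw [wpoly, hq, Polynomial.mul_divByMonic_cancel_left _ (u_monic lam), mul_comm]

/-- By the spectral curve u w has degree at most 2n + 2, the degree of the potential N, and u is
monic of degree n. -/
theorem toLaurent_wpoly_mem (hlam : lam ∈ config n m) (hm : m ≤ n + 1)
    (hN : N.natDegree ≤ 2 * n + 2) : (wpoly m N lam mu).toLaurent ∈ degLE (n + 2) := by
  refine mem_degLE_of_mul (toLaurent_u_mem lam) (by rw [coeff_toLaurent_u]; exact one_ne_zero) ?_
  rw [mul_comm, ← map_mul, wpoly_mul_u hlam]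
  simp only [map_sub, map_add, map_mul, map_pow, Polynomial.toLaurent_C, Polynomial.toLaurent_X]
  have hh := toLaurent_mem_degLE_of_degree (degree_hpoly_lt (mu := mu) (N := N) hlam)
  have hv := toLaurent_mem_degLE_of_degree (degree_v_lt (mu := mu) hlam)
  refine sub_mem (add_mem ?_ ?_) ?_
  · exact mul_mem_degLE (by omega : (0 : ℤ) + (2 * n + 2) ≤ _) (C_mem_degLE 2)
      (toLaurent_mem_degLE_of_natDegree (by omega))
  · rw [LaurentPolynomial.T_pow]
    exact mul_mem_degLE (by omega : (m : ℤ) + (n - 1) ≤ _)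
      (mul_mem_degLE (by omega : (0 : ℤ) + m ≤ _) (C_mem_degLE 2) (T_mem_degLE (by omega))) hh
  · rw [pow_two]
    exact mul_mem_degLE (by omega) hv hv

theorem natDegree_wpoly_le (hlam : lam ∈ config n m) (hm : m ≤ n + 1)
    (hN : N.natDegree ≤ 2 * n + 2) : (wpoly m N lam mu).natDegree ≤ n + 2 := by
  rw [Polynomial.natDegree_le_iff_coeff_eq_zero]
  intro k hk
  rw [← coeff_toLaurent_natCast]
  exact toLaurent_wpoly_mem hlam hm hN k (by omega)

theorem eq_zero_or_coeff_zero_u_ne_zero (hlam : lam ∈ config n m) :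
    m = 0 ∨ (u lam).coeff 0 ≠ 0 := by
  rcases Nat.eq_zero_or_pos m with h | h
  · exact Or.inl h
  · exact Or.inr (coeff_zero_u_ne_zero fun i h0 => hlam.2 i (by rw [h0, zero_pow (by omega)]))

/-- Dividing the spectral curve by -2xᵐ gives Ψ(x, v x^{-m}) = -½ x^{-m} w u + h with deg h < n,
which is the decomposition defining `plusPart`. In particular the entry w has no pole. -/
theorem w_eq {c : ℤ → ℝ} (h : PotRelation n m c N) (hlam : lam ∈ config n m) :
    w m c lam mu = (wpoly m N lam mu).toLaurent := by
  have hP : plusPart (Psi n m c (fun α => T α) ((v m lam mu).toLaurent * T (-(m : ℤ)))) (u lam) =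
      C (-1 / 2) * T (-(m : ℤ)) * (wpoly m N lam mu).toLaurent := by
    have h2 := T_mul_T_neg (m : ℤ)
    have h1 := congrArg Polynomial.toLaurent (wpoly_mul_u (mu := mu) (N := N) hlam)
    simp only [map_sub, map_add, map_mul, map_pow, Polynomial.toLaurent_C, Polynomial.toLaurent_X,
      LaurentPolynomial.T_pow, mul_one] at h1
    have hC : C (-1 / 2 : ℝ) * C 2 = -1 := by rw [← map_mul]; norm_num
    have hC' : C (1 / 2 : ℝ) = - C (-1 / 2 : ℝ) := by rw [← map_neg]; norm_num
    have hb : Psi n m c (fun α => T α) ((v m lam mu).toLaurent * T (-(m : ℤ))) =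
        C (-1 / 2) * T (-(m : ℤ)) * (wpoly m N lam mu).toLaurent * (u lam).toLaurent +
          (hpoly m N lam mu).toLaurent := by
      rw [Psi, h, LaurentPolynomial.smul_eq_C_mul, hC']
      linear_combination (-C (-1 / 2 : ℝ) * T (-(m : ℤ))) * h1 -
        C (-1 / 2 : ℝ) * (v m lam mu).toLaurent ^ 2 * T (-(m : ℤ)) * h2 -
        T (-(m : ℤ)) * N.toLaurent * hC -
        (T m * T (-(m : ℤ)) * (hpoly m N lam mu).toLaurent) * hC +
        (hpoly m N lam mu).toLaurent * h2
    refine plusPart_eq (u_monic lam) (by rw [degree_u]; exact degree_hpoly_lt hlam) hb ?_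
    refine (eq_zero_or_coeff_zero_u_ne_zero hlam).imp_left fun h0 => ?_
    have h3 : C (-1 / 2) * T (-(m : ℤ)) * (wpoly m N lam mu).toLaurent ∈ ordGE 0 := by
      rw [h0]
      exact mul_mem_ordGE (zero_add 0).ge (mul_mem_ordGE (zero_add 0).ge (C_mem_ordGE _)
        (T_mem_ordGE (by simp))) (toLaurent_mem_ordGE _)
    refine ⟨?_, h3⟩
    rw [hb]
    exact add_mem (mul_mem_ordGE (zero_add 0).ge h3 (toLaurent_mem_ordGE _)) (toLaurent_mem_ordGE _)
  have hC : C (-2 : ℝ) * C (-1 / 2) = 1 := by rw [← map_mul]; norm_num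
  rw [w, hP, LaurentPolynomial.smul_eq_C_mul]
  linear_combination (T m * T (-(m : ℤ)) * (wpoly m N lam mu).toLaurent) * hC +
    (wpoly m N lam mu).toLaurent * T_mul_T_neg (m : ℤ)

/-! ### The matrices `U_r` -/

theorem phi_mem_degLE (σ : ℝ) {k : ℕ} {p : ℝ[X]} {M : ℤ} (hp : p.toLaurent ∈ degLE M) :
    phi σ k p ∈ degLE (M - k) :=
  tau_mem_degLE σ (mul_mem_degLE (by omega) (T_mem_degLE le_rfl) hp)

/-- The order of the pole of the `phi` at `0` is at most `poleOrder`. -/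
def poleOrder (n r : ℕ) (σ : ℝ) : ℕ := if σ = 0 then 0 else n + 1 - r

theorem Sector.phi_mem_ordGE {r : ℕ} {σ : ℝ} (h : Sector n m r σ) (p : ℝ[X]) :
    phi σ (n + 1 - r) p ∈ ordGE (-(poleOrder n r σ : ℤ)) := by
  rcases h with ⟨rfl, -⟩ | ⟨rfl, -⟩
  · rw [poleOrder, if_pos rfl, Nat.cast_zero, neg_zero]
    exact tau_zero_mem_ordGE _
  · rw [poleOrder, if_neg one_ne_zero]
    exact tau_mem_ordGE _ (mul_mem_ordGE (by omega : -((n + 1 - r : ℕ) : ℤ) ≤ _ + 0)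
      (T_mem_ordGE le_rfl) (toLaurent_mem_ordGE _))

/-- The diagonal entry of `U_r` -/
def entryA (m r : ℕ) (σ : ℝ) (lam mu : Fin n → ℝ) : ℝ[T;T⁻¹] :=
  ∑ i, C (lam i ^ m * mu i / (2 * Delta lam i)) * phi σ (n + 1 - r) (uE lam i)

/-- The remainder that belongs to the diagonal entry of `U_r` -/
def remR (m r : ℕ) (lam mu : Fin n → ℝ) : ℝ[X] :=
  ∑ i, Polynomial.C (lam i ^ m * mu i / Delta lam i * (uE lam i).coeff (n - r)) * uE lam i

theorem degree_sum_uE_lt (lam : Fin n → ℝ) (a : Fin n → ℝ) :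
    (∑ i, Polynomial.C (a i) * uE lam i).degree < n := by
  rw [← Polynomial.mem_degreeLT]
  refine Submodule.sum_mem _ fun i _ => ?_
  rw [← Polynomial.smul_eq_C_mul]
  exact Submodule.smul_mem _ _ (Polynomial.mem_degreeLT.2 (degree_uE_lt lam i))

/-- Multiplying `phi_u` by the cofactor shows that φ·`uE` equals phi(`uE`)·u plus a multiple of
`uE`. Summing over the Lagrange expansion of v performs the division by u explicitly and identifies
the diagonal entry of U_r. -/
theorem phi_mul_v {r : ℕ} (hr : r ≤ n) (σ : ℝ) (hlam : lam ∈ config n m) :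
    phi σ (n + 1 - r) (u lam) * (v m lam mu).toLaurent =
      2 * entryA m r σ lam mu * (u lam).toLaurent + (remR m r lam mu).toLaurent := by
  rw [v, interpolate_eq_sum hlam.1, entryA, remR, map_sum, map_sum, Finset.mul_sum, Finset.mul_sum,
    Finset.sum_mul, ← Finset.sum_add_distrib]
  refine Finset.sum_congr rfl fun i _ => ?_
  have h1 := phi_u σ hr lam i
  have h2 : (u lam).toLaurent = (T 1 - C (lam i)) * (uE lam i).toLaurent := by
    rw [u_eq_mul lam i, map_mul, map_sub, Polynomial.toLaurent_X, Polynomial.toLaurent_C]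
  have h3 : C (lam i ^ m * mu i / Delta lam i) = 2 * C (lam i ^ m * mu i / (2 * Delta lam i)) := by
    rw [two_eq_C, ← map_mul]
    congr 1
    have := Delta_ne_zero hlam.1 i
    field_simp
  simp only [map_mul, Polynomial.toLaurent_C, h3]
  linear_combination (2 * C (lam i ^ m * mu i / (2 * Delta lam i)) * (uE lam i).toLaurent) * h1 -
    (2 * C (lam i ^ m * mu i / (2 * Delta lam i)) * phi σ (n + 1 - r) (uE lam i)) * h2

theorem entryA_mem_ordGE {r : ℕ} {σ : ℝ} (h : Sector n m r σ) (lam mu : Fin n → ℝ) :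
    entryA m r σ lam mu ∈ ordGE (-(poleOrder n r σ : ℤ)) :=
  Submodule.sum_mem _ fun _ _ => mul_mem_ordGE (by omega) (C_mem_ordGE _) (h.phi_mem_ordGE _)

theorem entryA_mem_reg {r : ℕ} {σ : ℝ} (h : Sector n m r σ) (lam mu : Fin n → ℝ) {x : ℝ}
    (hx : x ^ m ≠ 0) : entryA m r σ lam mu ∈ reg x :=
  Subalgebra.sum_mem _ fun _ _ => mul_mem (C_mem_reg _ _) (h.phi_mem_reg hx _ _)

theorem Sector.coeff_zero_u {r : ℕ} {σ : ℝ} (h : Sector n m r σ) (hlam : lam ∈ config n m) :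
    poleOrder n r σ = 0 ∨ (u lam).coeff 0 ≠ 0 := by
  rcases h with ⟨rfl, -⟩ | ⟨rfl, h1, h2, h3⟩
  · exact Or.inl (if_pos rfl)
  · exact Or.inr (coeff_zero_u_ne_zero fun i h0 => hlam.2 i (by rw [h0, zero_pow (by omega)]))

/-- A quotient and a remainder of φp by u give the corresponding entry of U_r, the remainder being
rescaled by ½. Either there is no pole at all or u(0) ≠ 0. -/
theorem half_smul_phi_mul {r : ℕ} {σ : ℝ} (h : Sector n m r σ) (hlam : lam ∈ config n m)
    {p s : ℝ[X]} {q : ℝ[T;T⁻¹]} (hq : q ∈ ordGE (-(poleOrder n r σ : ℤ))) (hs : s.degree < n)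
    (hp : phi σ (n + 1 - r) (u lam) * p.toLaurent = 2 * q * (u lam).toLaurent + s.toLaurent) :
    plusPart ((1 / 2 : ℝ) • (phi σ (n + 1 - r) (u lam) * p.toLaurent)) (u lam) = q := by
  have hC : C (1 / 2 : ℝ) * 2 = 1 := by
    rw [two_eq_C, ← map_mul]; norm_num
  refine plusPart_eq (r := Polynomial.C (1 / 2) * s) (u_monic lam) ?_ ?_ ?_
  · rw [degree_u, Polynomial.degree_C_mul (by norm_num)]
    exact hs
  · rw [hp, LaurentPolynomial.smul_eq_C_mul, map_mul, Polynomial.toLaurent_C]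
    linear_combination (q * (u lam).toLaurent) * hC
  · refine (h.coeff_zero_u hlam).imp_left fun h0 => ?_
    rw [h0, Nat.cast_zero, neg_zero] at hq
    refine ⟨Submodule.smul_mem _ _ (mul_mem_ordGE (zero_add 0).ge ?_ (toLaurent_mem_ordGE _)), hq⟩
    have := h.phi_mem_ordGE (u lam)
    rwa [h0, Nat.cast_zero, neg_zero] at this

/-- The structure of the matrix `U_r` -/
theorem exists_U_eq {r : ℕ} {σ : ℝ} (h : Sector n m r σ) (hlam : lam ∈ config n m)
    {c : ℤ → ℝ} (hc : PotRelation n m c N) :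
    ∃ (q : ℝ[T;T⁻¹]) (s : ℝ[X]), q ∈ ordGE (-(poleOrder n r σ : ℤ)) ∧ s.degree < n ∧
      phi σ (n + 1 - r) (u lam) * (wpoly m N lam mu).toLaurent =
        2 * q * (u lam).toLaurent + s.toLaurent ∧
      U m c r lam mu = !![entryA m r σ lam mu, (1 / 2 : ℝ) • phi σ (n + 1 - r) (u lam);
        q, -entryA m r σ lam mu] := by
  -- For the lower left entry no closed form is needed: the existence of quotient and remainder and
  -- the pole bound suffice.
  have hphi := h.phi_mem_ordGE (u lam)
  obtain ⟨h1, s, hs, h2⟩ := plusPart_spec (b := (1 / 2 : ℝ) •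
      (phi σ (n + 1 - r) (u lam) * (wpoly m N lam mu).toLaurent)) (u_monic lam)
    (Submodule.smul_mem _ _ (mul_mem_ordGE (by omega) hphi (toLaurent_mem_ordGE _)))
    (h.coeff_zero_u hlam)
  have hC : 2 * C (1 / 2 : ℝ) = 1 := by
    rw [two_eq_C, ← map_mul]; norm_num
  refine ⟨_, Polynomial.C 2 * s, h1, ?_, ?_, ?_⟩
  · rw [Polynomial.degree_C_mul (by norm_num), ← degree_u lam]
    exact hs
  · rw [LaurentPolynomial.smul_eq_C_mul] at h2
    rw [map_mul, Polynomial.toLaurent_C, LaurentPolynomial.smul_eq_C_mul, ← two_eq_C]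
    linear_combination 2 * h2 - (phi σ (n + 1 - r) (u lam) * (wpoly m N lam mu).toLaurent) * hC
  · have hA := phi_mul_v (mu := mu) h.bounds.2 σ hlam
    have hR : (remR m r lam mu).degree < n := degree_sum_uE_lt lam _
    have e11 := half_smul_phi_mul h hlam (entryA_mem_ordGE h lam mu) hR hA
    have e22 := half_smul_phi_mul h hlam (p := -v m lam mu) (s := -remR m r lam mu)
      (neg_mem (entryA_mem_ordGE h lam mu)) (by rwa [Polynomial.degree_neg])
      (by rw [map_neg, map_neg]; linear_combination -hA)
    have e12 := half_smul_phi_mul h hlam (p := u lam) (s := 0)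
      (q := (1 / 2 : ℝ) • phi σ (n + 1 - r) (u lam)) (Submodule.smul_mem _ _ hphi)
      (by rw [Polynomial.degree_zero]; exact WithBot.bot_lt_coe n)
      (by
        rw [map_zero, add_zero, LaurentPolynomial.smul_eq_C_mul]
        linear_combination (-phi σ (n + 1 - r) (u lam) * (u lam).toLaurent) * hC)
    rw [U, B_eq h, lax, w_eq hc hlam]
    ext1 a b
    fin_cases a <;> fin_cases b
    · exact e11
    · exact e12
    · rfl
    · rw [map_neg] at e22
      exact e22

end

end PainleveLax
end

noncomputable section

namespace PainleveLax

open LaurentPolynomial (T C)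
open Filter Topology

/-! ### Families of polynomials with differentiable coefficients -/

section

variable {E : Type*} [NormedAddCommGroup E] [NormedSpace ℝ E]

/-- All coefficients of the family `F` of polynomials are differentiable at `z`. -/
def CoeffDiffAt (F : E → ℝ[X]) (z : E) : Prop :=
  ∀ k, DifferentiableAt ℝ (fun z => (F z).coeff k) z

variable {F G : E → ℝ[X]} {z : E}

theorem CoeffDiffAt.congr (h : CoeffDiffAt F z) (hFG : G =ᶠ[𝓝 z] F) : CoeffDiffAt G z :=
  fun k => (h k).congr_of_eventuallyEq (hFG.fun_comp fun p => p.coeff k)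

theorem coeffDiffAt_const (p : ℝ[X]) : CoeffDiffAt (fun _ => p) z :=
  fun _ => differentiableAt_const _

theorem coeffDiffAt_C {g : E → ℝ} (h : DifferentiableAt ℝ g z) :
    CoeffDiffAt (fun z => Polynomial.C (g z)) z := fun k => by
  simp only [Polynomial.coeff_C]
  split_ifs
  · exact h
  · exact differentiableAt_const _

theorem CoeffDiffAt.add (hF : CoeffDiffAt F z) (hG : CoeffDiffAt G z) :
    CoeffDiffAt (fun z => F z + G z) z := fun k => by
  simp only [Polynomial.coeff_add]
  exact (hF k).add (hG k)

theorem CoeffDiffAt.sub (hF : CoeffDiffAt F z) (hG : CoeffDiffAt G z) :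
    CoeffDiffAt (fun z => F z - G z) z := fun k => by
  simp only [Polynomial.coeff_sub]
  exact (hF k).sub (hG k)

theorem CoeffDiffAt.mul (hF : CoeffDiffAt F z) (hG : CoeffDiffAt G z) :
    CoeffDiffAt (fun z => F z * G z) z := fun k => by
  simp only [Polynomial.coeff_mul]
  exact DifferentiableAt.fun_sum fun i _ => (hF i.1).mul (hG i.2)

theorem CoeffDiffAt.sum {ι : Type*} {s : Finset ι} {F : ι → E → ℝ[X]}
    (h : ∀ i ∈ s, CoeffDiffAt (F i) z) : CoeffDiffAt (fun z => ∑ i ∈ s, F i z) z := fun k => by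
  simp only [Polynomial.finsetSum_coeff]
  exact DifferentiableAt.fun_sum fun i hi => h i hi k

theorem CoeffDiffAt.prod {ι : Type*} {s : Finset ι} {F : ι → E → ℝ[X]}
    (h : ∀ i ∈ s, CoeffDiffAt (F i) z) : CoeffDiffAt (fun z => ∏ i ∈ s, F i z) z := by
  classical
  induction s using Finset.induction_on with
  | empty => simpa using coeffDiffAt_const 1
  | insert i s hi ih =>
    simp only [Finset.prod_insert hi]
    exact (h i (Finset.mem_insert_self i s)).mul
      (ih fun j hj => h j (Finset.mem_insert_of_mem hj))

theorem CoeffDiffAt.eval (hF : CoeffDiffAt F z) {M : ℕ} (hM : ∀ᶠ z in 𝓝 z, (F z).natDegree ≤ M)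
    {g : E → ℝ} (hg : DifferentiableAt ℝ g z) : DifferentiableAt ℝ (fun z => (F z).eval (g z)) z := by
  have h : DifferentiableAt ℝ (fun z => ∑ k ∈ Finset.range (M + 1), (F z).coeff k * g z ^ k) z :=
    DifferentiableAt.fun_sum fun k _ => (hF k).mul (hg.pow k)
  refine h.congr_of_eventuallyEq ?_
  filter_upwards [hM] with z hz
  exact Polynomial.eval_eq_sum_range' (by omega) _

/-- For q monic of degree n this determines the k-th coefficient of p from pq and from higher
coefficients of p: long division, read from the top. -/
theorem coeff_mul_add_of_natDegree {p q : ℝ[X]} {n : ℕ} (hq : q.natDegree ≤ n) (k : ℕ) :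
    (p * q).coeff (k + n) = p.coeff k * q.coeff n +
      ∑ i ∈ Finset.range n, p.coeff (k + (i + 1)) * q.coeff (n - (i + 1)) := by
  rw [Polynomial.coeff_mul, Finset.Nat.sum_antidiagonal_eq_sum_range_succ_mk, Nat.succ_eq_add_one,
    add_assoc, Finset.sum_range_add, Finset.sum_eq_zero, zero_add, Finset.sum_range_succ', add_comm]
  · simp only [add_zero, Nat.add_sub_add_left, Nat.add_sub_cancel_left]
  · intro i hi
    rw [Finset.mem_range] at hi
    rw [Polynomial.coeff_eq_zero_of_natDegree_lt (p := q) (by omega), mul_zero]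

/-- The quotient by a monic family has differentiable coefficients. -/
theorem CoeffDiffAt.of_mul_monic {q : E → ℝ[X]} {n M : ℕ} (hG : CoeffDiffAt G z)
    (hF : CoeffDiffAt F z) (hmon : ∀ z, (F z).Monic) (hdeg : ∀ z, (F z).natDegree = n)
    (hq : ∀ᶠ z in 𝓝 z, (q z).natDegree ≤ M) (h : ∀ᶠ z in 𝓝 z, q z * F z = G z) :
    CoeffDiffAt q z := by
  -- Descending induction on k. The variable j measures how far k may lie below the degree bound M.
  have key : ∀ j k, M < k + j → DifferentiableAt ℝ (fun z => (q z).coeff k) z := by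
    intro j
    induction j with
    | zero =>
      intro k hk
      refine (differentiableAt_const (0 : ℝ)).congr_of_eventuallyEq ?_
      filter_upwards [hq] with z hz
      exact Polynomial.coeff_eq_zero_of_natDegree_lt (by omega)
    | succ j ih =>
      intro k hk
      have h1 : DifferentiableAt ℝ (fun z => (G z).coeff (k + n) -
          ∑ i ∈ Finset.range n, (q z).coeff (k + (i + 1)) * (F z).coeff (n - (i + 1))) z :=
        (hG _).sub (DifferentiableAt.fun_sum fun i _ => (ih _ (by omega)).mul (hF _))
      refine h1.congr_of_eventuallyEq ?_
      filter_upwards [h] with z hz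
      have h2 := (hmon z).coeff_natDegree
      rw [hdeg] at h2
      rw [← hz, coeff_mul_add_of_natDegree (hdeg z).le, h2]
      ring
  exact fun k => key (M + 1) k (by omega)

end

/-- `F'` is the coefficientwise derivative at `s` of the curve `F` of polynomials. -/
def HasCoeffDerivAt (F : ℝ → ℝ[X]) (F' : ℝ[X]) (s : ℝ) : Prop :=
  ∀ k, HasDerivAt (fun s => (F s).coeff k) (F'.coeff k) s

section

variable {F G : ℝ → ℝ[X]} {F' G' : ℝ[X]} {s : ℝ}

theorem HasCoeffDerivAt.unique (h : HasCoeffDerivAt F F' s) (h' : HasCoeffDerivAt F G' s) :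
    F' = G' := Polynomial.ext fun k => (h k).unique (h' k)

theorem HasCoeffDerivAt.congr (h : HasCoeffDerivAt F F' s) (hFG : G =ᶠ[𝓝 s] F) :
    HasCoeffDerivAt G F' s :=
  fun k => (h k).congr_of_eventuallyEq (hFG.fun_comp fun p => p.coeff k)

theorem hasCoeffDerivAt_const (p : ℝ[X]) : HasCoeffDerivAt (fun _ => p) 0 s :=
  fun k => by simpa using hasDerivAt_const s (p.coeff k)

theorem HasCoeffDerivAt.add (hF : HasCoeffDerivAt F F' s) (hG : HasCoeffDerivAt G G' s) :
    HasCoeffDerivAt (fun s => F s + G s) (F' + G') s := fun k => by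
  simp only [Polynomial.coeff_add]
  exact (hF k).add (hG k)

theorem HasCoeffDerivAt.sub (hF : HasCoeffDerivAt F F' s) (hG : HasCoeffDerivAt G G' s) :
    HasCoeffDerivAt (fun s => F s - G s) (F' - G') s := fun k => by
  simp only [Polynomial.coeff_sub]
  exact (hF k).sub (hG k)

theorem HasCoeffDerivAt.mul (hF : HasCoeffDerivAt F F' s) (hG : HasCoeffDerivAt G G' s) :
    HasCoeffDerivAt (fun s => F s * G s) (F' * G s + F s * G') s := fun k => by
  simp only [Polynomial.coeff_mul, Polynomial.coeff_add]
  rw [← Finset.sum_add_distrib]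
  exact HasDerivAt.fun_sum fun i _ => (hF i.1).mul (hG i.2)

theorem HasCoeffDerivAt.const_mul (hF : HasCoeffDerivAt F F' s) (p : ℝ[X]) :
    HasCoeffDerivAt (fun s => p * F s) (p * F') s := by
  simpa using (hasCoeffDerivAt_const p).mul hF

theorem HasCoeffDerivAt.degree_lt (hF : HasCoeffDerivAt F F' s) {n : ℕ}
    (h : ∀ᶠ s in 𝓝 s, (F s).degree < n) : F'.degree < n := by
  rw [Polynomial.degree_lt_iff_coeff_zero]
  intro k hk
  refine (hF k).unique ((hasDerivAt_const s 0).congr_of_eventuallyEq ?_)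
  filter_upwards [h] with s hs
  exact Polynomial.coeff_eq_zero_of_degree_lt (lt_of_lt_of_le hs (by exact_mod_cast hk))

theorem HasCoeffDerivAt.natDegree_le (hF : HasCoeffDerivAt F F' s) {M : ℕ}
    (h : ∀ᶠ s in 𝓝 s, (F s).natDegree ≤ M) : F'.natDegree ≤ M := by
  rw [Polynomial.natDegree_le_iff_coeff_eq_zero]
  intro k hk
  refine (hF k).unique ((hasDerivAt_const s 0).congr_of_eventuallyEq ?_)
  filter_upwards [h] with s hs
  exact Polynomial.coeff_eq_zero_of_natDegree_lt (by omega)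

/-- The product rule at a moving point. Its main use is to differentiate relations such as u(λᵢ) = 0
while λᵢ itself moves. The degree bound turns evaluation into a fixed finite sum. -/
theorem HasCoeffDerivAt.eval (hF : HasCoeffDerivAt F F' s) {M : ℕ}
    (hM : ∀ᶠ s in 𝓝 s, (F s).natDegree ≤ M) {g : ℝ → ℝ} {g' : ℝ} (hg : HasDerivAt g g' s) :
    HasDerivAt (fun s => (F s).eval (g s))
      (F'.eval (g s) + (Polynomial.derivative (F s)).eval (g s) * g') s := by
  have h : HasDerivAt (fun s => ∑ k ∈ Finset.range (M + 1), (F s).coeff k * g s ^ k)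
      (∑ k ∈ Finset.range (M + 1),
        (F'.coeff k * g s ^ k + (F s).coeff k * (k * g s ^ (k - 1) * g'))) s :=
    HasDerivAt.fun_sum fun k _ => (hF k).mul (hg.pow k)
  have h2 : ∑ k ∈ Finset.range (M + 1),
      (F'.coeff k * g s ^ k + (F s).coeff k * (k * g s ^ (k - 1) * g')) =
      F'.eval (g s) + (Polynomial.derivative (F s)).eval (g s) * g' := by
    rw [Finset.sum_add_distrib, Polynomial.eval_eq_sum_range' (p := F') (n := M + 1)
      (Nat.lt_succ_of_le (hF.natDegree_le hM))]
    congr 1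
    rw [Polynomial.derivative_eval, Polynomial.sum_over_range' _ (by simp) (M + 1)
      (Nat.lt_succ_of_le hM.self_of_nhds), Finset.sum_mul]
    exact Finset.sum_congr rfl fun k _ => by ring
  rw [h2] at h
  refine h.congr_of_eventuallyEq ?_
  filter_upwards [hM] with s hs
  exact Polynomial.eval_eq_sum_range' (by omega) _

/-- The coefficientwise derivatives form a polynomial only because the degrees stay bounded near z.
-/
theorem CoeffDiffAt.exists_hasCoeffDerivAt {E : Type*} [NormedAddCommGroup E] [NormedSpace ℝ E]
    {F : E → ℝ[X]} {z : E} (hF : CoeffDiffAt F z) {M : ℕ}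
    (hM : ∀ᶠ z in 𝓝 z, (F z).natDegree ≤ M) (y : E) :
    ∃ F', HasCoeffDerivAt (fun s : ℝ => F (z + s • y)) F' 0 := by
  have hl : HasDerivAt (fun s : ℝ => z + s • y) y 0 := by
    simpa using ((hasDerivAt_id (0 : ℝ)).smul_const y).const_add z
  have hl0 : z = z + (0 : ℝ) • y := by simp
  refine ⟨∑ k ∈ Finset.range (M + 1),
    Polynomial.monomial k (fderiv ℝ (fun z => (F z).coeff k) z y), fun k => ?_⟩
  have h1 : HasDerivAt (fun s : ℝ => (F (z + s • y)).coeff k)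
      (fderiv ℝ (fun z => (F z).coeff k) z y) 0 :=
    HasFDerivAt.comp_hasDerivAt_of_eq (0 : ℝ) (hF k).hasFDerivAt hl hl0
  rw [Polynomial.finsetSum_coeff]
  simp only [Polynomial.coeff_monomial, Finset.sum_ite_eq', Finset.mem_range]
  split_ifs with hk
  · exact h1
  · refine (hasDerivAt_const (0 : ℝ) (0 : ℝ)).congr_of_eventuallyEq ?_
    have h2 : Tendsto (fun s : ℝ => z + s • y) (𝓝 0) (𝓝 z) := by
      have := hl.continuousAt.tendsto
      rwa [← hl0] at this
    filter_upwards [h2.eventually hM] with s hs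
    exact Polynomial.coeff_eq_zero_of_natDegree_lt (by omega)

end

end PainleveLax
end

/-! ### Derivatives of u, v, h and w along lines in the extended phase space -/

noncomputable section

namespace PainleveLax

open LaurentPolynomial (T C)
open Filter Topology

variable {n m : ℕ}

/-! ### Differentiability of the polynomials of the Lax matrix -/

theorem differentiableAt_div {E : Type*} [NormedAddCommGroup E] [NormedSpace ℝ E] {f g : E → ℝ}
    {z : E} (hf : DifferentiableAt ℝ f z) (hg : DifferentiableAt ℝ g z) (h : g z ≠ 0) :
    DifferentiableAt ℝ (fun z => f z / g z) z := by
  simp only [div_eq_mul_inv]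
  exact hf.mul (hg.inv h)

theorem eventually_mem_config {lam : Fin n → ℝ} (h : lam ∈ config n m) :
    ∀ᶠ l in 𝓝 lam, l ∈ config n m := by
  have h1 : ∀ᶠ l in 𝓝 lam, ∀ i j, i ≠ j → l i ≠ l j := by
    rw [eventually_all]
    intro i
    rw [eventually_all]
    intro j
    by_cases hij : i = j
    · exact Eventually.of_forall fun l h => absurd hij h
    · have h2 : ∀ᶠ l in 𝓝 lam, l i - l j ≠ 0 :=
        ((continuous_apply i).sub (continuous_apply j)).continuousAt.eventually_ne
          (sub_ne_zero.2 fun h' => hij (h.1 h'))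
      filter_upwards [h2] with l hl _
      exact sub_ne_zero.1 hl
  have h3 : ∀ᶠ l in 𝓝 lam, ∀ i, l i ^ m ≠ 0 := by
    rw [eventually_all]
    exact fun i => ((continuous_apply i).pow m).continuousAt.eventually_ne (h.2 i)
  filter_upwards [h1, h3] with l hl hl'
  exact ⟨fun i j hij => by_contra fun h => hl i j h hij, hl'⟩

section

variable {E : Type*} [NormedAddCommGroup E] [NormedSpace ℝ E] {lam mu : E → Fin n → ℝ}
  {N : E → ℝ[X]} {z : E}

theorem coeffDiffAt_linear (hl : DifferentiableAt ℝ lam z) (i : Fin n) :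
    CoeffDiffAt (fun z => Polynomial.X - Polynomial.C (lam z i)) z :=
  (coeffDiffAt_const _).sub (coeffDiffAt_C (differentiableAt_pi.1 hl i))

theorem coeffDiffAt_u (hl : DifferentiableAt ℝ lam z) : CoeffDiffAt (fun z => u (lam z)) z :=
  CoeffDiffAt.prod fun i _ => coeffDiffAt_linear hl i

theorem coeffDiffAt_uE (hl : DifferentiableAt ℝ lam z) (i : Fin n) :
    CoeffDiffAt (fun z => uE (lam z) i) z :=
  CoeffDiffAt.prod fun i _ => coeffDiffAt_linear hl i

theorem differentiableAt_Delta (hl : DifferentiableAt ℝ lam z) (i : Fin n) :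
    DifferentiableAt ℝ (fun z => Delta (lam z) i) z := by
  simp only [← eval_uE_self]
  exact (coeffDiffAt_uE hl i).eval (M := n - 1)
    (Eventually.of_forall fun z => (natDegree_uE _ i).le) (differentiableAt_pi.1 hl i)

theorem eventually_mem_config_comp (hl : DifferentiableAt ℝ lam z) (h : lam z ∈ config n m) :
    ∀ᶠ z in 𝓝 z, lam z ∈ config n m :=
  hl.continuousAt.eventually (eventually_mem_config h)

theorem coeffDiffAt_interpolate (hl : DifferentiableAt ℝ lam z) (h : lam z ∈ config n m)
    {a : E → Fin n → ℝ} (ha : ∀ i, DifferentiableAt ℝ (fun z => a z i) z) :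
    CoeffDiffAt (fun z => Lagrange.interpolate Finset.univ (lam z) (a z)) z := by
  have h1 : CoeffDiffAt (fun z => ∑ i, Polynomial.C (a z i / Delta (lam z) i) * uE (lam z) i) z :=
    CoeffDiffAt.sum fun i _ => (coeffDiffAt_C (differentiableAt_div (ha i) (differentiableAt_Delta hl i)
      (Delta_ne_zero h.1 i))).mul (coeffDiffAt_uE hl i)
  refine h1.congr ?_
  filter_upwards [eventually_mem_config_comp hl h] with z hz
  exact interpolate_eq_sum hz.1 _

theorem coeffDiffAt_v (hl : DifferentiableAt ℝ lam z) (h : lam z ∈ config n m)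
    (hmu : DifferentiableAt ℝ mu z) : CoeffDiffAt (fun z => v m (lam z) (mu z)) z :=
  coeffDiffAt_interpolate hl h fun i =>
    ((differentiableAt_pi.1 hl i).pow m).mul (differentiableAt_pi.1 hmu i)

theorem coeffDiffAt_hpoly (hl : DifferentiableAt ℝ lam z) (h : lam z ∈ config n m)
    (hmu : DifferentiableAt ℝ mu z) (hN : CoeffDiffAt N z) {M : ℕ}
    (hM : ∀ z, (N z).natDegree ≤ M) : CoeffDiffAt (fun z => hpoly m (N z) (lam z) (mu z)) z :=
  coeffDiffAt_interpolate hl h fun i =>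
    ((((differentiableAt_pi.1 hl i).fun_pow m).const_mul (1 / 2)).fun_mul
      ((differentiableAt_pi.1 hmu i).fun_pow 2)).fun_sub
    (differentiableAt_div (hN.eval (Eventually.of_forall hM) (differentiableAt_pi.1 hl i))
      ((differentiableAt_pi.1 hl i).fun_pow m) (h.2 i))

theorem coeffDiffAt_wpoly (hl : DifferentiableAt ℝ lam z) (h : lam z ∈ config n m)
    (hmu : DifferentiableAt ℝ mu z) (hN : CoeffDiffAt N z) (hm : m ≤ n + 1)
    (hM : ∀ z, (N z).natDegree ≤ 2 * n + 2) :
    CoeffDiffAt (fun z => wpoly m (N z) (lam z) (mu z)) z := by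
  have hv := coeffDiffAt_v hl h hmu
  have h1 : CoeffDiffAt (fun z => Polynomial.C 2 * N z +
      Polynomial.C 2 * Polynomial.X ^ m * hpoly m (N z) (lam z) (mu z) -
      v m (lam z) (mu z) ^ 2) z := by
    simp only [pow_two (v _ _ _)]
    exact (((coeffDiffAt_const _).mul hN).add ((coeffDiffAt_const _).mul
      (coeffDiffAt_hpoly hl h hmu hN hM))).sub (hv.mul hv)
  have h2 := eventually_mem_config_comp hl h
  refine h1.of_mul_monic (coeffDiffAt_u hl) (fun z => u_monic _) (fun z => natDegree_u _)
    (M := n + 2) ?_ ?_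
  · filter_upwards [h2] with z hz
    exact natDegree_wpoly_le hz hm (hM z)
  · filter_upwards [h2] with z hz
    exact wpoly_mul_u hz

end

theorem coeffDiffAt_magPoly {E : Type*} [NormedAddCommGroup E] [NormedSpace ℝ E] {d : ℕ → E → ℝ}
    {z : E} (hd : ∀ γ ≤ n + 1, DifferentiableAt ℝ (d γ) z) :
    CoeffDiffAt (fun z => magPoly n fun γ => d γ z) z :=
  CoeffDiffAt.sum fun γ hγ => (coeffDiffAt_C (hd γ (by
    have := Finset.mem_range.1 hγ; omega))).mul (coeffDiffAt_const _)

theorem coeffDiffAt_potPoly {E : Type*} [NormedAddCommGroup E] [NormedSpace ℝ E] {d : ℕ → E → ℝ}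
    {e : E → ℝ} {z : E} (hd : ∀ γ ≤ n + 1, DifferentiableAt ℝ (d γ) z)
    (he : DifferentiableAt ℝ e z) :
    CoeffDiffAt (fun z => potPoly n m (fun γ => d γ z) (e z)) z := by
  have h := coeffDiffAt_magPoly hd
  simp only [potPoly, pow_two (magPoly _ _)]
  exact ((coeffDiffAt_const _).mul (h.mul h)).add
    ((coeffDiffAt_C (he.sub (hd _ le_rfl))).mul (coeffDiffAt_const _))

/-! ### Curves in the phase space -/

theorem natDegree_le_of_degree_lt {p : ℝ[X]} (h : p.degree < n) : p.natDegree ≤ n :=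
  Polynomial.natDegree_le_of_degree_le h.le

/-- The derivatives of the polynomials of the Lax matrix along a curve in the extended phase
space -/
structure CurveDeriv (m : ℕ) (lam mu a b : Fin n → ℝ) (N N' u' v' h' w' : ℝ[X]) : Prop where
  degree_u : u'.degree < n
  degree_v : v'.degree < n
  degree_h : h'.degree < n
  eval_u : ∀ i, u'.eval (lam i) = -(Delta lam i * a i)
  eval_v : ∀ i, v'.eval (lam i) = m * lam i ^ (m - 1) * a i * mu i + lam i ^ m * b i -
    (Polynomial.derivative (v m lam mu)).eval (lam i) * a i
  spectral : u' * wpoly m N lam mu + u lam * w' + 2 * v m lam mu * v' =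
    2 * N' + 2 * Polynomial.X ^ m * h'

/-- The values at the nodes come from differentiating u(λᵢ) = 0 and v(λᵢ) = λᵢᵐμᵢ, the last relation
from differentiating the spectral curve. It serves twice: with N constant it yields the partial
derivatives of h, and with N depending on time it yields the evolution of L. -/
theorem exists_curveDeriv {E : Type*} [NormedAddCommGroup E] [NormedSpace ℝ E]
    {lam mu a b : Fin n → ℝ} (hlam : lam ∈ config n m) (hm : m ≤ n + 1)
    {N : E → ℝ[X]} {t y : E} (hN : CoeffDiffAt N t) (hM : ∀ t, (N t).natDegree ≤ 2 * n + 2)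
    {N' : ℝ[X]} (hN' : HasCoeffDerivAt (fun s : ℝ => N (t + s • y)) N' 0) :
    ∃ u' v' h' w' : ℝ[X],
      HasCoeffDerivAt (fun s : ℝ => u (lam + s • a)) u' 0 ∧
      HasCoeffDerivAt (fun s : ℝ => v m (lam + s • a) (mu + s • b)) v' 0 ∧
      HasCoeffDerivAt (fun s : ℝ => hpoly m (N (t + s • y)) (lam + s • a) (mu + s • b)) h' 0 ∧
      HasCoeffDerivAt (fun s : ℝ => wpoly m (N (t + s • y)) (lam + s • a) (mu + s • b)) w' 0 ∧
      CurveDeriv m lam mu a b (N t) N' u' v' h' w' := by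
  let z : (Fin n → ℝ) × (Fin n → ℝ) × E := (lam, mu, t)
  have hl : DifferentiableAt ℝ (fun z : (Fin n → ℝ) × (Fin n → ℝ) × E => z.1) z :=
    differentiableAt_fst
  have hmu : DifferentiableAt ℝ (fun z : (Fin n → ℝ) × (Fin n → ℝ) × E => z.2.1) z :=
    differentiableAt_snd.fst
  have hNz : CoeffDiffAt (fun z : (Fin n → ℝ) × (Fin n → ℝ) × E => N z.2.2) z := fun k =>
    DifferentiableAt.fun_comp' z (g := fun t => (N t).coeff k) (hN k)
      (differentiableAt_snd.snd)
  have hMz : ∀ z : (Fin n → ℝ) × (Fin n → ℝ) × E, (N z.2.2).natDegree ≤ 2 * n + 2 :=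
    fun z => hM _
  have hz := eventually_mem_config_comp (m := m) hl hlam
  obtain ⟨u', hu⟩ := (coeffDiffAt_u hl).exists_hasCoeffDerivAt (M := n)
    (Eventually.of_forall fun z => (natDegree_u _).le) (a, b, y)
  obtain ⟨v', hv⟩ := (coeffDiffAt_v hl hlam hmu).exists_hasCoeffDerivAt (M := n) (by
    filter_upwards [hz] with z hz
    exact natDegree_le_of_degree_lt (degree_v_lt hz)) (a, b, y)
  obtain ⟨h', hh⟩ := (coeffDiffAt_hpoly hl hlam hmu hNz hMz).exists_hasCoeffDerivAt (M := n) (by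
    filter_upwards [hz] with z hz
    exact natDegree_le_of_degree_lt (degree_hpoly_lt hz)) (a, b, y)
  obtain ⟨w', hw⟩ := (coeffDiffAt_wpoly hl hlam hmu hNz hm hMz).exists_hasCoeffDerivAt
    (M := n + 2) (by
    filter_upwards [hz] with z hz
    exact natDegree_wpoly_le hz hm (hMz z)) (a, b, y)
  simp only [z, Prod.mk_add_mk, Prod.smul_mk] at hu hv hh hw
  have hline : HasDerivAt (fun s : ℝ => lam + s • a) a 0 := by
    simpa using ((hasDerivAt_id (0 : ℝ)).smul_const a).const_add lam
  have hmline : HasDerivAt (fun s : ℝ => mu + s • b) b 0 := by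
    simpa using ((hasDerivAt_id (0 : ℝ)).smul_const b).const_add mu
  have hs : ∀ᶠ s : ℝ in 𝓝 0, lam + s • a ∈ config n m := by
    have h1 := hline.continuousAt.tendsto
    rw [zero_smul, add_zero] at h1
    exact h1.eventually (eventually_mem_config hlam)
  refine ⟨u', v', h', w', hu, hv, hh, hw, ?_, ?_, ?_, ?_, ?_, ?_⟩
  -- Subtracting the constant xⁿ removes the leading coefficient without changing the derivative.
  · have h1 : HasCoeffDerivAt (fun s : ℝ => u (lam + s • a) - Polynomial.X ^ n) u' 0 := by
      simpa using hu.sub (hasCoeffDerivAt_const (Polynomial.X ^ n))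
    refine h1.degree_lt (Eventually.of_forall fun s => ?_)
    have h2 := Polynomial.degree_sub_lt_left (p := u (lam + s • a)) (q := Polynomial.X ^ n)
      (by rw [PainleveLax.degree_u, Polynomial.degree_X_pow]) (u_monic _).ne_zero
      (by rw [(u_monic _).leadingCoeff, (Polynomial.monic_X_pow n).leadingCoeff])
    rwa [PainleveLax.degree_u] at h2
  · refine hv.degree_lt ?_
    filter_upwards [hs] with s hs
    exact degree_v_lt hs
  · refine hh.degree_lt ?_
    filter_upwards [hs] with s hs
    exact degree_hpoly_lt hs
  · intro i
    have h1 := hu.eval (M := n) (Eventually.of_forall fun z => (natDegree_u _).le)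
      (hasDerivAt_pi.1 hline i)
    have h2 : ∀ s : ℝ, (u (lam + s • a)).eval ((lam + s • a) i) = 0 := fun s => PainleveLax.eval_u _ i
    simp only [h2] at h1
    have h3 := h1.unique (hasDerivAt_const (0 : ℝ) (0 : ℝ))
    simp only [zero_smul, add_zero] at h3
    rw [eval_derivative_u] at h3
    linarith
  · intro i
    have h1 := hv.eval (M := n) (by
      filter_upwards [hs] with s hs
      exact natDegree_le_of_degree_lt (degree_v_lt hs)) (hasDerivAt_pi.1 hline i)
    have h2 := ((hasDerivAt_pi.1 hline i).pow m).mul (hasDerivAt_pi.1 hmline i)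
    have h3 := h1.unique (h2.congr_of_eventuallyEq (by
      filter_upwards [hs] with s hs
      exact PainleveLax.eval_v hs i))
    simp only [zero_smul, add_zero, Pi.pow_apply] at h3
    linarith
  · have h1 := (hw.mul hu).add (hv.mul hv)
    have h2 := (hN'.const_mul (Polynomial.C 2)).add
      (hh.const_mul (Polynomial.C 2 * Polynomial.X ^ m))
    have h3 := h1.unique (h2.congr (by
      filter_upwards [hs] with s hs
      linear_combination wpoly_mul_u (mu := mu + s • b) (N := N (t + s • y)) hs))
    simp only [zero_smul, add_zero, map_ofNat] at h3
    linear_combination h3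

end PainleveLax
end

noncomputable section

namespace PainleveLax

open LaurentPolynomial (T C)
open Filter Topology

variable {n m r : ℕ} {σ : ℝ} {lam mu : Fin n → ℝ}

/-! ### Derivatives of the quasi-Stäckel terms -/

theorem add_smul_single_self (lam : Fin n → ℝ) (j : Fin n) (s : ℝ) :
    (lam + s • (Pi.single j (1 : ℝ) : Fin n → ℝ)) j = lam j + s := by simp

theorem add_smul_single_of_ne (lam : Fin n → ℝ) {i j : Fin n} (h : i ≠ j) (s : ℝ) :
    (lam + s • (Pi.single j (1 : ℝ) : Fin n → ℝ)) i = lam i := by simp [h]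

theorem uE_add_single_self (lam : Fin n → ℝ) (j : Fin n) (s : ℝ) :
    uE (lam + s • (Pi.single j (1 : ℝ) : Fin n → ℝ)) j = uE lam j :=
  Finset.prod_congr rfl fun k hk => by
    rw [add_smul_single_of_ne lam (Finset.ne_of_mem_erase hk)]

theorem uEE_add_single (lam : Fin n → ℝ) (i j : Fin n) (s : ℝ) :
    uEE (lam + s • (Pi.single j (1 : ℝ) : Fin n → ℝ)) i j = uEE lam i j :=
  Finset.prod_congr rfl fun k hk => by
    rw [add_smul_single_of_ne lam (Finset.ne_of_mem_erase hk)]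

/-- The cofactor is affine in the moved coordinate, so after applying the linear map `phi` its
derivative can be read off. -/
theorem uE_add_single_of_ne (lam : Fin n → ℝ) {i j : Fin n} (h : j ≠ i) (s : ℝ) :
    uE (lam + s • (Pi.single j (1 : ℝ) : Fin n → ℝ)) i = uE lam i - Polynomial.C s * uEE lam i j := by
  rw [uE_eq_mul _ h, uE_eq_mul lam h, uEE_add_single, add_smul_single_self, map_add]
  ring

theorem eventually_add_single_mem_config (hlam : lam ∈ config n m) (a : Fin n → ℝ) :
    ∀ᶠ s : ℝ in 𝓝 0, lam + s • a ∈ config n m := by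
  have hline : HasDerivAt (fun s : ℝ => lam + s • a) a 0 := by
    simpa using ((hasDerivAt_id (0 : ℝ)).smul_const a).const_add lam
  have h1 := hline.continuousAt.tendsto
  rw [zero_smul, add_zero] at h1
  exact h1.eventually (eventually_mem_config hlam)

theorem hasLineDerivAt_W_mu (h : Sector n m r σ) (hlam : lam ∈ config n m) (i : Fin n) :
    HasLineDerivAt ℝ (fun p => W m r lam p)
      (-(lam i ^ m * (evalAt (phi σ (n + 1 - r) (uE lam i)) (lam i) / Delta lam i))) mu
      (Pi.single i 1) := by
  simp only [HasLineDerivAt, W_eq h hlam]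
  have h1 : ∀ k, HasDerivAt (fun s : ℝ => lam k ^ m * (mu + s • (Pi.single i (1 : ℝ) : Fin n → ℝ)) k *
      (evalAt (phi σ (n + 1 - r) (uE lam k)) (lam k) / Delta lam k))
      (if k = i then lam i ^ m * (evalAt (phi σ (n + 1 - r) (uE lam i)) (lam i) / Delta lam i)
        else 0) 0 := by
    intro k
    split_ifs with hk
    · subst hk
      simp only [add_smul_single_self]
      have h2 := (((hasDerivAt_id (0 : ℝ)).const_add (mu k)).const_mul (lam k ^ m)).mul_const
        (evalAt (phi σ (n + 1 - r) (uE lam k)) (lam k) / Delta lam k)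
      simpa using h2
    · simp only [add_smul_single_of_ne _ hk]
      exact hasDerivAt_const _ _
  have h3 := (HasDerivAt.fun_sum fun k (_ : k ∈ Finset.univ) => h1 k).fun_neg
  simpa using h3

theorem hasDerivAt_W_term_self (h : Sector n m r σ) (hlam : lam ∈ config n m) (j : Fin n) :
    HasDerivAt (fun s : ℝ => (lam + s • (Pi.single j (1 : ℝ) : Fin n → ℝ)) j ^ m * mu j *
      (evalAt (phi σ (n + 1 - r) (uE (lam + s • (Pi.single j (1 : ℝ) : Fin n → ℝ)) j))
        ((lam + s • (Pi.single j (1 : ℝ) : Fin n → ℝ)) j) / Delta (lam + s • (Pi.single j (1 : ℝ) : Fin n → ℝ)) j))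
      (m * lam j ^ (m - 1) * mu j *
          (evalAt (phi σ (n + 1 - r) (uE lam j)) (lam j) / Delta lam j) +
        lam j ^ m * mu j * ((evalAt (D (phi σ (n + 1 - r) (uE lam j))) (lam j) * Delta lam j -
          evalAt (phi σ (n + 1 - r) (uE lam j)) (lam j) *
            (Polynomial.derivative (uE lam j)).eval (lam j)) / Delta lam j ^ 2)) 0 := by
  simp only [← eval_uE_self, uE_add_single_self, add_smul_single_self]
  have hs : HasDerivAt (fun s : ℝ => lam j + s) 1 0 := (hasDerivAt_id (0 : ℝ)).const_add _
  have h1 : HasDerivAt (fun s : ℝ => evalAt (phi σ (n + 1 - r) (uE lam j)) (lam j + s))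
      (evalAt (D (phi σ (n + 1 - r) (uE lam j))) (lam j) * 1) 0 :=
    HasDerivAt.comp_of_eq (0 : ℝ) (hasDerivAt_evalAt (h.phi_mem_reg (hlam.2 j) _ _)) hs (by simp)
  have h2 : HasDerivAt (fun s : ℝ => (uE lam j).eval (lam j + s))
      ((Polynomial.derivative (uE lam j)).eval (lam j) * 1) 0 :=
    HasDerivAt.comp_of_eq (0 : ℝ) ((uE lam j).hasDerivAt (lam j)) hs (by simp)
  have h3 := ((hs.fun_pow m).mul_const (mu j)).fun_mul (h1.fun_div h2 (by
    rw [add_zero, eval_uE_self]; exact Delta_ne_zero hlam.1 j))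
  simpa using h3

theorem hasDerivAt_W_term_of_ne (hlam : lam ∈ config n m)
    {i j : Fin n} (hij : j ≠ i) :
    HasDerivAt (fun s : ℝ => (lam + s • (Pi.single j (1 : ℝ) : Fin n → ℝ)) i ^ m * mu i *
      (evalAt (phi σ (n + 1 - r) (uE (lam + s • (Pi.single j (1 : ℝ) : Fin n → ℝ)) i))
        ((lam + s • (Pi.single j (1 : ℝ) : Fin n → ℝ)) i) / Delta (lam + s • (Pi.single j (1 : ℝ) : Fin n → ℝ)) i))
      (lam i ^ m * mu i * ((-evalAt (phi σ (n + 1 - r) (uEE lam i j)) (lam i) * Delta lam i +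
          evalAt (phi σ (n + 1 - r) (uE lam i)) (lam i) * (uEE lam i j).eval (lam i)) /
          Delta lam i ^ 2)) 0 := by
  simp only [← eval_uE_self, uE_add_single_of_ne lam hij, add_smul_single_of_ne lam hij.symm,
    phi_sub, phi_C_mul, ← LaurentPolynomial.smul_eq_C_mul, evalAt_sub, evalAt_smul,
    Polynomial.eval_sub, Polynomial.eval_mul, Polynomial.eval_C]
  have h1 : HasDerivAt (fun s : ℝ => evalAt (phi σ (n + 1 - r) (uE lam i)) (lam i) -
      s * evalAt (phi σ (n + 1 - r) (uEE lam i j)) (lam i))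
      (-(1 * evalAt (phi σ (n + 1 - r) (uEE lam i j)) (lam i))) 0 :=
    ((hasDerivAt_id (0 : ℝ)).mul_const _).const_sub _
  have h2 : HasDerivAt (fun s : ℝ => (uE lam i).eval (lam i) - s * (uEE lam i j).eval (lam i))
      (-(1 * (uEE lam i j).eval (lam i))) 0 :=
    ((hasDerivAt_id (0 : ℝ)).mul_const _).const_sub _
  have h3 := (h1.fun_div h2 (by
    rw [zero_mul, sub_zero, eval_uE_self]; exact Delta_ne_zero hlam.1 i)).const_mul
    (lam i ^ m * mu i)
  simpa using h3

theorem evalAt_phi_uE_of_ne (h : Sector n m r σ) (hlam : lam ∈ config n m) {i j : Fin n}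
    (hij : j ≠ i) (k : Fin n) :
    evalAt (phi σ (n + 1 - r) (uE lam i)) (lam k) =
      (lam k - lam j) * evalAt (phi σ (n + 1 - r) (uEE lam i j)) (lam k) +
        (uEE lam i j).coeff (n - r) := by
  rw [phi_uE σ h.bounds.2 lam hij, evalAt_add, evalAt_C,
    evalAt_mul (linear_mem_reg _ _) (h.phi_mem_reg (hlam.2 k) _ _), evalAt_linear]

theorem evalAt_D_phi_uE (h : Sector n m r σ) (hlam : lam ∈ config n m) {i j : Fin n}
    (hij : j ≠ i) :
    evalAt (D (phi σ (n + 1 - r) (uE lam i))) (lam j) =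
      evalAt (phi σ (n + 1 - r) (uEE lam i j)) (lam j) := by
  have h1 := h.phi_mem_reg (hlam.2 j) (n + 1 - r) (uEE lam i j)
  rw [phi_uE σ h.bounds.2 lam hij, map_add, D_C, add_zero, D_mul, D_linear, one_mul, evalAt_add,
    evalAt_mul (linear_mem_reg _ _) (D_mem_reg h1), evalAt_linear]
  ring

theorem eval_derivative_uE (lam : Fin n → ℝ) {i j : Fin n} (hij : j ≠ i) :
    (Polynomial.derivative (uE lam i)).eval (lam j) = (uEE lam i j).eval (lam j) := by
  rw [uE_eq_mul lam hij]; simp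

theorem D_entryA (r : ℕ) (σ : ℝ) (lam mu : Fin n → ℝ) :
    D (entryA m r σ lam mu) = ∑ i, C (lam i ^ m * mu i / (2 * Delta lam i)) *
      D (phi σ (n + 1 - r) (uE lam i)) := by
  rw [entryA, map_sum]
  exact Finset.sum_congr rfl fun i _ => by rw [D_mul, D_C, zero_mul, zero_add]

theorem evalAt_D_entryA (r : ℕ) (σ : ℝ) (lam mu : Fin n → ℝ) (x : ℝ) :
    2 * evalAt (D (entryA m r σ lam mu)) x = ∑ i, lam i ^ m * mu i / Delta lam i *
      evalAt (D (phi σ (n + 1 - r) (uE lam i))) x := by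
  rw [D_entryA, evalAt_sum, Finset.mul_sum]
  refine Finset.sum_congr rfl fun i _ => ?_
  rw [← LaurentPolynomial.smul_eq_C_mul, evalAt_smul, mul_comm (2 : ℝ) (Delta lam i), ← div_div]
  ring

theorem eval_derivative_v (hlam : lam ∈ config n m) (x : ℝ) :
    (Polynomial.derivative (v m lam mu)).eval x = ∑ i, lam i ^ m * mu i / Delta lam i *
      (Polynomial.derivative (uE lam i)).eval x := by
  rw [v, interpolate_eq_sum hlam.1, Polynomial.derivative_sum, Polynomial.eval_finsetSum]
  exact Finset.sum_congr rfl fun i _ => by simp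

/-- The derivative is arranged so that A'(λⱼ), the derivative of the diagonal entry of U_r, appears;
exactly this term is needed for v̇ = ½S + 2xᵐA'. The comparison is made summand by summand: for i ≠
j all quantities are expressed through `uEE lam i j`, and the rule for `phi` relates the values at
λᵢ and λⱼ. -/
theorem hasLineDerivAt_W_lam (h : Sector n m r σ) (hlam : lam ∈ config n m) (j : Fin n) :
    HasLineDerivAt ℝ (fun l => W m r l mu)
      (((Polynomial.derivative (v m lam mu)).eval (lam j) - m * lam j ^ (m - 1) * mu j) *
        evalAt (phi σ (n + 1 - r) (uE lam j)) (lam j) / Delta lam j -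
        2 * evalAt (D (entryA m r σ lam mu)) (lam j)) lam (Pi.single j 1) := by
  let G : Fin n → ℝ := fun i => if i = j then
      (m * lam j ^ (m - 1) * mu j *
          (evalAt (phi σ (n + 1 - r) (uE lam j)) (lam j) / Delta lam j) +
        lam j ^ m * mu j * ((evalAt (D (phi σ (n + 1 - r) (uE lam j))) (lam j) * Delta lam j -
          evalAt (phi σ (n + 1 - r) (uE lam j)) (lam j) *
            (Polynomial.derivative (uE lam j)).eval (lam j)) / Delta lam j ^ 2))
    else (lam i ^ m * mu i * ((-evalAt (phi σ (n + 1 - r) (uEE lam i j)) (lam i) * Delta lam i +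
          evalAt (phi σ (n + 1 - r) (uE lam i)) (lam i) * (uEE lam i j).eval (lam i)) /
          Delta lam i ^ 2))
  have h1 : ∀ i, HasDerivAt (fun s : ℝ => (lam + s • (Pi.single j (1 : ℝ) : Fin n → ℝ)) i ^ m * mu i *
      (evalAt (phi σ (n + 1 - r) (uE (lam + s • (Pi.single j (1 : ℝ) : Fin n → ℝ)) i))
        ((lam + s • (Pi.single j (1 : ℝ) : Fin n → ℝ)) i) / Delta (lam + s • (Pi.single j (1 : ℝ) : Fin n → ℝ)) i))
      (G i) 0 := by
    intro i
    by_cases hij : i = j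
    · subst hij
      simp only [G, if_true]
      exact hasDerivAt_W_term_self h hlam i
    · simp only [G, if_neg hij]
      exact hasDerivAt_W_term_of_ne hlam (Ne.symm hij)
  have h2 := ((HasDerivAt.fun_sum fun i (_ : i ∈ Finset.univ) => h1 i).fun_neg).congr_of_eventuallyEq
    (f₁ := fun s : ℝ => W m r (lam + s • (Pi.single j (1 : ℝ) : Fin n → ℝ)) mu) (by
      filter_upwards [eventually_add_single_mem_config hlam (Pi.single j 1)] with s hs
      exact W_eq h hs mu)
  have h3 : -∑ i, G i = ((Polynomial.derivative (v m lam mu)).eval (lam j) -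
      m * lam j ^ (m - 1) * mu j) *
        evalAt (phi σ (n + 1 - r) (uE lam j)) (lam j) / Delta lam j -
        2 * evalAt (D (entryA m r σ lam mu)) (lam j) := by
    -- The single term with mλⱼ^{m-1} is spread over the sum, so that both sides can be compared
    -- summandwise.
    have h4 : m * lam j ^ (m - 1) * mu j *
        (evalAt (phi σ (n + 1 - r) (uE lam j)) (lam j) / Delta lam j) =
        ∑ i, if i = j then m * lam j ^ (m - 1) * mu j *
          (evalAt (phi σ (n + 1 - r) (uE lam j)) (lam j) / Delta lam j) else 0 := by simp
    rw [eval_derivative_v hlam, evalAt_D_entryA, sub_mul, sub_div, mul_div_assoc,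
      mul_div_assoc (m * lam j ^ (m - 1) * mu j), h4, Finset.sum_mul, ← Finset.sum_sub_distrib,
      ← Finset.sum_sub_distrib, ← Finset.sum_neg_distrib]
    refine Finset.sum_congr rfl fun i _ => ?_
    have hΔ := Delta_ne_zero hlam.1 j
    by_cases hij : i = j
    · subst hij
      simp only [G, if_true]
      field_simp
      ring
    · have hij' : j ≠ i := Ne.symm hij
      have hΔi := Delta_ne_zero hlam.1 i
      simp only [G, if_neg hij]
      rw [eval_derivative_uE lam hij', evalAt_D_phi_uE h hlam hij',
        evalAt_phi_uE_of_ne h hlam hij' i, evalAt_phi_uE_of_ne h hlam hij j, uEE_comm lam j i]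
      have e1 := Delta_eq_mul lam hij'
      have e2 := Delta_eq_mul lam hij
      rw [uEE_comm lam j i] at e2
      rw [e1] at hΔi ⊢
      rw [e2] at hΔ ⊢
      have n1 := left_ne_zero_of_mul hΔi
      have n2 := right_ne_zero_of_mul hΔi
      have n3 := right_ne_zero_of_mul hΔ
      have n4 := left_ne_zero_of_mul hΔ
      field_simp
      ring
  rw [← h3]
  exact h2

end PainleveLax
end

/-! ### Hamilton's equations and the deformations -/

noncomputable section

namespace PainleveLax

open LaurentPolynomial (T C)
open Filter Topology

variable {n m r : ℕ} {σ : ℝ} {lam mu : Fin n → ℝ} {N : ℝ[X]}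

/-! ### Derivatives of the Hamiltonians -/

theorem coeff_eq_sum_of_degree_lt (h : Function.Injective lam) {p : ℝ[X]} (hp : p.degree < n)
    (k : ℕ) : p.coeff k = ∑ i, p.eval (lam i) / Delta lam i * (uE lam i).coeff k := by
  conv_lhs => rw [eq_sum_of_degree_lt h hp]
  rw [Polynomial.finsetSum_coeff]
  simp only [Polynomial.coeff_C_mul]

/-- With λ fixed, the differentiated spectral curve at λⱼ reads v v̇ = xᵐḣ. So ḣ vanishes at every
node but the i-th, and interpolation gives its coefficients. -/
theorem hasLineDerivAt_hpoly_mu (hlam : lam ∈ config n m) (hm : m ≤ n + 1)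
    (hN : N.natDegree ≤ 2 * n + 2) (i : Fin n) (k : ℕ) :
    HasLineDerivAt ℝ (fun p => (hpoly m N lam p).coeff k)
      (lam i ^ m * mu i * (uE lam i).coeff k / Delta lam i) mu (Pi.single i 1) := by
  obtain ⟨u', v', h', w', -, -, hh, -, hc⟩ := exists_curveDeriv (a := 0) (b := Pi.single i 1)
    (mu := mu) (N := fun _ : ℝ => N) (t := 0) (y := 0) (N' := 0) hlam hm (coeffDiffAt_const _)
    (fun _ => hN) (hasCoeffDerivAt_const _)
  have h1 : ∀ j, h'.eval (lam j) = if j = i then lam j ^ m * mu j else 0 := by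
    intro j
    have h2 := congrArg (Polynomial.eval (lam j)) hc.spectral
    simp only [Polynomial.eval_add, Polynomial.eval_mul, eval_u, hc.eval_u, hc.eval_v,
      eval_v hlam, Polynomial.eval_pow, Polynomial.eval_X, Polynomial.eval_ofNat,
      Polynomial.eval_zero, Pi.zero_apply] at h2
    have h3 := hlam.2 j
    have h4 : 2 * lam j ^ m * (h'.eval (lam j) -
        lam j ^ m * mu j * (Pi.single i (1 : ℝ) : Fin n → ℝ) j) = 0 := by
      linear_combination -h2
    have h5 := (mul_eq_zero.1 h4).resolve_left (mul_ne_zero two_ne_zero h3)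
    rw [sub_eq_zero] at h5
    rw [h5, Pi.single_apply, mul_ite, mul_one, mul_zero]
  have h2 := hh k
  rw [coeff_eq_sum_of_degree_lt hlam.1 hc.degree_h] at h2
  simp only [h1, ite_div, zero_div, ite_mul, zero_mul, Finset.sum_ite_eq', Finset.mem_univ,
    if_true, smul_zero, add_zero] at h2
  rw [HasLineDerivAt, mul_div_right_comm]
  exact h2

/-- At λⱼ the differentiated spectral curve reads u̇w + 2v v̇ = 2xᵐḣ, and all three derivatives
vanish there for j ≠ i. The value of w enters through u̇(λᵢ) = -Δᵢ. -/
theorem hasLineDerivAt_hpoly_lam (hlam : lam ∈ config n m) (hm : m ≤ n + 1)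
    (hN : N.natDegree ≤ 2 * n + 2) (i : Fin n) (k : ℕ) :
    HasLineDerivAt ℝ (fun l => (hpoly m N l mu).coeff k)
      ((lam i ^ m * mu i * (m * lam i ^ (m - 1) * mu i -
        (Polynomial.derivative (v m lam mu)).eval (lam i)) -
        1 / 2 * Delta lam i * (wpoly m N lam mu).eval (lam i)) / lam i ^ m *
        (uE lam i).coeff k / Delta lam i) lam (Pi.single i 1) := by
  obtain ⟨u', v', h', w', -, -, hh, -, hc⟩ := exists_curveDeriv (a := Pi.single i 1) (b := 0)
    (mu := mu) (N := fun _ : ℝ => N) (t := 0) (y := 0) (N' := 0) hlam hm (coeffDiffAt_const _)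
    (fun _ => hN) (hasCoeffDerivAt_const _)
  have h1 : ∀ j, h'.eval (lam j) = if j = i then (lam j ^ m * mu j * (m * lam j ^ (m - 1) * mu j -
        (Polynomial.derivative (v m lam mu)).eval (lam j)) -
        1 / 2 * Delta lam j * (wpoly m N lam mu).eval (lam j)) / lam j ^ m else 0 := by
    intro j
    have h2 := congrArg (Polynomial.eval (lam j)) hc.spectral
    simp only [Polynomial.eval_add, Polynomial.eval_mul, eval_u, hc.eval_u, hc.eval_v,
      eval_v hlam, Polynomial.eval_pow, Polynomial.eval_X, Polynomial.eval_ofNat,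
      Polynomial.eval_zero, Pi.zero_apply] at h2
    have h3 := hlam.2 j
    split_ifs with hj
    · subst hj
      simp only [Pi.single_eq_same] at h2
      rw [eq_div_iff h3]
      linear_combination -(1 / 2 : ℝ) * h2
    · rw [Pi.single_eq_of_ne hj] at h2
      have h4 : 2 * lam j ^ m * h'.eval (lam j) = 0 := by linear_combination -h2
      exact (mul_eq_zero.1 h4).resolve_left (mul_ne_zero two_ne_zero h3)
  have h2 := hh k
  rw [coeff_eq_sum_of_degree_lt hlam.1 hc.degree_h] at h2
  simp only [h1, ite_div, zero_div, ite_mul, zero_mul, Finset.sum_ite_eq', Finset.mem_univ,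
    if_true, smul_zero, add_zero] at h2
  rw [HasLineDerivAt, mul_div_right_comm]
  exact h2

theorem hA_eq {c : ℤ → ℝ} (h : PotRelation n m c N) (hlam : lam ∈ config n m) (r : ℕ) :
    hA m c r lam mu = (hpoly m N lam mu).coeff (n - r) + W m r lam mu := by
  rw [hA, sepSol_Psi_eq h hlam]

theorem hasLineDerivAt_hA_mu (h : Sector n m r σ) (hlam : lam ∈ config n m) (hm : m ≤ n + 1)
    {c : ℤ → ℝ} (hc : PotRelation n m c N) (hN : N.natDegree ≤ 2 * n + 2) (i : Fin n) :
    HasLineDerivAt ℝ (fun p => hA m c r lam p)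
      ((lam i ^ m * mu i * evalAt (phi σ (n + 1 - r) (u lam)) (lam i) -
        lam i ^ m * evalAt (D (phi σ (n + 1 - r) (u lam))) (lam i)) / Delta lam i) mu
      (Pi.single i 1) := by
  simp only [hA_eq hc hlam]
  have h1 := HasDerivAt.fun_add (hasLineDerivAt_hpoly_mu (mu := mu) hlam hm hN i (n - r))
    (hasLineDerivAt_W_mu (mu := mu) h hlam i)
  rw [evalAt_phi_u h hlam, evalAt_D_phi_u h hlam, HasLineDerivAt, sub_div, sub_eq_add_neg,
    mul_div_assoc (lam i ^ m)]
  exact h1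

theorem hasLineDerivAt_hA_lam (h : Sector n m r σ) (hlam : lam ∈ config n m) (hm : m ≤ n + 1)
    {c : ℤ → ℝ} (hc : PotRelation n m c N) (hN : N.natDegree ≤ 2 * n + 2) (i : Fin n) :
    HasLineDerivAt ℝ (fun l => hA m c r l mu)
      ((lam i ^ m * mu i * (m * lam i ^ (m - 1) * mu i -
        (Polynomial.derivative (v m lam mu)).eval (lam i)) -
        1 / 2 * Delta lam i * (wpoly m N lam mu).eval (lam i)) / lam i ^ m *
        evalAt (phi σ (n + 1 - r) (u lam)) (lam i) / Delta lam i +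
        (((Polynomial.derivative (v m lam mu)).eval (lam i) - m * lam i ^ (m - 1) * mu i) *
        evalAt (D (phi σ (n + 1 - r) (u lam))) (lam i) / Delta lam i -
        2 * evalAt (D (entryA m r σ lam mu)) (lam i))) lam (Pi.single i 1) := by
  rw [evalAt_phi_u h hlam, evalAt_D_phi_u h hlam]
  refine (HasDerivAt.fun_add (hasLineDerivAt_hpoly_lam (mu := mu) hlam hm hN i (n - r))
    (hasLineDerivAt_W_lam (mu := mu) h hlam i)).congr_of_eventuallyEq ?_
  filter_upwards [eventually_add_single_mem_config hlam (Pi.single i 1)] with s hs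
  exact hA_eq hc hs r

/-! ### Deformations as linear combinations -/

open Classical in
/-- The coefficients of the deformation -/
def defCoef (n m : ℕ) (ζ : ℕ → ℕ → ℝ) (r j : ℕ) : ℝ :=
  if r = 1 ∨ I1 n m r then
    if r ≤ kappa1 n m then if j = r then 1 else 0 else if j ≤ r then ζ r j else 0
  else
    if r ≤ n - kappa2 m then if r ≤ j then ζ r j else 0 else if j = r then 1 else 0

theorem deform_eq_sum {E : Type*} [AddCommGroup E] [Module ℝ E] (ζ : ℕ → ℕ → ℝ)
    (X : ℕ → E) (h1 : 1 ≤ r) (h2 : r ≤ n) :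
    deform n m ζ X r = ∑ j ∈ Finset.Icc 1 n, defCoef n m ζ r j • X j := by
  have hr : r ∈ Finset.Icc 1 n := Finset.mem_Icc.2 ⟨h1, h2⟩
  have hsingle : ∑ j ∈ Finset.Icc 1 n, (if j = r then (1 : ℝ) else 0) • X j = X r := by
    simp only [ite_smul, one_smul, zero_smul, Finset.sum_ite_eq', if_pos hr]
  unfold deform defCoef
  split_ifs with h3 h4 h4
  · exact hsingle.symm
  · simp only [ite_smul, zero_smul]
    rw [← Finset.sum_filter]
    refine Finset.sum_congr ?_ fun _ _ => rfl
    ext j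
    simp only [Finset.mem_Icc, Finset.mem_filter]
    omega
  · simp only [ite_smul, zero_smul]
    rw [← Finset.sum_filter]
    refine Finset.sum_bij' (fun j _ => r + j) (fun j _ => j - r) ?_ ?_ ?_ ?_ fun _ _ => rfl
    all_goals
      intro j hj
      simp only [Finset.mem_range, Finset.mem_Icc, Finset.mem_filter] at hj ⊢
      omega
  · exact hsingle.symm

theorem Sector.iff_zero (h1 : 1 ≤ r) (h2 : r ≤ n) : (r = 1 ∨ I1 n m r) ↔ Sector n m r 0 := by
  unfold Sector I1
  constructor
  · rintro h
    exact Or.inl ⟨rfl, by omega, by omega, by omega⟩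
  · rintro (⟨-, h⟩ | ⟨h, -⟩)
    · omega
    · exact absurd h zero_ne_one

/-- A deformation mixes only indices from the same range: on {1} ∪ I₁ it involves j ≤ r, on I₂ it
involves j ≥ r. Hence a single σ serves for the whole combination. -/
theorem Sector.of_defCoef {ζ : ℕ → ℕ → ℝ} (h : Sector n m r σ) {j : ℕ} (hj : 1 ≤ j) (hj' : j ≤ n)
    (h0 : defCoef n m ζ r j ≠ 0) : Sector n m j σ := by
  unfold defCoef at h0
  rcases h with ⟨rfl, h1, h2, h3⟩ | ⟨rfl, h1, h2, h3⟩
  · rw [if_pos ((Sector.iff_zero h1 h2).2 (Or.inl ⟨rfl, h1, h2, h3⟩))] at h0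
    split_ifs at h0 with h4 h5 h5
    · rw [h5]; exact Or.inl ⟨rfl, h1, h2, h3⟩
    · exact absurd rfl h0
    · exact Or.inl ⟨rfl, hj, hj', by omega⟩
    · exact absurd rfl h0
  · rw [if_neg (by unfold I1; omega)] at h0
    split_ifs at h0 with h4 h5 h5
    · exact Or.inr ⟨rfl, by omega, hj', by omega⟩
    · exact absurd rfl h0
    · rw [h5]; exact Or.inr ⟨rfl, h1, h2, h3⟩
    · exact absurd rfl h0

/-! ### Derivatives of the deformed Hamiltonians -/

/-- The combination of the functions `phi` for a deformed flow -/
def phiBar (n : ℕ) (σ : ℝ) (z : ℕ → ℝ) (p : ℝ[X]) : ℝ[T;T⁻¹] :=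
  ∑ j ∈ Finset.Icc 1 n, z j • phi σ (n + 1 - j) p

/-- The diagonal entry of the deformed matrix `U` -/
def entryABar (m : ℕ) (σ : ℝ) (z : ℕ → ℝ) (lam mu : Fin n → ℝ) : ℝ[T;T⁻¹] :=
  ∑ j ∈ Finset.Icc 1 n, z j • entryA m j σ lam mu

theorem D_smul (a : ℝ) (b : ℝ[T;T⁻¹]) : D (a • b) = a • D b := Derivation.map_smul D a b

/-- Differentiability is required only for indices with nonzero weight, because only these are known
to belong to the range of σ. -/
theorem hasLineDerivAt_sum {E : Type*} [NormedAddCommGroup E] [NormedSpace ℝ E] {s : Finset ℕ}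
    {z : ℕ → ℝ} {f : ℕ → E → ℝ} {f' : ℕ → ℝ} {x y : E}
    (h : ∀ j ∈ s, z j ≠ 0 → HasLineDerivAt ℝ (f j) (f' j) x y) :
    HasLineDerivAt ℝ (fun x => ∑ j ∈ s, z j * f j x) (∑ j ∈ s, z j * f' j) x y := by
  refine HasDerivAt.fun_sum fun j hj => ?_
  by_cases h0 : z j = 0
  · simp only [h0, zero_mul]
    exact hasDerivAt_const _ _
  · exact HasDerivAt.const_mul (z j) (h j hj h0)

section

variable {c : ℤ → ℝ} {z : ℕ → ℝ}

theorem hasLineDerivAt_sum_hA_mu (hz : ∀ j ∈ Finset.Icc 1 n, z j ≠ 0 → Sector n m j σ)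
    (hlam : lam ∈ config n m) (hm : m ≤ n + 1) (hc : PotRelation n m c N)
    (hN : N.natDegree ≤ 2 * n + 2) (i : Fin n) :
    HasLineDerivAt ℝ (fun p => ∑ j ∈ Finset.Icc 1 n, z j * hA m c j lam p)
      ((lam i ^ m * mu i * evalAt (phiBar n σ z (u lam)) (lam i) -
        lam i ^ m * evalAt (D (phiBar n σ z (u lam))) (lam i)) / Delta lam i) mu
      (Pi.single i 1) := by
  convert! hasLineDerivAt_sum fun j hj h0 =>
    hasLineDerivAt_hA_mu (mu := mu) (hz j hj h0) hlam hm hc hN i using 1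
  simp only [phiBar, map_sum, D_smul, evalAt_sum, evalAt_smul]
  simp only [Finset.mul_sum, ← Finset.sum_sub_distrib, Finset.sum_div]
  exact Finset.sum_congr rfl fun j _ => by ring

theorem hasLineDerivAt_sum_hA_lam (hz : ∀ j ∈ Finset.Icc 1 n, z j ≠ 0 → Sector n m j σ)
    (hlam : lam ∈ config n m) (hm : m ≤ n + 1) (hc : PotRelation n m c N)
    (hN : N.natDegree ≤ 2 * n + 2) (i : Fin n) :
    HasLineDerivAt ℝ (fun l => ∑ j ∈ Finset.Icc 1 n, z j * hA m c j l mu)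
      ((lam i ^ m * mu i * (m * lam i ^ (m - 1) * mu i -
        (Polynomial.derivative (v m lam mu)).eval (lam i)) -
        1 / 2 * Delta lam i * (wpoly m N lam mu).eval (lam i)) / lam i ^ m *
        evalAt (phiBar n σ z (u lam)) (lam i) / Delta lam i +
        (((Polynomial.derivative (v m lam mu)).eval (lam i) - m * lam i ^ (m - 1) * mu i) *
        evalAt (D (phiBar n σ z (u lam))) (lam i) / Delta lam i -
        2 * evalAt (D (entryABar m σ z lam mu)) (lam i))) lam (Pi.single i 1) := by
  convert! hasLineDerivAt_sum fun j hj h0 =>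
    hasLineDerivAt_hA_lam (mu := mu) (hz j hj h0) hlam hm hc hN i using 1
  simp only [phiBar, entryABar, map_sum, D_smul, evalAt_sum, evalAt_smul]
  simp only [Finset.mul_sum, ← Finset.sum_sub_distrib, Finset.sum_div, ← Finset.sum_add_distrib]
  exact Finset.sum_congr rfl fun j _ => by ring

end

end PainleveLax
end

noncomputable section

namespace PainleveLax

open LaurentPolynomial (T C)

variable {n m r : ℕ} {σ : ℝ} {lam mu : Fin n → ℝ}

/-! ### The behaviour of the trace of `U'L` at infinity and at zero -/

/-- The bilinear expression `2 φ' u M + φ u M' - 2 φ u' M` -/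
def bracket (U φ M : ℝ[T;T⁻¹]) : ℝ[T;T⁻¹] := 2 * D φ * U * M + φ * U * D M - 2 * φ * D U * M

theorem two_mem_degLE : (2 : ℝ[T;T⁻¹]) ∈ degLE 0 := two_eq_C ▸ C_mem_degLE 2

theorem two_mem_ordGE : (2 : ℝ[T;T⁻¹]) ∈ ordGE 0 := two_eq_C ▸ C_mem_ordGE 2

theorem bracket_mem_degLE {U φ M : ℝ[T;T⁻¹]} {a b c K : ℤ} (hU : U ∈ degLE a) (hφ : φ ∈ degLE b)
    (hM : M ∈ degLE c) (hK : a + b + c - 1 ≤ K) : bracket U φ M ∈ degLE K := by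
  refine sub_mem (add_mem ?_ ?_) ?_
  · exact mul_mem_degLE (by omega) (mul_mem_degLE le_rfl (mul_mem_degLE le_rfl two_mem_degLE
      (D_mem_degLE le_rfl hφ)) hU) hM
  · exact mul_mem_degLE (by omega) (mul_mem_degLE le_rfl hφ hU) (D_mem_degLE le_rfl hM)
  · exact mul_mem_degLE (by omega) (mul_mem_degLE le_rfl (mul_mem_degLE le_rfl two_mem_degLE hφ)
      (D_mem_degLE le_rfl hU)) hM

theorem bracket_mem_ordGE {U φ M : ℝ[T;T⁻¹]} {a b c K : ℤ} (hU : U ∈ ordGE a) (hφ : φ ∈ ordGE b)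
    (hM : M ∈ ordGE c) (hK : K ≤ a + b + c - 1) : bracket U φ M ∈ ordGE K := by
  refine sub_mem (add_mem ?_ ?_) ?_
  · exact mul_mem_ordGE (by omega) (mul_mem_ordGE le_rfl (mul_mem_ordGE le_rfl two_mem_ordGE
      (D_mem_ordGE le_rfl hφ)) hU) hM
  · exact mul_mem_ordGE (by omega) (mul_mem_ordGE le_rfl hφ hU) (D_mem_ordGE le_rfl hM)
  · exact mul_mem_ordGE (by omega) (mul_mem_ordGE le_rfl (mul_mem_ordGE le_rfl two_mem_ordGE hφ)
      (D_mem_ordGE le_rfl hU)) hM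

theorem bracket_mem_ordGE_zero {U φ M : ℝ[T;T⁻¹]} (hU : U ∈ ordGE 0) (hφ : φ ∈ ordGE 0)
    (hM : M ∈ ordGE 0) : bracket U φ M ∈ ordGE 0 := by
  have h0 : (0 : ℤ) ≤ 0 + 0 := (zero_add 0).ge
  refine sub_mem (add_mem ?_ ?_) ?_
  · exact mul_mem_ordGE h0 (mul_mem_ordGE h0 (mul_mem_ordGE h0 two_mem_ordGE
      (D_mem_ordGE_zero hφ)) hU) hM
  · exact mul_mem_ordGE h0 (mul_mem_ordGE h0 hφ hU) (D_mem_ordGE_zero hM)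
  · exact mul_mem_ordGE h0 (mul_mem_ordGE h0 (mul_mem_ordGE h0 two_mem_ordGE hφ)
      (D_mem_ordGE_zero hU)) hM

/-- The leading coefficient of the bracket cancels for these degrees. -/
theorem bracket_mem_degLE_of_neg {U φ M : ℝ[T;T⁻¹]} (hU : U ∈ degLE n) (hφ : φ ∈ degLE (-1))
    (hM : M ∈ degLE (2 * n + 2)) : bracket U φ M ∈ degLE (3 * n - 1) := by
  have h1 := euler_sub_mem_degLE hU
  have h2 := euler_sub_mem_degLE hφ
  have h3 := euler_sub_mem_degLE hM
  -- The leading contributions carry the total factor 2·(-1) + (2n+2) - 2n = 0. Replacing each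
  -- derivative by x d/dx minus its leading exponent therefore does not change the bracket.
  have e : bracket U φ M = T (-1) * (2 * (T 1 * D φ - ((-1 : ℤ) : ℝ) • φ) * U * M +
      φ * U * (T 1 * D M - ((2 * n + 2 : ℤ) : ℝ) • M) -
      2 * φ * (T 1 * D U - ((n : ℤ) : ℝ) • U) * M) := by
    have hT : (T (-1) : ℝ[T;T⁻¹]) * T 1 = 1 := by
      rw [← LaurentPolynomial.T_add]; simp
    simp only [LaurentPolynomial.smul_eq_C_mul, bracket]
    push_cast
    simp only [map_add, map_mul, map_neg, map_one, map_ofNat, map_natCast]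
    linear_combination -(2 * D φ * U * M + φ * U * D M - 2 * φ * D U * M) * hT
  rw [e]
  refine mul_mem_degLE (by omega : (-1 : ℤ) + 3 * n ≤ _) (T_mem_degLE le_rfl)
    (sub_mem (add_mem ?_ ?_) ?_)
  · exact mul_mem_degLE (by omega) (mul_mem_degLE le_rfl (mul_mem_degLE le_rfl two_mem_degLE h2)
      hU) hM
  · exact mul_mem_degLE (by omega) (mul_mem_degLE le_rfl hφ hU) h3
  · exact mul_mem_degLE (by omega) (mul_mem_degLE le_rfl (mul_mem_degLE le_rfl two_mem_degLE hφ)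
      h1) hM

theorem bracket_add_right (U φ M M' : ℝ[T;T⁻¹]) :
    bracket U φ (M + M') = bracket U φ M + bracket U φ M' := by
  simp only [bracket, map_add]; ring

/-- For φ = x^{-k}U the derivatives of U cancel, and what remains is U² times a derivative of M and
of x^{-k}. On M = P² this is 2P(x^{-k}P)', the same expression that governs the evolution of the
magnetic potentials. -/
theorem bracket_main (U P : ℝ[T;T⁻¹]) (ε : ℝ) (k j : ℤ) :
    bracket U (T (-k) * U) (P ^ 2 + C ε * T j) =
      U ^ 2 * (2 * P * D (T (-k) * P) + C ((j - 2 * k) * ε) * T (j - k - 1)) := by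
  have h1 : (T (j - k - 1) : ℝ[T;T⁻¹]) = T (-k - 1) * T j := by
    rw [← LaurentPolynomial.T_add]; congr 1; ring
  have h2 : (T (j - 1) : ℝ[T;T⁻¹]) * T (-k) = T (-k - 1) * T j := by
    rw [← LaurentPolynomial.T_add, ← LaurentPolynomial.T_add]; congr 1; ring
  rw [bracket, map_add, D_mul, D_mul (C ε), D_C, D_mul, D_T, D_T, pow_two, D_mul, h1]
  push_cast
  simp only [map_mul, map_neg, map_sub, map_ofNat]
  linear_combination (U ^ 2 * C ε * C (j : ℝ)) * h2

/-- The bracketed factor on the left is twice the trace of U_r'L. Both division relations and the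
relation for the determinant are differentiated, which eliminates Q', A' and w; only the remainders
R, S survive, as Wronskians with U. -/
theorem trace_identity {φ U V w A Q R S M : ℝ[T;T⁻¹]} (h1 : φ * V = 2 * A * U + R)
    (h2 : φ * w = 2 * Q * U + S) (h3 : w * U = M - V ^ 2) :
    U ^ 2 * (2 * D Q * U + D φ * w + 4 * V * D A) = bracket U φ M -
      U * (D S * U - S * D U) - 2 * V * (D R * U - R * D U) := by
  have d2 : (D (2 : ℝ[T;T⁻¹])) = 0 := by rw [two_eq_C, D_C]
  have h1' := congrArg D h1
  have h2' := congrArg D h2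
  have h3' := congrArg D h3
  simp only [map_add, map_sub, D_mul, pow_two, d2] at h1' h2' h3'
  rw [bracket]
  linear_combination (-U ^ 2) * h2' + (U * D U) * h2 - (2 * V * U) * h1' + (2 * V * D U) * h1 +
    (2 * D φ * U - 2 * φ * D U) * h3 + (φ * U) * h3'

/-- The data of the matrices of a flow: `φ / 2`, `A`, `Q` are the entries of the matrix `U`. -/
structure IsLaxData (n m : ℕ) (lam : Fin n → ℝ) (V w P : ℝ[T;T⁻¹]) (ε : ℝ)
    (φ A Q : ℝ[T;T⁻¹]) (R S : ℝ[X]) (ψ : ℝ[T;T⁻¹]) (κ : ℝ) : Prop where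
  reg_φ : ∀ x : ℝ, x ^ m ≠ 0 → φ ∈ reg x
  reg_A : ∀ x : ℝ, x ^ m ≠ 0 → A ∈ reg x
  reg_Q : ∀ x : ℝ, x ^ m ≠ 0 → Q ∈ reg x
  degree_R : R.degree < n
  degree_S : S.degree < n
  mul_V : φ * V = 2 * A * (u lam).toLaurent + R.toLaurent
  mul_w : φ * w = 2 * Q * (u lam).toLaurent + S.toLaurent
  deg_φ : T m * D φ ∈ degLE (n - 1)
  ord_φ : T m * D φ ∈ ordGE 0
  deg_A : T m * D A ∈ degLE (n - 1)
  ord_A : T m * D A ∈ ordGE 0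
  deg_trace : 2 * D Q * (u lam).toLaurent + D φ * w + 4 * V * D A - 2 * P * D ψ -
    C (2 * ε * κ) * T n ∈ degLE (n - 1)
  ord_trace : 2 * D Q * (u lam).toLaurent + D φ * w + 4 * V * D A - 2 * P * D ψ -
    C (2 * ε * κ) * T n ∈ ordGE 0

theorem IsLaxData.zero (V w P : ℝ[T;T⁻¹]) (ε : ℝ) : IsLaxData n m lam V w P ε 0 0 0 0 0 0 0 := by
  constructor <;> simp [zero_mem]

/-- For fixed V, w, P and ε every condition is linear in the remaining data; together with
`IsLaxData.smul` this carries the structure over to deformed flows. -/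
theorem IsLaxData.add {V w P : ℝ[T;T⁻¹]} {ε : ℝ} {φ A Q φ' A' Q' ψ ψ' : ℝ[T;T⁻¹]} {R S R' S' : ℝ[X]}
    {κ κ' : ℝ} (h : IsLaxData n m lam V w P ε φ A Q R S ψ κ)
    (h' : IsLaxData n m lam V w P ε φ' A' Q' R' S' ψ' κ') :
    IsLaxData n m lam V w P ε (φ + φ') (A + A') (Q + Q') (R + R') (S + S') (ψ + ψ') (κ + κ') where
  reg_φ x hx := add_mem (h.reg_φ x hx) (h'.reg_φ x hx)
  reg_A x hx := add_mem (h.reg_A x hx) (h'.reg_A x hx)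
  reg_Q x hx := add_mem (h.reg_Q x hx) (h'.reg_Q x hx)
  degree_R := lt_of_le_of_lt (Polynomial.degree_add_le _ _) (max_lt h.degree_R h'.degree_R)
  degree_S := lt_of_le_of_lt (Polynomial.degree_add_le _ _) (max_lt h.degree_S h'.degree_S)
  mul_V := by rw [map_add]; linear_combination h.mul_V + h'.mul_V
  mul_w := by rw [map_add]; linear_combination h.mul_w + h'.mul_w
  deg_φ := by rw [map_add, mul_add]; exact add_mem h.deg_φ h'.deg_φ
  ord_φ := by rw [map_add, mul_add]; exact add_mem h.ord_φ h'.ord_φ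
  deg_A := by rw [map_add, mul_add]; exact add_mem h.deg_A h'.deg_A
  ord_A := by rw [map_add, mul_add]; exact add_mem h.ord_A h'.ord_A
  deg_trace := by
    convert! add_mem h.deg_trace h'.deg_trace using 1
    simp only [map_add, mul_add]; ring
  ord_trace := by
    convert! add_mem h.ord_trace h'.ord_trace using 1
    simp only [map_add, mul_add]; ring

theorem IsLaxData.smul {V w P : ℝ[T;T⁻¹]} {ε : ℝ} {φ A Q ψ : ℝ[T;T⁻¹]} {R S : ℝ[X]}
    {κ : ℝ} (h : IsLaxData n m lam V w P ε φ A Q R S ψ κ) (a : ℝ) :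
    IsLaxData n m lam V w P ε (a • φ) (a • A) (a • Q) (a • R) (a • S) (a • ψ) (a * κ) where
  reg_φ x hx := Subalgebra.smul_mem _ (h.reg_φ x hx) a
  reg_A x hx := Subalgebra.smul_mem _ (h.reg_A x hx) a
  reg_Q x hx := Subalgebra.smul_mem _ (h.reg_Q x hx) a
  degree_R := lt_of_le_of_lt (Polynomial.degree_smul_le _ _) h.degree_R
  degree_S := lt_of_le_of_lt (Polynomial.degree_smul_le _ _) h.degree_S
  mul_V := by
    rw [Polynomial.smul_eq_C_mul, map_mul, Polynomial.toLaurent_C]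
    simp only [LaurentPolynomial.smul_eq_C_mul]
    linear_combination C a * h.mul_V
  mul_w := by
    rw [Polynomial.smul_eq_C_mul, map_mul, Polynomial.toLaurent_C]
    simp only [LaurentPolynomial.smul_eq_C_mul]
    linear_combination C a * h.mul_w
  deg_φ := by rw [D_smul, mul_smul_comm]; exact Submodule.smul_mem _ a h.deg_φ
  ord_φ := by rw [D_smul, mul_smul_comm]; exact Submodule.smul_mem _ a h.ord_φ
  deg_A := by rw [D_smul, mul_smul_comm]; exact Submodule.smul_mem _ a h.deg_A
  ord_A := by rw [D_smul, mul_smul_comm]; exact Submodule.smul_mem _ a h.ord_A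
  deg_trace := by
    convert! Submodule.smul_mem _ a h.deg_trace using 1
    simp only [D_smul]
    simp only [LaurentPolynomial.smul_eq_C_mul, map_mul]; ring
  ord_trace := by
    convert! Submodule.smul_mem _ a h.ord_trace using 1
    simp only [D_smul]
    simp only [LaurentPolynomial.smul_eq_C_mul, map_mul]; ring

theorem IsLaxData.sum {V w P : ℝ[T;T⁻¹]} {ε : ℝ} {φ A Q ψ : ℕ → ℝ[T;T⁻¹]} {R S : ℕ → ℝ[X]}
    {κ z : ℕ → ℝ} {s : Finset ℕ} (h : ∀ j ∈ s, z j ≠ 0 →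
      IsLaxData n m lam V w P ε (φ j) (A j) (Q j) (R j) (S j) (ψ j) (κ j)) :
    IsLaxData n m lam V w P ε (∑ j ∈ s, z j • φ j) (∑ j ∈ s, z j • A j) (∑ j ∈ s, z j • Q j)
      (∑ j ∈ s, z j • R j) (∑ j ∈ s, z j • S j) (∑ j ∈ s, z j • ψ j) (∑ j ∈ s, z j * κ j) := by
  induction s using Finset.induction_on with
  | empty => simpa using IsLaxData.zero V w P ε
  | insert i s hi ih =>
    simp only [Finset.sum_insert hi]
    refine IsLaxData.add ?_ (ih fun j hj => h j (Finset.mem_insert_of_mem hj))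
    by_cases h0 : z i = 0
    · simpa [h0] using IsLaxData.zero V w P ε
    · exact (h i (Finset.mem_insert_self i s) h0).smul (z i)

theorem toLaurent_potPoly (d : ℕ → ℝ) (e : ℝ) :
    2 * (potPoly n m d e).toLaurent = (magPoly n d).toLaurent ^ 2 +
      C (2 * (e - d (n + 1))) * T (n + m : ℤ) := by
  have h1 : (2 : ℝ[T;T⁻¹]) * C (1 / 2) = 1 := by rw [two_eq_C, ← map_mul]; norm_num
  have h2 : (T (n + m : ℤ) : ℝ[T;T⁻¹]) = T ((n + m : ℕ) : ℤ) := by push_cast; rfl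
  rw [potPoly, map_add, map_mul, map_mul, map_pow, Polynomial.toLaurent_X_pow,
    Polynomial.toLaurent_C, Polynomial.toLaurent_C, h2, map_mul C, ← two_eq_C]
  linear_combination (magPoly n d).toLaurent ^ 2 * h1

end PainleveLax
end

noncomputable section

namespace PainleveLax

open LaurentPolynomial (T C)

variable {n m r : ℕ} {σ : ℝ} {lam mu : Fin n → ℝ}

/-! ### The data of the matrices `U_r` -/

theorem eq_zero_of_mem {b : ℝ[T;T⁻¹]} (hd : b ∈ degLE (-1)) (ho : b ∈ ordGE 0) : b = 0 := by
  ext k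
  rcases lt_or_ge k 0 with h | h
  · exact ho k h
  · exact hd k (by omega)

theorem toLaurent_u_sq_mem (lam : Fin n → ℝ) : (u lam).toLaurent ^ 2 ∈ degLE (2 * n) := by
  rw [pow_two]
  exact mul_mem_degLE (by omega) (toLaurent_u_mem lam) (toLaurent_u_mem lam)

theorem degLE_of_u_sq_mul {b : ℝ[T;T⁻¹]} {N : ℤ}
    (h : (u lam).toLaurent ^ 2 * b ∈ degLE (2 * n + N)) : b ∈ degLE N := by
  refine mem_degLE_of_mul (toLaurent_u_sq_mem lam) ?_ h
  rw [pow_two, coeff_mul_degLE (two_mul _).symm (toLaurent_u_mem lam) (toLaurent_u_mem lam),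
    coeff_toLaurent_u]
  norm_num

theorem ordGE_of_u_sq_mul (h0 : (u lam).coeff 0 ≠ 0) {b : ℝ[T;T⁻¹]}
    (h : (u lam).toLaurent ^ 2 * b ∈ ordGE 0) : b ∈ ordGE 0 := by
  have hu := toLaurent_mem_ordGE (u lam)
  have e0 : (u lam).toLaurent.coeff 0 = (u lam).coeff 0 := coeff_toLaurent_natCast (u lam) 0
  refine mem_ordGE_of_mul (M := 0) ?_ ?_ (by rwa [zero_add])
  · rw [pow_two]
    exact mul_mem_ordGE (zero_add 0).ge hu hu
  · rw [pow_two, coeff_mul_ordGE (zero_add 0) hu hu, e0]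
    exact mul_ne_zero h0 h0

theorem wronskian_mem_degLE {a b : ℝ[T;T⁻¹]} {M N K : ℤ} (hK : M + N - 1 ≤ K) (ha : a ∈ degLE M)
    (hb : b ∈ degLE N) : D a * b - a * D b ∈ degLE K :=
  sub_mem (mul_mem_degLE (by omega) (D_mem_degLE le_rfl ha) hb)
    (mul_mem_degLE (by omega) ha (D_mem_degLE le_rfl hb))

theorem wronskian_mem_ordGE {a b : ℝ[T;T⁻¹]} (ha : a ∈ ordGE 0) (hb : b ∈ ordGE 0) :
    D a * b - a * D b ∈ ordGE 0 :=
  sub_mem (mul_mem_ordGE (zero_add 0).ge (D_mem_ordGE_zero ha) hb)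
    (mul_mem_ordGE (zero_add 0).ge ha (D_mem_ordGE_zero hb))

/-- The bound r + m ≤ n + 1 is what is needed for σ = 0. It fails only for r = 1, m = n + 1, where φ
is a constant and its derivative vanishes. -/
theorem D_phi_mem_degLE (h : Sector n m r σ) (hm : m ≤ n + 1) :
    T m * D (phi σ (n + 1 - r) (u lam)) ∈ degLE (n - 1) := by
  have hb := h.bounds
  have h1 := phi_mem_degLE (k := n + 1 - r) σ (toLaurent_u_mem lam)
  rcases h with ⟨rfl, -, -, h3⟩ | ⟨rfl, h2, -, h3⟩
  · by_cases h4 : r + m ≤ n + 1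
    · exact mul_mem_degLE (by omega) (T_mem_degLE le_rfl) (D_mem_degLE le_rfl h1)
    · have h5 : D (phi 0 (n + 1 - r) (u lam)) = 0 :=
        eq_zero_of_mem (D_mem_degLE (by omega) h1) (D_mem_ordGE_zero (tau_zero_mem_ordGE _))
      rw [h5, mul_zero]
      exact zero_mem _
  · exact mul_mem_degLE (by omega) (T_mem_degLE le_rfl) (D_mem_degLE le_rfl (tau_one_mem_degLE _))

/-- For σ = 1 the pole of the derivative has order at most n + 2 - r, and r in I₂ means precisely
that xᵐ compensates it. -/
theorem T_mul_D_mem_ordGE (h : Sector n m r σ) {b : ℝ[T;T⁻¹]}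
    (hb : b ∈ ordGE (-(poleOrder n r σ : ℤ))) : T m * D b ∈ ordGE 0 := by
  rcases h with ⟨rfl, -⟩ | ⟨rfl, -, h2, h3⟩
  · rw [poleOrder, if_pos rfl, Nat.cast_zero, neg_zero] at hb
    exact mul_mem_ordGE (by omega : (0 : ℤ) ≤ m + 0) (T_mem_ordGE le_rfl) (D_mem_ordGE_zero hb)
  · rw [poleOrder, if_neg one_ne_zero] at hb
    exact mul_mem_ordGE (by omega) (T_mem_ordGE le_rfl) (D_mem_ordGE le_rfl hb)

/-- The cofactors have degree n - 1 instead of n, so no exceptional case arises here. -/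
theorem D_entryA_mem_degLE (h : Sector n m r σ) (hm : m ≤ n + 1) :
    T m * D (entryA m r σ lam mu) ∈ degLE (n - 1) := by
  have key : ∃ K : ℤ, (m : ℤ) + K ≤ n ∧ entryA m r σ lam mu ∈ degLE K := by
    rcases h with ⟨rfl, h1, h2, h3⟩ | ⟨rfl, h2, -, h3⟩
    · refine ⟨r - 2, by omega, Submodule.sum_mem _ fun i _ =>
        mul_mem_degLE (by omega) (C_mem_degLE _) (phi_mem_degLE 0
          (toLaurent_mem_degLE_of_degree (degree_uE_lt lam i)))⟩
    · exact ⟨-1, by omega, Submodule.sum_mem _ fun i _ =>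
        mul_mem_degLE (by omega) (C_mem_degLE _) (tau_one_mem_degLE _)⟩
  obtain ⟨K, h1, h2⟩ := key
  exact mul_mem_degLE (by omega) (T_mem_degLE le_rfl) (D_mem_degLE le_rfl h2)

theorem toLaurent_magPoly_mem (d : ℕ → ℝ) : (magPoly n d).toLaurent ∈ degLE (n + 1) :=
  toLaurent_mem_degLE_of_natDegree (by exact_mod_cast natDegree_magPoly_le d)

theorem sq_add_mem_degLE (hm : m ≤ n + 1) (d : ℕ → ℝ) (ε : ℝ) :
    (magPoly n d).toLaurent ^ 2 + C ε * T (n + m : ℤ) ∈ degLE (2 * n + 2) := by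
  refine add_mem ?_ (mul_mem_degLE (by omega) (C_mem_degLE _) (T_mem_degLE le_rfl))
  rw [pow_two]
  exact mul_mem_degLE (by omega) (toLaurent_magPoly_mem d) (toLaurent_magPoly_mem d)

theorem two_T_mul_mem_ordGE {b : ℝ[T;T⁻¹]} (hb : b ∈ ordGE 0) : 2 * T m * b ∈ ordGE m :=
  mul_mem_ordGE (by omega) (mul_mem_ordGE le_rfl two_mem_ordGE (T_mem_ordGE le_rfl)) hb

theorem two_T_mul_mem_degLE {b : ℝ[T;T⁻¹]} (hb : b ∈ degLE (n - 1)) :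
    2 * T m * b ∈ degLE (m + n - 1) :=
  mul_mem_degLE (by omega) (mul_mem_degLE le_rfl two_mem_degLE (T_mem_degLE le_rfl)) hb

theorem bracket_add_middle (U φ φ' M : ℝ[T;T⁻¹]) :
    bracket U (φ + φ') M = bracket U φ M + bracket U φ' M := by
  simp only [bracket, map_add]; ring

section

variable {U V w P A Q R S G φ δ ψ η : ℝ[T;T⁻¹]} {ε κ : ℝ} {k : ℤ}

/-- The trace for a polynomial `U` and the part `φ = s (T^{-k} U + δ)` of `T^{-k} U` -/
theorem trace_expansion (s : ℝ) (h1 : φ * V = 2 * A * U + R) (h2 : φ * w = 2 * Q * U + S)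
    (h3 : w * U = P ^ 2 + C (2 * ε) * T (n + m : ℤ) + G - V ^ 2)
    (hφ : φ = C s * (T (-k) * U) + δ) (hψ : ψ = C s * (T (-k) * P) + η) :
    U ^ 2 * (2 * D Q * U + D φ * w + 4 * V * D A - 2 * P * D ψ - C (2 * ε * κ) * T n) =
      bracket U δ (P ^ 2 + C (2 * ε) * T (n + m : ℤ)) + bracket U φ G -
        U * (D S * U - S * D U) - 2 * V * (D R * U - R * D U) - 2 * U ^ 2 * (P * D η) +
        U ^ 2 * (C (s * ((n + m - 2 * k) * (2 * ε))) * T (n + m - k - 1) -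
          C (2 * ε * κ) * T n) := by
  have e1 := trace_identity h1 h2 h3
  have e2 := bracket_main U P (2 * ε) k (n + m)
  have e3 : bracket U φ (P ^ 2 + C (2 * ε) * T (n + m : ℤ)) =
      C s * bracket U (T (-k) * U) (P ^ 2 + C (2 * ε) * T (n + m : ℤ)) +
        bracket U δ (P ^ 2 + C (2 * ε) * T (n + m : ℤ)) := by
    rw [hφ, bracket_add_middle]
    simp only [bracket, D_mul (C s), D_C]
    ring
  have e4 : D ψ = C s * D (T (-k) * P) + D η := by
    rw [hψ, map_add, D_mul (C s), D_C]
    ring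
  have e5 : bracket U φ (P ^ 2 + C (2 * ε) * T (n + m : ℤ) + G) =
      bracket U φ (P ^ 2 + C (2 * ε) * T (n + m : ℤ)) + bracket U φ G := bracket_add_right _ _ _ _
  push_cast at e2
  rw [map_mul C s]
  linear_combination e1 + e5 + e3 + C s * e2 - 2 * U ^ 2 * P * e4

end

theorem spectral_laurent (hlam : lam ∈ config n m) (d : ℕ → ℝ) (e : ℝ) :
    (wpoly m (potPoly n m d e) lam mu).toLaurent * (u lam).toLaurent =
      (magPoly n d).toLaurent ^ 2 + C (2 * (e - d (n + 1))) * T (n + m : ℤ) +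
        2 * T m * (hpoly m (potPoly n m d e) lam mu).toLaurent - (v m lam mu).toLaurent ^ 2 := by
  have h1 := congrArg Polynomial.toLaurent (wpoly_mul_u (mu := mu) (N := potPoly n m d e) hlam)
  have h2 := toLaurent_potPoly (n := n) (m := m) d e
  simp only [map_sub, map_add, map_mul, map_pow, Polynomial.toLaurent_C, Polynomial.toLaurent_X,
    LaurentPolynomial.T_pow, mul_one, ← two_eq_C] at h1
  linear_combination h1 + h2

/-- Behaviour at infinity. For σ = 0, φ is x^{-k}u minus its negative part, so `bracket_main`
supplies the potential term and the error has negative degree; for σ = 1, φ itself has negative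
degree. In both cases `bracket_mem_degLE_of_neg` gains the one degree missing from the naive
estimate. The factor u², monic of degree 2n, is cancelled at the end. -/
theorem trace_mem_degLE (h : Sector n m r σ) (hlam : lam ∈ config n m) (hm : m ≤ n + 1)
    (d : ℕ → ℝ) (e : ℝ) {A Q : ℝ[T;T⁻¹]} {R S : ℝ[X]} (hR : R.degree < n) (hS : S.degree < n)
    (h1 : phi σ (n + 1 - r) (u lam) * (v m lam mu).toLaurent =
      2 * A * (u lam).toLaurent + R.toLaurent)
    (h2 : phi σ (n + 1 - r) (u lam) * (wpoly m (potPoly n m d e) lam mu).toLaurent =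
      2 * Q * (u lam).toLaurent + S.toLaurent) :
    2 * D Q * (u lam).toLaurent +
      D (phi σ (n + 1 - r) (u lam)) * (wpoly m (potPoly n m d e) lam mu).toLaurent +
      4 * (v m lam mu).toLaurent * D A -
      2 * (magPoly n d).toLaurent * D (phi σ (n + 1 - r) (magPoly n d)) -
      C (2 * (e - d (n + 1)) * if m = n + 1 ∧ r = 1 then 1 else 0) * T n ∈ degLE (n - 1) := by
  have hb := h.bounds
  have hu := toLaurent_u_mem lam
  have hu2 := toLaurent_u_sq_mem lam
  have hP := toLaurent_magPoly_mem (n := n) d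
  have hv := toLaurent_mem_degLE_of_degree (degree_v_lt (mu := mu) hlam)
  have hR' := toLaurent_mem_degLE_of_degree hR
  have hS' := toLaurent_mem_degLE_of_degree hS
  have hG := two_T_mul_mem_degLE (m := m) (toLaurent_mem_degLE_of_degree
    (degree_hpoly_lt (mu := mu) (N := potPoly n m d e) hlam))
  have hM := sq_add_mem_degLE hm d (2 * (e - d (n + 1)))
  have hφ := phi_mem_degLE (k := n + 1 - r) σ hu
  have hw1 := mul_mem_degLE (by omega) hu (wronskian_mem_degLE le_rfl hS' hu) (K := 3 * n - 1)
  have hw2 := mul_mem_degLE (by omega) (mul_mem_degLE le_rfl two_mem_degLE hv)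
    (wronskian_mem_degLE le_rfl hR' hu) (K := 3 * n - 1)
  apply degLE_of_u_sq_mul (lam := lam)
  rw [show 2 * (n : ℤ) + (n - 1) = 3 * n - 1 by ring]
  have h2u2 : 2 * (u lam).toLaurent ^ 2 ∈ degLE (2 * n) :=
    mul_mem_degLE (by omega) two_mem_degLE hu2
  rcases h with ⟨rfl, h3, h4, h5⟩ | ⟨rfl, h3, h4, h5⟩
  · have hε := tau_zero_sub_mem_degLE (T (-((n + 1 - r : ℕ) : ℤ)) * (u lam).toLaurent)
    have hη := tau_zero_sub_mem_degLE (T (-((n + 1 - r : ℕ) : ℤ)) * (magPoly n d).toLaurent)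
    have e1 := trace_expansion (κ := if m = n + 1 ∧ r = 1 then 1 else 0) (k := (n + 1 - r : ℕ)) 1
      h1 h2 (spectral_laurent (mu := mu) hlam d e)
      (δ := -(T (-((n + 1 - r : ℕ) : ℤ)) * (u lam).toLaurent - phi 0 (n + 1 - r) (u lam)))
      (η := -(T (-((n + 1 - r : ℕ) : ℤ)) * (magPoly n d).toLaurent -
        phi 0 (n + 1 - r) (magPoly n d)))
      (ψ := phi 0 (n + 1 - r) (magPoly n d))
      (by rw [map_one]; ring) (by rw [map_one]; ring)
    rw [e1]
    refine add_mem (sub_mem (sub_mem (sub_mem (add_mem ?_ ?_) hw1) hw2) ?_) ?_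
    · exact bracket_mem_degLE_of_neg hu (neg_mem hε) hM
    · exact bracket_mem_degLE hu hφ hG (by omega)
    · exact mul_mem_degLE (by omega) h2u2
        (mul_mem_degLE (by omega : (n + 1 : ℤ) + -2 ≤ n - 1) hP
          (D_mem_degLE (by omega) (neg_mem hη)))
    -- The exponent n+m-k-1 equals m+r-2. It exceeds n-1 only for r = 1, m = n+1, where the
    -- coefficient is n+m-2k = 1 and the term is removed by the one with κ.
    · refine mul_mem_degLE (by omega : 2 * (n : ℤ) + (n - 1) ≤ _) hu2 ?_
      by_cases h6 : m = n + 1 ∧ r = 1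
      · obtain ⟨rfl, rfl⟩ := h6
        have h7 : (n : ℤ) + (n + 1 : ℕ) - (n + 1 - 1 : ℕ) - 1 = n := by
          rw [Nat.add_sub_cancel]; push_cast; ring
        rw [h7, ← sub_mul, ← map_sub, if_pos ⟨rfl, rfl⟩]
        have h8 : (1 : ℝ) * (((n : ℝ) + (n + 1 : ℕ) - 2 * ((n + 1 - 1 : ℕ) : ℤ)) *
            (2 * (e - d (n + 1)))) - 2 * (e - d (n + 1)) * 1 = 0 := by
          rw [Nat.add_sub_cancel]; push_cast; ring
        rw [h8, map_zero, zero_mul]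
        exact zero_mem _
      · rw [if_neg h6, mul_zero, map_zero, zero_mul, sub_zero]
        exact mul_mem_degLE (zero_add _).le (C_mem_degLE _) (T_mem_degLE (by omega))
  · have h6 : ¬ (m = n + 1 ∧ r = 1) := by omega
    -- Here s = 0: the truncation φ as a whole plays the role of the error δ.
    have e1 := trace_expansion (κ := 0) (k := 0) 0
      h1 h2 (spectral_laurent (mu := mu) hlam d e) (by rw [map_zero, zero_mul, zero_add])
      (ψ := phi 1 (n + 1 - r) (magPoly n d)) (by rw [map_zero, zero_mul, zero_add])
    rw [if_neg h6, e1]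
    refine add_mem (sub_mem (sub_mem (sub_mem (add_mem ?_ ?_) hw1) hw2) ?_) ?_
    · exact bracket_mem_degLE_of_neg hu (tau_one_mem_degLE _) hM
    · exact bracket_mem_degLE hu (tau_one_mem_degLE _) hG (by omega)
    · exact mul_mem_degLE (by omega) h2u2
        (mul_mem_degLE (by omega : (n + 1 : ℤ) + -2 ≤ n - 1) hP
          (D_mem_degLE (by omega) (tau_one_mem_degLE _)))
    · simp [zero_mem]

/-- Behaviour at 0. For σ = 0 every ingredient is a polynomial. For σ = 1, φ is -x^{-k}u plus a
polynomial error, so `bracket_main` accounts for the pole, while the h-term is regular because of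
its factor xᵐ. Cancelling u² uses u(0) ≠ 0. -/
theorem trace_mem_ordGE (h : Sector n m r σ) (hlam : lam ∈ config n m)
    (d : ℕ → ℝ) (e κ : ℝ) {A Q : ℝ[T;T⁻¹]} {R S : ℝ[X]}
    (hA : A ∈ ordGE (-(poleOrder n r σ : ℤ))) (hQ : Q ∈ ordGE (-(poleOrder n r σ : ℤ)))
    (h1 : phi σ (n + 1 - r) (u lam) * (v m lam mu).toLaurent =
      2 * A * (u lam).toLaurent + R.toLaurent)
    (h2 : phi σ (n + 1 - r) (u lam) * (wpoly m (potPoly n m d e) lam mu).toLaurent =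
      2 * Q * (u lam).toLaurent + S.toLaurent) :
    2 * D Q * (u lam).toLaurent +
      D (phi σ (n + 1 - r) (u lam)) * (wpoly m (potPoly n m d e) lam mu).toLaurent +
      4 * (v m lam mu).toLaurent * D A -
      2 * (magPoly n d).toLaurent * D (phi σ (n + 1 - r) (magPoly n d)) -
      C (2 * (e - d (n + 1)) * κ) * T n ∈ ordGE 0 := by
  have h0 : (0 : ℤ) ≤ 0 + 0 := (zero_add 0).ge
  have hT : C (2 * (e - d (n + 1)) * κ) * T n ∈ ordGE 0 :=
    mul_mem_ordGE h0 (C_mem_ordGE _) (T_mem_ordGE (by omega))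
  have hu := toLaurent_mem_ordGE (u lam)
  have hv := toLaurent_mem_ordGE (v m lam mu)
  have hP := toLaurent_mem_ordGE (magPoly n d)
  rcases h with ⟨rfl, -⟩ | ⟨rfl, h3, h4, h5⟩
  · rw [poleOrder, if_pos rfl, Nat.cast_zero, neg_zero] at hA hQ
    have h4 : (4 : ℝ[T;T⁻¹]) ∈ ordGE 0 := by
      rw [show (4 : ℝ[T;T⁻¹]) = 2 * 2 by norm_num]
      exact mul_mem_ordGE h0 two_mem_ordGE two_mem_ordGE
    refine sub_mem (sub_mem (add_mem (add_mem ?_ ?_) ?_) ?_) hT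
    · exact mul_mem_ordGE h0 (mul_mem_ordGE h0 two_mem_ordGE (D_mem_ordGE_zero hQ)) hu
    · exact mul_mem_ordGE h0 (D_mem_ordGE_zero (tau_zero_mem_ordGE _)) (toLaurent_mem_ordGE _)
    · exact mul_mem_ordGE h0 (mul_mem_ordGE h0 h4 hv) (D_mem_ordGE_zero hA)
    · exact mul_mem_ordGE h0 (mul_mem_ordGE h0 two_mem_ordGE hP)
        (D_mem_ordGE_zero (tau_zero_mem_ordGE _))
  · have hc := (Sector.coeff_zero_u (Or.inr ⟨rfl, h3, h4, h5⟩ : Sector n m r 1) hlam).resolve_left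
      (by rw [poleOrder, if_neg one_ne_zero]; omega)
    have hδ := tau_one_add_mem_ordGE (T (-((n + 1 - r : ℕ) : ℤ)) * (u lam).toLaurent)
    have hη := tau_one_add_mem_ordGE (T (-((n + 1 - r : ℕ) : ℤ)) * (magPoly n d).toLaurent)
    have hG := two_T_mul_mem_ordGE (m := m)
      (toLaurent_mem_ordGE (hpoly m (potPoly n m d e) lam mu))
    have hφ := Sector.phi_mem_ordGE (Or.inr ⟨rfl, h3, h4, h5⟩ : Sector n m r 1) (u lam)
    rw [poleOrder, if_neg one_ne_zero] at hφ
    -- Here s = -1: φ + x^{-k}u is the nonnegative part of x^{-k}u, and likewise for P.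
    have e1 := trace_expansion (κ := κ) (k := (n + 1 - r : ℕ)) (-1)
      h1 h2 (spectral_laurent (mu := mu) hlam d e)
      (δ := T (-((n + 1 - r : ℕ) : ℤ)) * (u lam).toLaurent + phi 1 (n + 1 - r) (u lam))
      (η := T (-((n + 1 - r : ℕ) : ℤ)) * (magPoly n d).toLaurent + phi 1 (n + 1 - r) (magPoly n d))
      (ψ := phi 1 (n + 1 - r) (magPoly n d))
      (by rw [map_neg, map_one]; ring) (by rw [map_neg, map_one]; ring)
    have hu2 : (u lam).toLaurent ^ 2 ∈ ordGE 0 := by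
      rw [pow_two]; exact mul_mem_ordGE h0 hu hu
    apply ordGE_of_u_sq_mul hc
    rw [e1]
    refine add_mem (sub_mem (sub_mem (sub_mem (add_mem ?_ ?_) ?_) ?_) ?_) ?_
    · refine bracket_mem_ordGE_zero hu hδ (add_mem ?_ ?_)
      · rw [pow_two]; exact mul_mem_ordGE h0 hP hP
      · exact mul_mem_ordGE h0 (C_mem_ordGE _) (T_mem_ordGE (by omega))
    · exact bracket_mem_ordGE hu hφ hG (by omega)
    · exact mul_mem_ordGE h0 hu (wronskian_mem_ordGE (toLaurent_mem_ordGE S) hu)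
    · exact mul_mem_ordGE h0 (mul_mem_ordGE h0 two_mem_ordGE hv)
        (wronskian_mem_ordGE (toLaurent_mem_ordGE R) hu)
    · exact mul_mem_ordGE h0 (mul_mem_ordGE h0 two_mem_ordGE hu2)
        (mul_mem_ordGE h0 hP (D_mem_ordGE_zero hη))
    · exact mul_mem_ordGE h0 hu2 (sub_mem
        (mul_mem_ordGE h0 (C_mem_ordGE _) (T_mem_ordGE (by omega))) hT)

/-- The matrix `U_r` is given by Lax data. -/
theorem exists_isLaxData (h : Sector n m r σ) (hlam : lam ∈ config n m) (hm : m ≤ n + 1)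
    (d : ℕ → ℝ) (e : ℝ) (mu : Fin n → ℝ) {c : ℤ → ℝ} (hc : PotRelation n m c (potPoly n m d e)) :
    ∃ (q : ℝ[T;T⁻¹]) (s : ℝ[X]), IsLaxData n m lam (v m lam mu).toLaurent
        (wpoly m (potPoly n m d e) lam mu).toLaurent (magPoly n d).toLaurent (e - d (n + 1))
        (phi σ (n + 1 - r) (u lam)) (entryA m r σ lam mu) q (remR m r lam mu) s
        (phi σ (n + 1 - r) (magPoly n d)) (if m = n + 1 ∧ r = 1 then 1 else 0) ∧
      U m c r lam mu = !![entryA m r σ lam mu, (1 / 2 : ℝ) • phi σ (n + 1 - r) (u lam);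
        q, -entryA m r σ lam mu] := by
  obtain ⟨q, s, hq, hs, h2, hU⟩ := exists_U_eq (mu := mu) h hlam hc
  have h1 := phi_mul_v (mu := mu) h.bounds.2 σ hlam
  have hR : (remR m r lam mu).degree < n := degree_sum_uE_lt lam _
  refine ⟨q, s, ⟨fun x hx => h.phi_mem_reg hx _ _, fun x hx => entryA_mem_reg h lam mu hx,
    fun x hx => ?_, hR, hs, h1, h2, D_phi_mem_degLE h hm, T_mul_D_mem_ordGE h (h.phi_mem_ordGE _),
    D_entryA_mem_degLE h hm, T_mul_D_mem_ordGE h (entryA_mem_ordGE h lam mu),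
    trace_mem_degLE h hlam hm d e hR hs h1 h2,
    trace_mem_ordGE h hlam d e _ (entryA_mem_ordGE h lam mu) hq h1 h2⟩, hU⟩
  rcases h with ⟨rfl, -⟩ | ⟨rfl, h3, h4, h5⟩
  · rw [poleOrder, if_pos rfl, Nat.cast_zero, neg_zero] at hq
    exact Or.inr hq
  · exact Or.inl fun h0 => hx (by rw [h0, zero_pow (by omega)])

end PainleveLax
end

/-! ### The Lax equation for Laurent polynomials, and the evolution of the potentials -/

noncomputable section

namespace PainleveLax

open LaurentPolynomial (T C)

variable {n m r : ℕ} {σ : ℝ} {lam mu : Fin n → ℝ}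

/-! ### The Lax equation as an identity of Laurent polynomials -/

section

variable {a b : Fin n → ℝ} {N N' u' v' h' w' : ℝ[X]} {P φ A Q ψ : ℝ[T;T⁻¹]} {R S : ℝ[X]} {ε κ : ℝ}

theorem evalAt_T_mul {b : ℝ[T;T⁻¹]} {x : ℝ} (hb : b ∈ reg x) :
    evalAt (T m * b) x = x ^ m * evalAt b x := by
  rw [evalAt_mul (Or.inr (T_mem_ordGE (by omega))) hb, evalAt_T, zpow_natCast]

theorem IsLaxData.evalAt_R
    (hL : IsLaxData n m lam (v m lam mu).toLaurent (wpoly m N lam mu).toLaurent P ε φ A Q R S ψ κ)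
    (hlam : lam ∈ config n m) (i : Fin n) :
    R.eval (lam i) = lam i ^ m * mu i * evalAt φ (lam i) := by
  have h1 := congrArg (fun b => evalAt b (lam i)) hL.mul_V
  have h2 := hL.reg_φ _ (hlam.2 i)
  have h3 := hL.reg_A _ (hlam.2 i)
  rw [evalAt_mul h2 (toLaurent_mem_reg _ _), evalAt_add,
    evalAt_mul (mul_mem (two_eq_C ▸ C_mem_reg 2 _) h3) (toLaurent_mem_reg _ _), evalAt_toLaurent, evalAt_toLaurent, evalAt_toLaurent, eval_u,
    eval_v hlam] at h1
  linarith

theorem IsLaxData.evalAt_S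
    (hL : IsLaxData n m lam (v m lam mu).toLaurent (wpoly m N lam mu).toLaurent P ε φ A Q R S ψ κ)
    (hlam : lam ∈ config n m) (i : Fin n) :
    S.eval (lam i) = (wpoly m N lam mu).eval (lam i) * evalAt φ (lam i) := by
  have h1 := congrArg (fun b => evalAt b (lam i)) hL.mul_w
  have h2 := hL.reg_φ _ (hlam.2 i)
  have h3 := hL.reg_Q _ (hlam.2 i)
  rw [evalAt_mul h2 (toLaurent_mem_reg _ _), evalAt_add,
    evalAt_mul (mul_mem (two_eq_C ▸ C_mem_reg 2 _) h3) (toLaurent_mem_reg _ _), evalAt_toLaurent, evalAt_toLaurent, evalAt_toLaurent, eval_u] at h1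
  linarith

/-- Both sides have exponents in [0, n), so the values at the n nodes decide. At λᵢ the claim is
Hamilton's equation for λᵢ, multiplied by -Δᵢ. -/
theorem IsLaxData.deriv_u
    (hL : IsLaxData n m lam (v m lam mu).toLaurent (wpoly m N lam mu).toLaurent P ε φ A Q R S ψ κ)
    (hlam : lam ∈ config n m) (hD : CurveDeriv m lam mu a b N N' u' v' h' w')
    (ha : ∀ i, a i = (lam i ^ m * mu i * evalAt φ (lam i) -
      lam i ^ m * evalAt (D φ) (lam i)) / Delta lam i) :
    u'.toLaurent = T m * D φ - R.toLaurent := by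
  rw [← sub_eq_zero]
  refine eq_zero_of_evalAt hlam.1 ?_ ?_ fun i => ?_
  · exact sub_mem (toLaurent_mem_degLE_of_degree hD.degree_u)
      (sub_mem hL.deg_φ (toLaurent_mem_degLE_of_degree hL.degree_R))
  · exact sub_mem (toLaurent_mem_ordGE _) (sub_mem hL.ord_φ (toLaurent_mem_ordGE _))
  · have h1 := Delta_ne_zero hlam.1 i
    rw [evalAt_sub, evalAt_sub, evalAt_toLaurent, evalAt_toLaurent,
      evalAt_T_mul (D_mem_reg (hL.reg_φ _ (hlam.2 i))), hD.eval_u, hL.evalAt_R hlam, ha]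
    field_simp
    ring

/-- The same comparison at the nodes. In v̇(λᵢ) the terms with the x-derivative of v cancel between
the motion of λᵢ and that of μᵢ, leaving w(λᵢ)φ(λᵢ)/2 and the A' term that comes from W_r. -/
theorem IsLaxData.deriv_v
    (hL : IsLaxData n m lam (v m lam mu).toLaurent (wpoly m N lam mu).toLaurent P ε φ A Q R S ψ κ)
    (hlam : lam ∈ config n m) (hD : CurveDeriv m lam mu a b N N' u' v' h' w')
    (ha : ∀ i, a i = (lam i ^ m * mu i * evalAt φ (lam i) -
      lam i ^ m * evalAt (D φ) (lam i)) / Delta lam i)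
    (hb : ∀ i, b i = -((lam i ^ m * mu i * (m * lam i ^ (m - 1) * mu i -
        (Polynomial.derivative (v m lam mu)).eval (lam i)) -
        1 / 2 * Delta lam i * (wpoly m N lam mu).eval (lam i)) / lam i ^ m *
        evalAt φ (lam i) / Delta lam i +
        (((Polynomial.derivative (v m lam mu)).eval (lam i) - m * lam i ^ (m - 1) * mu i) *
        evalAt (D φ) (lam i) / Delta lam i - 2 * evalAt (D A) (lam i)))) :
    v'.toLaurent = C (1 / 2) * S.toLaurent + 2 * (T m * D A) := by
  rw [← sub_eq_zero]
  refine eq_zero_of_evalAt hlam.1 ?_ ?_ fun i => ?_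
  · exact sub_mem (toLaurent_mem_degLE_of_degree hD.degree_v) (add_mem
      (mul_mem_degLE (zero_add _).le (C_mem_degLE _) (toLaurent_mem_degLE_of_degree hL.degree_S))
      (mul_mem_degLE (zero_add _).le two_mem_degLE hL.deg_A))
  · exact sub_mem (toLaurent_mem_ordGE _) (add_mem
      (mul_mem_ordGE (zero_add _).ge (C_mem_ordGE _) (toLaurent_mem_ordGE _))
      (mul_mem_ordGE (zero_add _).ge two_mem_ordGE hL.ord_A))
  · have h1 := Delta_ne_zero hlam.1 i
    have h2 := hlam.2 i
    have h3 := D_mem_reg (hL.reg_A _ h2)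
    rw [two_eq_C, evalAt_sub, evalAt_add, ← LaurentPolynomial.smul_eq_C_mul,
      ← LaurentPolynomial.smul_eq_C_mul, evalAt_smul, evalAt_smul, evalAt_toLaurent,
      evalAt_toLaurent, evalAt_T_mul h3, hD.eval_v, hL.evalAt_S hlam, ha, hb]
    generalize lam i ^ m = X at h2
    field_simp
    ring

/-- Comparison at the nodes is impossible for ẇ itself, whose degree is too large. The
differentiated spectral curve moves the question to Z, which lies in the range where nodes suffice.
-/
theorem IsLaxData.deriv_w
    (hL : IsLaxData n m lam (v m lam mu).toLaurent (wpoly m N lam mu).toLaurent P ε φ A Q R S ψ κ)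
    (hlam : lam ∈ config n m) (hD : CurveDeriv m lam mu a b N N' u' v' h' w')
    (hu : u'.toLaurent = T m * D φ - R.toLaurent)
    (hv : v'.toLaurent = C (1 / 2) * S.toLaurent + 2 * (T m * D A))
    (hN' : N'.toLaurent = P * (T m * D ψ) + C (ε * κ) * T (n + m : ℤ)) :
    w'.toLaurent = 2 * Q * (v m lam mu).toLaurent - 2 * A * (wpoly m N lam mu).toLaurent +
      2 * (T m * D Q) := by
  set V := (v m lam mu).toLaurent
  set w := (wpoly m N lam mu).toLaurent
  set Y := w'.toLaurent - (2 * Q * V - 2 * A * w + 2 * (T m * D Q)) with hY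
  set Z := 2 * h'.toLaurent - (2 * D Q * (u lam).toLaurent + D φ * w + 4 * V * D A -
    2 * P * D ψ - C (2 * ε * κ) * T n) with hZ
  have hsp := congrArg Polynomial.toLaurent hD.spectral
  simp only [map_add, map_mul, map_pow, Polynomial.toLaurent_X, map_ofNat,
    LaurentPolynomial.T_pow, mul_one] at hsp
  -- The differentiated spectral curve, with u̇, v̇ and Ṅ inserted and R, S eliminated by the
  -- division relations.
  have e1 : (u lam).toLaurent * Y = T m * Z := by
    have hT : (T (n + m : ℤ) : ℝ[T;T⁻¹]) = T n * T m := LaurentPolynomial.T_add _ _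
    have hC : 2 * C (1 / 2 : ℝ) = 1 := by rw [two_eq_C, ← map_mul]; norm_num
    have hC' : C (2 * ε * κ) = 2 * C (ε * κ) := by rw [mul_assoc, map_mul C, two_eq_C]
    rw [hY, hZ, hC']
    rw [hT] at hN'
    linear_combination hsp - w * hu - 2 * V * hv + 2 * hN' - V * S.toLaurent * hC +
      V * hL.mul_w - w * hL.mul_V
  have e2 : Z = 0 := by
    refine eq_zero_of_evalAt hlam.1 ?_ ?_ fun i => ?_
    · exact sub_mem (mul_mem_degLE (zero_add _).le two_mem_degLE
        (toLaurent_mem_degLE_of_degree hD.degree_h)) hL.deg_trace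
    · have hZo : Z ∈ ordGE 0 := sub_mem (mul_mem_ordGE (zero_add _).ge two_mem_ordGE
        (toLaurent_mem_ordGE _)) hL.ord_trace
      exact hZo
    · have hZo : Z ∈ ordGE 0 := sub_mem (mul_mem_ordGE (zero_add _).ge two_mem_ordGE
        (toLaurent_mem_ordGE _)) hL.ord_trace
      have h2 : ∀ x : ℝ, (2 : ℝ[T;T⁻¹]) ∈ reg x := fun x => two_eq_C ▸ C_mem_reg 2 x
      have hx := hlam.2 i
      have hYr : Y ∈ reg (lam i) := sub_mem (toLaurent_mem_reg _ _) (add_mem (sub_mem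
        (mul_mem (mul_mem (h2 _) (hL.reg_Q _ hx)) (toLaurent_mem_reg _ _))
        (mul_mem (mul_mem (h2 _) (hL.reg_A _ hx)) (toLaurent_mem_reg _ _)))
        (mul_mem (h2 _) (mul_mem (Or.inr (T_mem_ordGE (by omega))) (D_mem_reg (hL.reg_Q _ hx)))))
      -- As Y is regular at λᵢ and u(λᵢ) = 0, the product λᵢᵐZ(λᵢ) vanishes, and λᵢᵐ ≠ 0.
      have h3 := congrArg (fun b => evalAt b (lam i)) e1
      rw [evalAt_mul (toLaurent_mem_reg _ _) hYr, evalAt_T_mul (Or.inr hZo), evalAt_toLaurent,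
        eval_u, zero_mul] at h3
      exact (mul_eq_zero.1 h3.symm).resolve_left hx
  rw [e2, mul_zero] at e1
  exact sub_eq_zero.1 ((mul_eq_zero.1 e1).resolve_left (toLaurent_u_ne_zero lam))

end

/-! ### The dependence of the potentials on the times -/

section

variable {ζ : ℕ → ℕ → (Fin n → ℝ) → ℝ} {d : ℕ → (Fin n → ℝ) → ℝ} {e : (Fin n → ℝ) → ℝ}

theorem coeff_toLaurent_magPoly (d : ℕ → ℝ) (k : ℕ) :
    (magPoly n d).toLaurent.coeff (k : ℤ) = if k < n + 2 then d k else 0 := by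
  rw [coeff_toLaurent_natCast, coeff_magPoly]

theorem coeff_T_mul_D_phiBar (σ : ℝ) (z : ℕ → ℝ) (p : ℝ[X]) (g : ℤ) :
    (T m * D (phiBar n σ z p)).coeff g = ((g : ℝ) - m + 1) * ∑ j ∈ Finset.Icc 1 n,
      z j * (((if 0 ≤ g - m + 1 then 1 else 0) - σ) *
        p.toLaurent.coeff (g - m + 1 + (n + 1 - j : ℕ))) := by
  rw [coeff_T_mul, coeff_D, phiBar, AddMonoidAlgebra.coeff_sum, Finset.sum_apply']
  simp only [AddMonoidAlgebra.coeff_smul_apply, coeff_phi, smul_eq_mul]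
  push_cast
  rfl

/-- The right side is the coefficient of x^γ in xᵐ times the derivative of the truncated, deformed
P. The factor γ - m + 1 comes from differentiating, the restrictions on γ from the truncation and
from the range of exponents of P. -/
theorem IsMagneticData.deriv_d_eq_zero_case (hdata : IsMagneticData n m ζ d e)
    (h : Sector n m r 0) (t : Fin n → ℝ) {γ : ℕ} (hγ : γ ≤ n + 1) :
    timeDeriv r (d γ) t = ((γ : ℝ) - m + 1) * ∑ j ∈ Finset.Icc 1 n,
      defCoef n m (fun a b => ζ a b t) r j * (((if (0 : ℤ) ≤ γ - m + 1 then 1 else 0) - 0) *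
        (magPoly n fun γ => d γ t).toLaurent.coeff ((γ : ℤ) - m + 1 + (n + 1 - j : ℕ))) := by
  have hb := h.bounds
  have hr := (Sector.iff_zero hb.1 hb.2).2 h
  have hrm : r = 1 ∨ r + m ≤ n + 1 := hr.imp_right fun h => h.2.2
  -- If j < γ + 1 - m, the index exceeds n + 1 and P has no such coefficient; this produces the
  -- lower limit of the sum.
  have hterm : ∀ j, 1 ≤ j → j ≤ n → m ≤ γ →
      (magPoly n fun γ => d γ t).toLaurent.coeff ((γ : ℤ) - m + 1 + (n + 1 - j : ℕ)) =
        if γ + 1 - m ≤ j then d (n + 2 + γ - m - j) t else 0 := by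
    intro j h1 h2 h3
    rw [show ((γ : ℤ) - m + 1 + (n + 1 - j : ℕ)) = ((n + 2 + γ - m - j : ℕ) : ℤ) by omega,
      coeff_toLaurent_magPoly]
    by_cases h4 : γ + 1 - m ≤ j
    · rw [if_pos h4, if_pos (by omega)]
    · rw [if_neg h4, if_neg (by omega)]
  by_cases hcase : m ≤ γ ∧ γ ≤ m + r - 1
  · rw [if_pos (by omega)]
    by_cases hk : r ≤ kappa1 n m
    · rw [hdata.deriv_d₁ r hr hk γ hcase.1 hcase.2, Finset.sum_eq_single r]
      · rw [hterm r hb.1 hb.2 hcase.1, defCoef, if_pos hr, if_pos hk, if_pos rfl, if_pos (by omega)]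
        ring
      · intro j _ hj
        rw [defCoef, if_pos hr, if_pos hk, if_neg hj, zero_mul]
      · intro h0
        exact absurd (Finset.mem_Icc.2 hb) h0
    · rw [hdata.deriv_d₂ r hr (not_le.1 hk) γ hcase.1 hcase.2]
      congr 1
      have hsub : Finset.Icc (γ + 1 - m) r ⊆ Finset.Icc 1 n :=
        Finset.Icc_subset_Icc (by omega) hb.2
      rw [← Finset.sum_subset hsub]
      · refine Finset.sum_congr rfl fun j hj => ?_
        rw [Finset.mem_Icc] at hj
        rw [hterm j (by omega) (by omega) hcase.1, defCoef, if_pos hr, if_neg hk, if_pos hj.2,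
          if_pos hj.1]
        ring
      · intro j hj hj'
        rw [Finset.mem_Icc] at hj hj'
        rw [defCoef, if_pos hr, if_neg hk]
        split_ifs with h1
        · rw [hterm j hj.1 hj.2 hcase.1, if_neg (by omega), mul_zero, mul_zero]
        · rw [zero_mul]
  · rw [hdata.deriv_d_zero₁ r hr γ hγ hcase]
    -- For γ = m - 1 the relevant exponent is 0: the coefficient survives the truncation, but
    -- differentiation kills it.
    by_cases h1 : γ + 1 = m
    · rw [← h1]; push_cast; ring
    · rw [eq_comm, Finset.sum_eq_zero, mul_zero]
      intro j hj
      rw [Finset.mem_Icc] at hj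
      by_cases h2 : m ≤ γ
      · rw [hterm j hj.1 hj.2 h2, defCoef, if_pos hr]
        split_ifs <;> first | omega | ring
      · rw [if_neg (by omega)]; ring

/-- Now only negative exponents survive, that is γ ≤ m - 2, and the minus sign in the system for I₂
is that of `tau 1`. -/
theorem IsMagneticData.deriv_d_eq_one_case (hdata : IsMagneticData n m ζ d e) (hm : m ≤ n + 1)
    (h : Sector n m r 1) (t : Fin n → ℝ) {γ : ℕ} (hγ : γ ≤ n + 1) :
    timeDeriv r (d γ) t = ((γ : ℝ) - m + 1) * ∑ j ∈ Finset.Icc 1 n,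
      defCoef n m (fun a b => ζ a b t) r j * (((if (0 : ℤ) ≤ γ - m + 1 then 1 else 0) - 1) *
        (magPoly n fun γ => d γ t).toLaurent.coeff ((γ : ℤ) - m + 1 + (n + 1 - j : ℕ))) := by
  have hb := h.bounds
  have hr : I2 n m r := by
    rcases h with ⟨h, -⟩ | ⟨-, h⟩
    · exact absurd h one_ne_zero
    · exact h
  have hr' : ¬(r = 1 ∨ I1 n m r) := by
    obtain ⟨h1, h2, h3⟩ := hr
    unfold I1
    omega
  have hterm : ∀ j, 1 ≤ j → j ≤ n → γ + 2 ≤ m →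
      (magPoly n fun γ => d γ t).toLaurent.coeff ((γ : ℤ) - m + 1 + (n + 1 - j : ℕ)) =
        if j + m ≤ n + 2 + γ then d (n + 2 + γ - m - j) t else 0 := by
    intro j h1 h2 h3
    by_cases h4 : j + m ≤ n + 2 + γ
    · rw [show ((γ : ℤ) - m + 1 + (n + 1 - j : ℕ)) = ((n + 2 + γ - m - j : ℕ) : ℤ) by omega,
        coeff_toLaurent_magPoly, if_pos h4, if_pos (by omega)]
    · rw [if_neg h4]
      exact toLaurent_mem_ordGE _ _ (by omega)
  by_cases hcase : r + m ≤ n + 2 + γ ∧ γ + 2 ≤ m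
  · rw [if_neg (by omega)]
    by_cases hk : r ≤ n - kappa2 m
    · rw [hdata.deriv_d₃ r hr hk γ hcase.1 hcase.2, neg_mul, ← mul_neg, ← Finset.sum_neg_distrib]
      congr 1
      have hsub : Finset.Icc r (n + 2 + γ - m) ⊆ Finset.Icc 1 n :=
        Finset.Icc_subset_Icc hb.1 (by omega)
      rw [← Finset.sum_subset hsub]
      · refine Finset.sum_bij' (fun j _ => r + j) (fun j _ => j - r) ?_ ?_ ?_ ?_ ?_
        · intro j hj; simp only [Finset.mem_range, Finset.mem_Icc] at hj ⊢; omega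
        · intro j hj; simp only [Finset.mem_range, Finset.mem_Icc] at hj ⊢; omega
        · intro j hj; omega
        · intro j hj; simp only [Finset.mem_Icc] at hj; omega
        · intro j hj
          rw [Finset.mem_range] at hj
          rw [hterm (r + j) (by omega) (by omega) hcase.2, defCoef, if_neg hr', if_pos hk,
            if_pos (by omega), if_pos (by omega), ← Nat.sub_sub]
          ring
      · intro j hj hj'
        rw [Finset.mem_Icc] at hj hj'
        rw [defCoef, if_neg hr', if_pos hk]
        split_ifs with h1
        · rw [hterm j hj.1 hj.2 hcase.2, if_neg (by omega), mul_zero, mul_zero]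
        · rw [zero_mul]
    · rw [hdata.deriv_d₄ r hr (not_le.1 hk) γ hcase.1 hcase.2, Finset.sum_eq_single r]
      · rw [hterm r hb.1 hb.2 hcase.2, defCoef, if_neg hr', if_neg hk, if_pos rfl, if_pos hcase.1]
        ring
      · intro j _ hj
        rw [defCoef, if_neg hr', if_neg hk, if_neg hj, zero_mul]
      · intro h0
        exact absurd (Finset.mem_Icc.2 hb) h0
  · rw [hdata.deriv_d_zero₂ r hr γ hγ hcase, eq_comm, Finset.sum_eq_zero, mul_zero]
    intro j hj
    rw [Finset.mem_Icc] at hj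
    by_cases h2 : γ + 2 ≤ m
    · rw [hterm j hj.1 hj.2 h2, defCoef, if_neg hr']
      split_ifs <;> first | omega | ring
    · rw [if_pos (by omega)]; ring

theorem Sector.eq_zero_or_one (h : Sector n m r σ) : σ = 0 ∨ σ = 1 :=
  h.imp And.left And.left

theorem IsMagneticData.deriv_d (hdata : IsMagneticData n m ζ d e) (hm : m ≤ n + 1)
    (h : Sector n m r σ) (t : Fin n → ℝ) {γ : ℕ} (hγ : γ ≤ n + 1) :
    timeDeriv r (d γ) t = (T m * D (phiBar n σ (defCoef n m (fun a b => ζ a b t) r)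
      (magPoly n fun γ => d γ t))).coeff (γ : ℤ) := by
  rw [coeff_T_mul_D_phiBar]
  push_cast
  rcases h.eq_zero_or_one with rfl | rfl
  · exact hdata.deriv_d_eq_zero_case h t hγ
  · exact hdata.deriv_d_eq_one_case hm h t hγ

theorem T_mul_D_phiBar_mem_degLE {z : ℕ → ℝ} (hz : ∀ j ∈ Finset.Icc 1 n, z j ≠ 0 → Sector n m j σ)
    (hm : m ≤ n + 1) (d : ℕ → ℝ) :
    T m * D (phiBar n σ z (magPoly n d)) ∈ degLE (n + 1) := by
  rw [phiBar, map_sum, Finset.mul_sum]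
  refine Submodule.sum_mem _ fun j hj => ?_
  rw [D_smul, mul_smul_comm]
  by_cases h0 : z j = 0
  · rw [h0, zero_smul]; exact zero_mem _
  · refine Submodule.smul_mem _ _ ?_
    have h1 := phi_mem_degLE (k := n + 1 - j) σ (toLaurent_magPoly_mem (n := n) d)
    rcases hz j hj h0 with ⟨rfl, h3, h4, h5⟩ | ⟨rfl, h3, h4, h5⟩
    · exact mul_mem_degLE (by omega) (T_mem_degLE le_rfl) (D_mem_degLE le_rfl h1)
    · exact mul_mem_degLE (by omega) (T_mem_degLE le_rfl) (D_mem_degLE le_rfl (tau_one_mem_degLE _))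

theorem T_mul_D_phiBar_mem_ordGE {z : ℕ → ℝ} (hz : ∀ j ∈ Finset.Icc 1 n, z j ≠ 0 → Sector n m j σ)
    (p : ℝ[X]) : T m * D (phiBar n σ z p) ∈ ordGE 0 := by
  rw [phiBar, map_sum, Finset.mul_sum]
  refine Submodule.sum_mem _ fun j hj => ?_
  rw [D_smul, mul_smul_comm]
  by_cases h0 : z j = 0
  · rw [h0, zero_smul]; exact zero_mem _
  · exact Submodule.smul_mem _ _ (T_mul_D_mem_ordGE (hz j hj h0) ((hz j hj h0).phi_mem_ordGE _))

theorem sector_of_mem (h : Sector n m r σ) (ζ : ℕ → ℕ → ℝ) :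
    ∀ j ∈ Finset.Icc 1 n, defCoef n m ζ r j ≠ 0 → Sector n m j σ := fun j hj h0 => by
  rw [Finset.mem_Icc] at hj
  exact h.of_defCoef hj.1 hj.2 h0

/-- The evolution of the magnetic potentials -/
theorem IsMagneticData.toLaurent_deriv (hdata : IsMagneticData n m ζ d e) (hm : m ≤ n + 1)
    (h : Sector n m r σ) (t : Fin n → ℝ) :
    (magPoly n fun γ => timeDeriv r (d γ) t).toLaurent =
      T m * D (phiBar n σ (defCoef n m (fun a b => ζ a b t) r) (magPoly n fun γ => d γ t)) := by
  have hz := sector_of_mem h fun a b => ζ a b t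
  ext k
  rcases lt_or_ge k 0 with h0 | h0
  · rw [toLaurent_mem_ordGE _ k h0, T_mul_D_phiBar_mem_ordGE hz _ k h0]
  · lift k to ℕ using h0
    rw [coeff_toLaurent_magPoly]
    split_ifs with h1
    · exact hdata.deriv_d hm h t (by omega)
    · rw [T_mul_D_phiBar_mem_degLE hz hm _ _ (by omega)]

/-- In the exceptional case m = n + 1, r = 1 both e and d_{n+1} reproduce themselves under the
derivative; otherwise both are independent of t_r. -/
theorem IsMagneticData.deriv_e_sub (hdata : IsMagneticData n m ζ d e) (hm : m ≤ n + 1)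
    (h : Sector n m r σ) (t : Fin n → ℝ) :
    timeDeriv r e t - timeDeriv r (d (n + 1)) t =
      (e t - d (n + 1) t) * if m = n + 1 ∧ r = 1 then 1 else 0 := by
  have hb := h.bounds
  rw [hdata.deriv_e r hb.1 hb.2]
  by_cases h1 : m = n + 1 ∧ r = 1
  · obtain ⟨rfl, rfl⟩ := h1
    rw [if_pos ⟨rfl, rfl⟩, if_pos ⟨rfl, rfl⟩, hdata.deriv_d₁ 1 (Or.inl rfl)
      (by unfold kappa1; omega) (n + 1) le_rfl (by omega)]
    rw [show n + 2 + (n + 1) - (n + 1) - 1 = n + 1 by omega]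
    ring
  · rw [if_neg h1, if_neg h1, mul_zero, zero_sub, neg_eq_zero]
    rcases h with ⟨rfl, h2, h3, h4⟩ | ⟨rfl, h2, h3, h4⟩
    · exact hdata.deriv_d_zero₁ r ((Sector.iff_zero h2 h3).2 (Or.inl ⟨rfl, h2, h3, h4⟩)) _ le_rfl
        (by omega) t
    · exact hdata.deriv_d_zero₂ r ⟨h2, h3, h4⟩ _ le_rfl (by omega) t

end

end PainleveLax
end

/-! ### Assembling the isomonodromic Lax representation -/

noncomputable section

namespace PainleveLax

open LaurentPolynomial (T C)
open Filter Topology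

variable {n m r : ℕ} {σ : ℝ} {lam mu t : Fin n → ℝ}

/-! ### The evolutionary derivative as the derivative along a curve -/

/-- The direction of the time `t_r` -/
def timeDir (n r : ℕ) : Fin n → ℝ := fun i => if i.val + 1 = r then 1 else 0

/-- By the chain rule the bracket with H is the derivative in the direction of its Hamiltonian
vector field. A straight line suffices in place of an integral curve, since only first derivatives
at one point enter. -/
theorem evolDeriv_eq {H F : (Fin n → ℝ) → (Fin n → ℝ) → (Fin n → ℝ) → ℝ}
    (hF : DifferentiableAt ℝ (fun p : (Fin n → ℝ) × (Fin n → ℝ) × (Fin n → ℝ) =>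
      F p.1 p.2.1 p.2.2) (lam, mu, t)) {a b : Fin n → ℝ} {X : ℝ}
    (ha : ∀ i, lineDeriv ℝ (fun p => H lam p t) mu (Pi.single i 1) = a i)
    (hb : ∀ i, lineDeriv ℝ (fun l => H l mu t) lam (Pi.single i 1) = -b i)
    (hX : HasDerivAt (fun s : ℝ => F (lam + s • a) (mu + s • b) (t + s • timeDir n r)) X 0) :
    evolDeriv r H F lam mu t = X := by
  have hd := hF.hasFDerivAt
  set F' := fderiv ℝ (fun p : (Fin n → ℝ) × (Fin n → ℝ) × (Fin n → ℝ) =>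
      F p.1 p.2.1 p.2.2) (lam, mu, t)
  have h1 : ∀ y, lineDeriv ℝ (fun l => F l mu t) lam y = F' (y, 0, 0) := fun y => by
    have := hd.hasLineDerivAt (y, 0, 0)
    simp only [HasLineDerivAt, Prod.smul_mk, Prod.mk_add_mk, smul_zero, add_zero] at this
    exact HasLineDerivAt.lineDeriv this
  have h2 : ∀ y, lineDeriv ℝ (fun p => F lam p t) mu y = F' (0, y, 0) := fun y => by
    have := hd.hasLineDerivAt (0, y, 0)
    simp only [HasLineDerivAt, Prod.smul_mk, Prod.mk_add_mk, smul_zero, add_zero] at this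
    exact HasLineDerivAt.lineDeriv this
  have h3 : ∀ y, lineDeriv ℝ (F lam mu) t y = F' (0, 0, y) := fun y => by
    have := hd.hasLineDerivAt (0, 0, y)
    simp only [HasLineDerivAt, Prod.smul_mk, Prod.mk_add_mk, smul_zero, add_zero] at this
    exact HasLineDerivAt.lineDeriv this
  have h4 : X = F' (a, b, timeDir n r) := by
    have := hd.hasLineDerivAt (a, b, timeDir n r)
    simp only [HasLineDerivAt, Prod.smul_mk, Prod.mk_add_mk] at this
    exact hX.unique this
  have h5 : (a, b, timeDir n r) = (∑ i, a i • ((Pi.single i 1, 0, 0) :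
      (Fin n → ℝ) × (Fin n → ℝ) × (Fin n → ℝ))) + (∑ i, b i • ((0, Pi.single i 1, 0) :
      (Fin n → ℝ) × (Fin n → ℝ) × (Fin n → ℝ))) + (0, 0, timeDir n r) := by
    have hs : ∀ a : Fin n → ℝ, ∑ i, a i • (Pi.single i (1 : ℝ) : Fin n → ℝ) = a := fun a => by
      ext j
      simp [Finset.sum_apply, Pi.single_apply]
    refine Prod.ext ?_ (Prod.ext ?_ ?_)
    · simp [Prod.fst_sum, hs]
    · simp [Prod.fst_sum, Prod.snd_sum, hs]
    · simp [Prod.snd_sum]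
  rw [h4, h5, map_add, map_add, map_sum, map_sum, evolDeriv, timeDeriv, poisson, h3,
    Finset.sum_sub_distrib, sub_eq_add_neg, ← Finset.sum_neg_distrib, add_comm]
  simp only [h1, h2, ha, hb, map_smul, smul_eq_mul]
  congr 2
  · exact Finset.sum_congr rfl fun i _ => mul_comm _ _
  · exact Finset.sum_congr rfl fun i _ => by ring

/-! ### Differentiability -/

theorem differentiableAt_W {E : Type*} [NormedAddCommGroup E] [NormedSpace ℝ E]
    {lam mu : E → Fin n → ℝ} {z : E} (hl : DifferentiableAt ℝ lam z) (h : lam z ∈ config n m)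
    (hmu : DifferentiableAt ℝ mu z) (r : ℕ) :
    DifferentiableAt ℝ (fun z => W m r (lam z) (mu z)) z := by
  have hrho : ∀ k, DifferentiableAt ℝ (fun z => rho (lam z) k) z := fun k => coeffDiffAt_u hl _
  have hD := fun i => differentiableAt_Delta hl i
  unfold W
  split_ifs with h1 h2
  · refine (DifferentiableAt.fun_sum fun i _ => ?_).fun_neg
    refine DifferentiableAt.fun_mul (DifferentiableAt.fun_sum fun k _ => ?_)
      (differentiableAt_pi.1 hmu i)
    exact ((hrho _).const_mul _).fun_mul (differentiableAt_div
      ((differentiableAt_pi.1 hl i).fun_pow _) (hD i) (Delta_ne_zero h.1 i))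
  · refine (DifferentiableAt.fun_sum fun i _ => ?_).fun_neg
    refine DifferentiableAt.fun_mul (DifferentiableAt.fun_sum fun k _ => ?_)
      (differentiableAt_pi.1 hmu i)
    have h0 : lam z i ≠ 0 := fun h0 => h.2 i (by
      obtain ⟨h3, h4, h5⟩ := h2
      rw [h0, zero_pow (by omega)])
    exact ((hrho _).const_mul _).fun_mul (differentiableAt_div
      (DifferentiableAt.fun_comp' z (g := fun x : ℝ => x ^ ((m : ℤ) - k - 1))
        (differentiableAt_zpow.2 (Or.inl h0)) (differentiableAt_pi.1 hl i))
      (hD i) (Delta_ne_zero h.1 i))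
  · exact differentiableAt_const _

theorem differentiableAt_hA {E : Type*} [NormedAddCommGroup E] [NormedSpace ℝ E]
    {lam mu : E → Fin n → ℝ} {z : E} {N : ℝ[X]} (hl : DifferentiableAt ℝ lam z)
    (h : lam z ∈ config n m) (hmu : DifferentiableAt ℝ mu z) {c : ℤ → ℝ}
    (hc : PotRelation n m c N) (r : ℕ) :
    DifferentiableAt ℝ (fun z => hA m c r (lam z) (mu z)) z := by
  refine ((coeffDiffAt_hpoly hl h hmu (coeffDiffAt_const N) (fun _ => le_rfl) (n - r)).fun_add
    (differentiableAt_W hl h hmu r)).congr_of_eventuallyEq ?_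
  filter_upwards [eventually_mem_config_comp hl h] with z hz
  exact hA_eq hc hz r

theorem HA_eq_sum (ζ : ℕ → ℕ → (Fin n → ℝ) → ℝ) (c : ℤ → (Fin n → ℝ) → ℝ) (h1 : 1 ≤ r)
    (h2 : r ≤ n) (lam mu t : Fin n → ℝ) :
    HA m ζ c r lam mu t = ∑ j ∈ Finset.Icc 1 n, defCoef n m (fun a b => ζ a b t) r j *
      hA m (fun α => c α t) j lam mu := by
  rw [HA, deform_eq_sum _ _ h1 h2]
  rfl

section

variable {ζ : ℕ → ℕ → (Fin n → ℝ) → ℝ} {d : ℕ → (Fin n → ℝ) → ℝ} {e : (Fin n → ℝ) → ℝ}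
  {c : ℤ → (Fin n → ℝ) → ℝ}

theorem differentiableAt_HA (hlam : lam ∈ config n m) (hc : CoeffRelation n m c d e) (h1 : 1 ≤ r)
    (h2 : r ≤ n) (mu t : Fin n → ℝ) :
    DifferentiableAt ℝ (fun ξ : (Fin n → ℝ) × (Fin n → ℝ) => HA m ζ c r ξ.1 ξ.2 t) (lam, mu) := by
  simp only [HA_eq_sum ζ c h1 h2]
  exact DifferentiableAt.fun_sum fun j _ => (differentiableAt_hA
    (z := ((lam, mu) : (Fin n → ℝ) × (Fin n → ℝ))) differentiableAt_fst hlam differentiableAt_snd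
    (hc.potRelation t) j).const_mul _

/-- The Lax matrix in terms of polynomials -/
theorem L_eq (hc : CoeffRelation n m c d e) (hlam : lam ∈ config n m) (x : ℝ) (mu t : Fin n → ℝ) :
    L m c x lam mu t = !![(v m lam mu).eval x, (u lam).eval x;
      (wpoly m (potPoly n m (fun γ => d γ t) (e t)) lam mu).eval x, -(v m lam mu).eval x] := by
  ext a b
  rw [L, lax, w_eq (hc.potRelation t) hlam]
  fin_cases a <;> fin_cases b
  · exact evalAt_toLaurent _ _
  · exact evalAt_toLaurent _ _
  · exact evalAt_toLaurent _ _
  · exact (evalAt_neg _ _).trans (congrArg Neg.neg (evalAt_toLaurent _ _))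

theorem IsMagneticData.coeffDiffAt (hdata : IsMagneticData n m ζ d e) (t : Fin n → ℝ) :
    CoeffDiffAt (fun t => potPoly n m (fun γ => d γ t) (e t)) t :=
  coeffDiffAt_potPoly
    (fun γ hγ => ((hdata.contDiff_d γ hγ).differentiable two_ne_zero).differentiableAt)
    (hdata.contDiff_e.differentiable two_ne_zero).differentiableAt

theorem differentiableAt_L (hdata : IsMagneticData n m ζ d e) (hc : CoeffRelation n m c d e)
    (hm : m ≤ n + 1) (hlam : lam ∈ config n m) (mu t : Fin n → ℝ) (x : ℝ) (a b : Fin 2) :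
    DifferentiableAt ℝ (fun p : (Fin n → ℝ) × (Fin n → ℝ) × (Fin n → ℝ) =>
      L m c x p.1 p.2.1 p.2.2 a b) (lam, mu, t) := by
  let z : (Fin n → ℝ) × (Fin n → ℝ) × (Fin n → ℝ) := (lam, mu, t)
  have hl : DifferentiableAt ℝ (fun z : (Fin n → ℝ) × (Fin n → ℝ) × (Fin n → ℝ) => z.1) z :=
    differentiableAt_fst
  have hmu : DifferentiableAt ℝ (fun z : (Fin n → ℝ) × (Fin n → ℝ) × (Fin n → ℝ) => z.2.1) z :=
    differentiableAt_snd.fst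
  have hN : CoeffDiffAt (fun z : (Fin n → ℝ) × (Fin n → ℝ) × (Fin n → ℝ) =>
      potPoly n m (fun γ => d γ z.2.2) (e z.2.2)) z := fun k =>
    DifferentiableAt.fun_comp' z
      (g := fun t => (potPoly n m (fun γ => d γ t) (e t)).coeff k) (hdata.coeffDiffAt t k)
      (differentiableAt_snd.snd)
  have hM : ∀ z : (Fin n → ℝ) × (Fin n → ℝ) × (Fin n → ℝ),
      (potPoly n m (fun γ => d γ z.2.2) (e z.2.2)).natDegree ≤ 2 * n + 2 :=
    fun z => natDegree_potPoly_le hm _ _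
  have hz := eventually_mem_config_comp (m := m) hl hlam
  have hx : DifferentiableAt ℝ (fun _ : (Fin n → ℝ) × (Fin n → ℝ) × (Fin n → ℝ) => x) z :=
    differentiableAt_const x
  have hv := (coeffDiffAt_v hl hlam hmu).eval (M := n) (by
    filter_upwards [hz] with z hz
    exact natDegree_le_of_degree_lt (degree_v_lt hz)) hx
  have hw := (coeffDiffAt_wpoly hl hlam hmu hN hm hM).eval (M := n + 2) (by
    filter_upwards [hz] with z hz
    exact natDegree_wpoly_le hz hm (hM z)) hx
  have hu := (coeffDiffAt_u hl).eval (M := n)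
    (Eventually.of_forall fun z => (natDegree_u _).le) hx
  have key : ∀ f : (Fin n → ℝ) × (Fin n → ℝ) × (Fin n → ℝ) → ℝ, DifferentiableAt ℝ f z →
      (∀ z : (Fin n → ℝ) × (Fin n → ℝ) × (Fin n → ℝ), z.1 ∈ config n m →
        L m c x z.1 z.2.1 z.2.2 a b = f z) →
      DifferentiableAt ℝ (fun p : (Fin n → ℝ) × (Fin n → ℝ) × (Fin n → ℝ) =>
        L m c x p.1 p.2.1 p.2.2 a b) z := fun f hf h => by
    refine hf.congr_of_eventuallyEq ?_
    filter_upwards [hz] with z hz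
    exact h z hz
  fin_cases a <;> fin_cases b
  · exact key _ hv fun z hz => by rw [L_eq hc hz]; rfl
  · exact key _ hu fun z hz => by rw [L_eq hc hz]; rfl
  · exact key _ hw fun z hz => by rw [L_eq hc hz]; rfl
  · exact key _ hv.fun_neg fun z hz => by rw [L_eq hc hz]; rfl

/-! ### The Lax equation -/

/-- The term with κ is present only for m = n + 1. Then r = 1 is alone in its range and is not
deformed, so deforming leaves κ unchanged. -/
theorem sum_defCoef_mul_ite (h : Sector n m r σ) (ζ : ℕ → ℕ → ℝ) :
    ∑ j ∈ Finset.Icc 1 n, defCoef n m ζ r j * (if m = n + 1 ∧ j = 1 then 1 else 0) =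
      if m = n + 1 ∧ r = 1 then 1 else 0 := by
  have hb := h.bounds
  rw [Finset.sum_eq_single 1]
  · by_cases h1 : m = n + 1 ∧ r = 1
    · obtain ⟨rfl, rfl⟩ := h1
      rw [if_pos ⟨rfl, rfl⟩, defCoef, if_pos (Or.inl rfl), if_pos (by unfold kappa1; omega),
        if_pos rfl, mul_one]
    · rw [if_neg h1]
      by_cases h2 : m = n + 1
      · rw [if_pos ⟨h2, rfl⟩, mul_one]
        by_contra h0
        have h3 := h.of_defCoef le_rfl (by omega) h0
        unfold Sector at h h3
        rcases h with h | h <;> rcases h3 with h3 | h3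
        · omega
        · exact absurd (h.1.symm.trans h3.1) zero_ne_one
        · exact absurd (h3.1.symm.trans h.1) zero_ne_one
        · omega
      · rw [if_neg fun h => h2 h.1, mul_zero]
  · intro j _ hj
    rw [if_neg fun h => hj h.2, mul_zero]
  · intro h0
    exact absurd (Finset.mem_Icc.2 ⟨le_rfl, by omega⟩) h0

/-- The deformed matrices are given by Lax data. -/
theorem exists_isLaxData_deform (h : Sector n m r σ) (hlam : lam ∈ config n m) (hm : m ≤ n + 1)
    (ζ : ℕ → ℕ → ℝ) (d : ℕ → ℝ) (e : ℝ) (mu : Fin n → ℝ) {c : ℤ → ℝ}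
    (hc : PotRelation n m c (potPoly n m d e)) :
    ∃ (Q : ℝ[T;T⁻¹]) (R S : ℝ[X]), IsLaxData n m lam (v m lam mu).toLaurent
        (wpoly m (potPoly n m d e) lam mu).toLaurent (magPoly n d).toLaurent (e - d (n + 1))
        (phiBar n σ (defCoef n m ζ r) (u lam)) (entryABar m σ (defCoef n m ζ r) lam mu) Q R S
        (phiBar n σ (defCoef n m ζ r) (magPoly n d)) (if m = n + 1 ∧ r = 1 then 1 else 0) ∧
      deform n m ζ (fun j => U m c j lam mu) r =
        !![entryABar m σ (defCoef n m ζ r) lam mu,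
          (1 / 2 : ℝ) • phiBar n σ (defCoef n m ζ r) (u lam);
        Q, -entryABar m σ (defCoef n m ζ r) lam mu] := by
  have hz := sector_of_mem h ζ
  have key : ∀ j, ∃ (q : ℝ[T;T⁻¹]) (s : ℝ[X]), j ∈ Finset.Icc 1 n → defCoef n m ζ r j ≠ 0 →
      IsLaxData n m lam (v m lam mu).toLaurent
        (wpoly m (potPoly n m d e) lam mu).toLaurent (magPoly n d).toLaurent (e - d (n + 1))
        (phi σ (n + 1 - j) (u lam)) (entryA m j σ lam mu) q (remR m j lam mu) s
        (phi σ (n + 1 - j) (magPoly n d)) (if m = n + 1 ∧ j = 1 then 1 else 0) ∧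
      U m c j lam mu = !![entryA m j σ lam mu, (1 / 2 : ℝ) • phi σ (n + 1 - j) (u lam);
        q, -entryA m j σ lam mu] := by
    intro j
    by_cases h1 : j ∈ Finset.Icc 1 n ∧ defCoef n m ζ r j ≠ 0
    · obtain ⟨q, s, h2⟩ := exists_isLaxData (hz j h1.1 h1.2) hlam hm d e mu hc
      exact ⟨q, s, fun _ _ => h2⟩
    · exact ⟨0, 0, fun h2 h3 => absurd ⟨h2, h3⟩ h1⟩
  -- Indices of weight zero received dummy data, because they need not lie in the range of σ.
  choose q s hqs using key
  have hsum := IsLaxData.sum fun j hj h0 => (hqs j hj h0).1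
  rw [sum_defCoef_mul_ite h] at hsum
  refine ⟨_, _, _, hsum, ?_⟩
  rw [deform_eq_sum _ _ h.bounds.1 h.bounds.2]
  have hU : ∀ j ∈ Finset.Icc 1 n, defCoef n m ζ r j • U m c j lam mu = defCoef n m ζ r j •
      !![entryA m j σ lam mu, (1 / 2 : ℝ) • phi σ (n + 1 - j) (u lam);
        q j, -entryA m j σ lam mu] := fun j hj => by
    by_cases h0 : defCoef n m ζ r j = 0
    · rw [h0, zero_smul, zero_smul]
    · rw [(hqs j hj h0).2]
  rw [Finset.sum_congr rfl hU]
  ext1 a b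
  rw [Matrix.sum_apply]
  fin_cases a <;> fin_cases b
  · rfl
  · simp only [Matrix.smul_apply, phiBar, Finset.smul_sum]
    exact Finset.sum_congr rfl fun j _ =>
      smul_comm (defCoef n m ζ r j) (1 / 2 : ℝ) (phi σ (n + 1 - j) (u lam))
  · rfl
  · simp only [Matrix.smul_apply, entryABar, ← Finset.sum_neg_distrib]
    exact Finset.sum_congr rfl fun j _ => smul_neg _ _

theorem IsMagneticData.hasCoeffDerivAt (hdata : IsMagneticData n m ζ d e) (t : Fin n → ℝ)
    (r : ℕ) : HasCoeffDerivAt (fun s : ℝ => potPoly n m (fun γ => d γ (t + s • timeDir n r))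
      (e (t + s • timeDir n r)))
      (magPoly n (fun γ => d γ t) * magPoly n (fun γ => timeDeriv r (d γ) t) +
        Polynomial.C (timeDeriv r e t - timeDeriv r (d (n + 1)) t) * Polynomial.X ^ (n + m)) 0 := by
  have hd : ∀ γ ≤ n + 1, HasDerivAt (fun s : ℝ => d γ (t + s • timeDir n r))
      (timeDeriv r (d γ) t) 0 := fun γ hγ =>
    (((hdata.contDiff_d γ hγ).differentiable two_ne_zero).differentiableAt
      (x := t)).lineDifferentiableAt.hasLineDerivAt
  have he : HasDerivAt (fun s : ℝ => e (t + s • timeDir n r)) (timeDeriv r e t) 0 :=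
    ((hdata.contDiff_e.differentiable two_ne_zero).differentiableAt
      (x := t)).lineDifferentiableAt.hasLineDerivAt
  have hP : HasCoeffDerivAt (fun s : ℝ => magPoly n fun γ => d γ (t + s • timeDir n r))
      (magPoly n fun γ => timeDeriv r (d γ) t) 0 := fun k => by
    simp only [coeff_magPoly]
    split_ifs with hk
    · exact hd k (by omega)
    · exact hasDerivAt_const _ _
  have hC : HasCoeffDerivAt (fun s : ℝ => Polynomial.C (e (t + s • timeDir n r) -
      d (n + 1) (t + s • timeDir n r)))
      (Polynomial.C (timeDeriv r e t - timeDeriv r (d (n + 1)) t)) 0 := fun k => by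
    simp only [Polynomial.coeff_C]
    split_ifs with hk
    · exact he.sub (hd _ le_rfl)
    · exact hasDerivAt_const _ _
  have h1 := ((hP.mul hP).const_mul (Polynomial.C (1 / 2))).add
    (hC.mul (hasCoeffDerivAt_const (Polynomial.X ^ (n + m))))
  have h2 : Polynomial.C (1 / 2 : ℝ) * 2 = 1 := by
    rw [← map_ofNat Polynomial.C 2, ← map_mul]; norm_num
  convert! h1 using 1
  · funext s
    rw [potPoly, pow_two]
  · simp only [zero_smul, add_zero]
    linear_combination -(magPoly n (fun γ => d γ t) *
      magPoly n (fun γ => timeDeriv r (d γ) t)) * h2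

theorem lax_equation (hdata : IsMagneticData n m ζ d e) (hc : CoeffRelation n m c d e)
    (hm : m ≤ n + 1) (h1 : 1 ≤ r) (h2 : r ≤ n) (hlam : lam ∈ config n m) (mu t : Fin n → ℝ)
    {x : ℝ} (hx : x ^ m ≠ 0) :
    (∀ a b : Fin 2, DifferentiableAt ℝ (fun y : ℝ => Ubar m ζ c r y lam mu t a b) x) ∧
      Matrix.of (fun a b : Fin 2 => evolDeriv r (HA m ζ c r)
          (fun l p s => L m c x l p s a b) lam mu t) =
        Ubar m ζ c r x lam mu t * L m c x lam mu t - L m c x lam mu t * Ubar m ζ c r x lam mu t +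
          (2 * x ^ m) • Matrix.of (fun a b : Fin 2 =>
            deriv (fun y : ℝ => Ubar m ζ c r y lam mu t a b) x) := by
  obtain ⟨σ, h⟩ := exists_sector (m := m) h1 h2
  have hpot := hc.potRelation t
  have hNdeg := fun t => natDegree_potPoly_le hm (fun γ => d γ t) (e t)
  set z := defCoef n m (fun a b => ζ a b t) r with hz'
  have hz : ∀ j ∈ Finset.Icc 1 n, z j ≠ 0 → Sector n m j σ := sector_of_mem h _
  obtain ⟨Q, R, S, hL, hU⟩ := exists_isLaxData_deform h hlam hm (fun a b => ζ a b t) _ _ mu hpot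
  rw [← hz'] at hL hU
  set A := entryABar m σ z lam mu
  set φ := phiBar n σ z (u lam)
  -- the matrix `Ubar` and its derivative
  have hUb : ∀ y, Ubar m ζ c r y lam mu t =
      !![evalAt A y, 1 / 2 * evalAt φ y; evalAt Q y, -evalAt A y] := fun y => by
    rw [Ubar, hU]
    ext a b
    fin_cases a <;> fin_cases b
    · rfl
    · exact evalAt_smul _ _ _
    · rfl
    · exact evalAt_neg _ _
  have hUd : ∀ a b : Fin 2, HasDerivAt (fun y : ℝ => Ubar m ζ c r y lam mu t a b)
      ((!![evalAt (D A) x, 1 / 2 * evalAt (D φ) x; evalAt (D Q) x, -evalAt (D A) x] :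
        Matrix (Fin 2) (Fin 2) ℝ) a b) x := fun a b => by
    simp only [hUb]
    fin_cases a <;> fin_cases b
    · exact hasDerivAt_evalAt (hL.reg_A x hx)
    · exact (hasDerivAt_evalAt (hL.reg_φ x hx)).const_mul _
    · exact hasDerivAt_evalAt (hL.reg_Q x hx)
    · exact (hasDerivAt_evalAt (hL.reg_A x hx)).fun_neg
  refine ⟨fun a b => (hUd a b).differentiableAt, ?_⟩
  -- the vector field of the Hamiltonian
  set N := potPoly n m (fun γ => d γ t) (e t) with hN
  have hmu := fun i => (hasLineDerivAt_sum_hA_mu (mu := mu) hz hlam hm hpot (hNdeg t) i).lineDeriv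
  have hla := fun i => (hasLineDerivAt_sum_hA_lam (mu := mu) hz hlam hm hpot (hNdeg t) i).lineDeriv
  let a : Fin n → ℝ := fun i => lineDeriv ℝ (fun p => HA m ζ c r lam p t) mu (Pi.single i 1)
  let b : Fin n → ℝ := fun i => -lineDeriv ℝ (fun l => HA m ζ c r l mu t) lam (Pi.single i 1)
  have hHA : ∀ l p, HA m ζ c r l p t =
      ∑ j ∈ Finset.Icc 1 n, z j * hA m (fun α => c α t) j l p := fun l p => HA_eq_sum ζ c h1 h2 l p t
  have ha : ∀ i, a i = (lam i ^ m * mu i * evalAt φ (lam i) -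
      lam i ^ m * evalAt (D φ) (lam i)) / Delta lam i := fun i => by
    rw [← hmu i]
    simp only [a, hHA]
  have hb : ∀ i, b i = -((lam i ^ m * mu i * (m * lam i ^ (m - 1) * mu i -
        (Polynomial.derivative (v m lam mu)).eval (lam i)) -
        1 / 2 * Delta lam i * (wpoly m N lam mu).eval (lam i)) / lam i ^ m *
        evalAt φ (lam i) / Delta lam i +
        (((Polynomial.derivative (v m lam mu)).eval (lam i) - m * lam i ^ (m - 1) * mu i) *
        evalAt (D φ) (lam i) / Delta lam i - 2 * evalAt (D A) (lam i))) := fun i => by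
    rw [← hla i]
    simp only [b, hHA]
  obtain ⟨u', v', h', w', hu, hv, -, hw, hD⟩ := exists_curveDeriv (a := a) (b := b) (mu := mu)
    hlam hm (hdata.coeffDiffAt t) hNdeg (hdata.hasCoeffDerivAt t r)
  have eu := hL.deriv_u hlam hD ha
  have ev := hL.deriv_v hlam hD ha hb
  have ew := hL.deriv_w hlam hD eu ev (by
    rw [map_add, map_mul, map_mul, hdata.toLaurent_deriv hm h t, Polynomial.toLaurent_C,
      Polynomial.toLaurent_X_pow, hdata.deriv_e_sub hm h t]
    push_cast
    rfl)
  -- the derivatives of the entries of `L`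
  have hs := eventually_add_single_mem_config hlam a
  have hxc : HasDerivAt (fun _ : ℝ => x) 0 0 := hasDerivAt_const _ _
  have du := hu.eval (M := n) (Eventually.of_forall fun z => (natDegree_u _).le) hxc
  have dv := hv.eval (M := n) (by
    filter_upwards [hs] with s hs
    exact natDegree_le_of_degree_lt (degree_v_lt hs)) hxc
  have dw := hw.eval (M := n + 2) (by
    filter_upwards [hs] with s hs
    exact natDegree_wpoly_le hs hm (hNdeg _)) hxc
  rw [mul_zero, add_zero] at du dv dw
  have hE : ∀ i j : Fin 2, evolDeriv r (HA m ζ c r) (fun l p s => L m c x l p s i j) lam mu t =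
      (!![v'.eval x, u'.eval x; w'.eval x, -v'.eval x] : Matrix (Fin 2) (Fin 2) ℝ) i j := by
    intro i j
    refine evolDeriv_eq (differentiableAt_L hdata hc hm hlam mu t x i j) (a := a) (b := b)
      (fun i => rfl) (fun i => (neg_neg _).symm) ?_
    have hcongr : ∀ (f : ℝ → ℝ) (f' : ℝ), HasDerivAt f f' 0 →
        (∀ s : ℝ, lam + s • a ∈ config n m →
          L m c x (lam + s • a) (mu + s • b) (t + s • timeDir n r) i j = f s) →
        HasDerivAt (fun s : ℝ =>
          L m c x (lam + s • a) (mu + s • b) (t + s • timeDir n r) i j) f' 0 := by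
      intro f f' hf h
      refine hf.congr_of_eventuallyEq ?_
      filter_upwards [hs] with s hs
      exact h s hs
    fin_cases i <;> fin_cases j
    · exact hcongr _ _ dv fun s hs => by rw [L_eq hc hs]; rfl
    · exact hcongr _ _ du fun s hs => by rw [L_eq hc hs]; rfl
    · exact hcongr _ _ dw fun s hs => by rw [L_eq hc hs]; rfl
    · exact hcongr _ _ dv.fun_neg fun s hs => by rw [L_eq hc hs]; rfl
  -- evaluation of the identities of Laurent polynomials
  have hev : ∀ {b b' : ℝ[T;T⁻¹]}, b = b' → evalAt b x = evalAt b' x := fun h => by rw [h]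
  have h2r : (2 : ℝ[T;T⁻¹]) ∈ reg x := two_eq_C ▸ C_mem_reg 2 x
  have hTr : (T m : ℝ[T;T⁻¹]) ∈ reg x := Or.inr (T_mem_ordGE (by omega))
  have rA := hL.reg_A x hx
  have rφ := hL.reg_φ x hx
  have rQ := hL.reg_Q x hx
  have rp := fun p : ℝ[X] => toLaurent_mem_reg p x
  have ev2 : evalAt (2 : ℝ[T;T⁻¹]) x = 2 := by rw [two_eq_C, evalAt_C]
  have xu := hev eu
  have xv := hev ev
  have xw := hev ew
  have xV := hev hL.mul_V
  have xW := hev hL.mul_w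
  rw [evalAt_sub, evalAt_T_mul (D_mem_reg rφ), evalAt_toLaurent, evalAt_toLaurent] at xu
  rw [evalAt_add, ← LaurentPolynomial.smul_eq_C_mul, evalAt_smul, evalAt_toLaurent,
    evalAt_toLaurent, evalAt_mul h2r (mul_mem hTr (D_mem_reg rA)), ev2,
    evalAt_T_mul (D_mem_reg rA)] at xv
  rw [evalAt_add, evalAt_sub, evalAt_mul (mul_mem h2r rQ) (rp _), evalAt_mul h2r rQ,
    evalAt_mul (mul_mem h2r rA) (rp _), evalAt_mul h2r rA,
    evalAt_mul h2r (mul_mem hTr (D_mem_reg rQ)), ev2, evalAt_T_mul (D_mem_reg rQ),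
    evalAt_toLaurent, evalAt_toLaurent, evalAt_toLaurent] at xw
  rw [evalAt_add, evalAt_mul rφ (rp _), evalAt_mul (mul_mem h2r rA) (rp _), evalAt_mul h2r rA, ev2,
    evalAt_toLaurent, evalAt_toLaurent, evalAt_toLaurent] at xV
  rw [evalAt_add, evalAt_mul rφ (rp _), evalAt_mul (mul_mem h2r rQ) (rp _), evalAt_mul h2r rQ, ev2,
    evalAt_toLaurent, evalAt_toLaurent, evalAt_toLaurent] at xW
  ext i j
  have hdU := (hUd i j).deriv
  rw [Matrix.add_apply, Matrix.smul_apply, Matrix.of_apply, Matrix.of_apply, hE, hdU, hUb,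
    L_eq hc hlam x mu t]
  simp only [Matrix.sub_apply, Matrix.mul_apply, Fin.sum_univ_two, smul_eq_mul]
  fin_cases i <;> fin_cases j
  · simp only [Fin.zero_eta, Matrix.of_apply, Matrix.cons_val_zero, Matrix.cons_val_one,
      Matrix.cons_val', Matrix.cons_val_fin_one]
    -- The diagonal entry of the commutator is ½φw - Qu = ½S.
    linear_combination xv - 1 / 2 * xW
  · simp only [Fin.zero_eta, Fin.mk_one, Matrix.of_apply, Matrix.cons_val_zero, Matrix.cons_val_one,
      Matrix.cons_val', Matrix.cons_val_fin_one]
    -- The upper right entry of the commutator is 2Au - φv = -R.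
    linear_combination xu + xV
  · simp only [Fin.zero_eta, Fin.mk_one, Matrix.of_apply, Matrix.cons_val_zero, Matrix.cons_val_one,
      Matrix.cons_val', Matrix.cons_val_fin_one]
    linear_combination xw
  · simp only [Fin.mk_one, Matrix.of_apply, Matrix.cons_val_zero, Matrix.cons_val_one,
      Matrix.cons_val', Matrix.cons_val_fin_one]
    linear_combination -xv + 1 / 2 * xW

end

end PainleveLax
end

/-! ### The canonical transformation to the magnetic system -/

noncomputable section

namespace PainleveLax

open LaurentPolynomial (T C)
open Filter Topology

variable {n m r : ℕ} {σ : ℝ} {lam mu t : Fin n → ℝ}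

/-! ### The generating function -/

theorem hasLineDerivAt_genF_mu (d : ℕ → (Fin n → ℝ) → ℝ) (lam mu' t : Fin n → ℝ) (i : Fin n) :
    HasLineDerivAt ℝ (fun p => genF m d lam p t) (lam i) mu' (Pi.single i 1) := by
  have h : HasLineDerivAt ℝ (fun p => genF m d lam p t)
      (∑ k, lam k * (Pi.single i (1 : ℝ) : Fin n → ℝ) k) mu' (Pi.single i 1) := by
    refine HasDerivAt.fun_sum fun k _ => HasDerivAt.add_const _ (HasDerivAt.const_mul _ ?_)
    have h1 : HasDerivAt (fun s : ℝ => mu' + s • (Pi.single i (1 : ℝ) : Fin n → ℝ))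
        (Pi.single i 1) 0 := by
      simpa using ((hasDerivAt_id (0 : ℝ)).smul_const (Pi.single i (1 : ℝ) : Fin n → ℝ)).const_add mu'
    exact hasDerivAt_pi.1 h1 k
  simpa [Pi.single_apply] using h

theorem zpow_sub_natCast_of_pow_ne_zero {x : ℝ} (hx : x ^ m ≠ 0) (γ : ℕ) :
    x ^ ((γ : ℤ) - m) = x ^ γ / x ^ m := by
  rcases Nat.eq_zero_or_pos m with rfl | h
  · simp
  · have h0 : x ≠ 0 := fun h0 => hx (by rw [h0, zero_pow (by omega)])
    rw [zpow_sub₀ h0, zpow_natCast, zpow_natCast]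

/-- The logarithm replaces the power whose exponent γ - m + 1 would be 0. For m = 0 the point x = 0
is admissible, as only nonnegative exponents occur. -/
theorem hasDerivAt_genF_term {x : ℝ} (hx : x ^ m ≠ 0) (a : ℝ) (γ : ℕ) :
    HasDerivAt (fun x : ℝ => if γ + 1 = m then a * Real.log x
      else 1 / ((γ : ℝ) - m + 1) * a * x ^ ((γ : ℤ) - m + 1)) (a * x ^ ((γ : ℤ) - m)) x := by
  split_ifs with h
  · have h0 : x ≠ 0 := fun h0 => hx (by rw [h0, zero_pow (by omega)])
    rw [show (γ : ℤ) - m = -1 by omega, zpow_neg_one]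
    exact (Real.hasDerivAt_log h0).const_mul a
  · have h0 : x ≠ 0 ∨ 0 ≤ (γ : ℤ) - m + 1 := by
      by_cases h1 : m = 0
      · right; omega
      · left; exact fun h0 => hx (by rw [h0, zero_pow h1])
    have h1 : (γ : ℝ) - m + 1 ≠ 0 := fun h1 => h (by
      have : (γ : ℝ) + 1 = m := by linarith
      exact_mod_cast this)
    convert! (hasDerivAt_zpow ((γ : ℤ) - m + 1) x h0).const_mul (1 / ((γ : ℝ) - m + 1) * a) using 1
    rw [add_sub_cancel_right]
    push_cast
    field_simp

theorem hasLineDerivAt_genF_lam (hlam : lam ∈ config n m) (d : ℕ → (Fin n → ℝ) → ℝ)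
    (mu' t : Fin n → ℝ) (i : Fin n) :
    HasLineDerivAt ℝ (fun l => genF m d l mu' t) (shiftMu m d lam mu' t i) lam
      (Pi.single i 1) := by
  have h1 : HasDerivAt (fun s : ℝ => lam + s • (Pi.single i (1 : ℝ) : Fin n → ℝ))
      (Pi.single i 1) 0 := by
    simpa using ((hasDerivAt_id (0 : ℝ)).smul_const (Pi.single i (1 : ℝ) : Fin n → ℝ)).const_add lam
  have h : HasLineDerivAt ℝ (fun l => genF m d l mu' t)
      (∑ k, shiftMu m d lam mu' t k * (Pi.single i (1 : ℝ) : Fin n → ℝ) k) lam (Pi.single i 1) := by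
    refine HasDerivAt.fun_sum fun k _ => ?_
    have h2 : HasDerivAt (fun x : ℝ => x * mu' k + ∑ γ ∈ Finset.range (n + 2),
        if γ + 1 = m then d γ t * Real.log x
        else 1 / ((γ : ℝ) - m + 1) * d γ t * x ^ ((γ : ℤ) - m + 1)) (shiftMu m d lam mu' t k)
        ((lam + (0 : ℝ) • (Pi.single i (1 : ℝ) : Fin n → ℝ)) k) := by
      rw [zero_smul, add_zero, shiftMu]
      refine HasDerivAt.fun_add ?_ (HasDerivAt.fun_sum fun γ _ =>
        hasDerivAt_genF_term (hlam.2 k) _ γ)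
      simpa using (hasDerivAt_id (lam k)).mul_const (mu' k)
    exact h2.comp (0 : ℝ) (hasDerivAt_pi.1 h1 k)
  simpa [Pi.single_apply] using h

theorem shiftMu_eq (hlam : lam ∈ config n m) (d : ℕ → (Fin n → ℝ) → ℝ) (mu' t : Fin n → ℝ)
    (i : Fin n) : shiftMu m d lam mu' t i =
      mu' i + (magPoly n fun γ => d γ t).eval (lam i) / lam i ^ m := by
  rw [shiftMu, magPoly, Polynomial.eval_finsetSum, Finset.sum_div]
  congr 1
  refine Finset.sum_congr rfl fun γ _ => ?_
  rw [zpow_sub_natCast_of_pow_ne_zero (hlam.2 i)]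
  simp [mul_div_assoc]

/-- A Laurent polynomial `b` such that `xᵐ b'` is a polynomial of degree at most `n + 1` -/
theorem evalAt_eq_sum_of_mem {b : ℝ[T;T⁻¹]} (hd : T m * D b ∈ degLE (n + 1))
    (ho : T m * D b ∈ ordGE 0) (x : ℝ) :
    evalAt b x = b.coeff 0 + ∑ γ ∈ Finset.range (n + 2),
      if γ + 1 = m then 0 else b.coeff ((γ : ℤ) - m + 1) * x ^ ((γ : ℤ) - m + 1) := by
  -- Away from k = 0 the coefficients of b are recovered from those of its derivative; the constant
  -- term is invisible to the hypotheses and has to be kept separately.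
  have hz : ∀ k : ℤ, k ≠ 0 → (k + m - 1 < 0 ∨ (n : ℤ) + 1 < k + m - 1) → b.coeff k = 0 := by
    intro k hk h
    have h1 : (T m * D b).coeff (k + m - 1) = k * b.coeff k := by
      rw [coeff_T_mul, coeff_D, show k + m - 1 - m + 1 = k by ring]
      push_cast
      ring
    have h2 : (T m * D b).coeff (k + m - 1) = 0 := h.elim (ho _) (hd _)
    rw [h1] at h2
    exact (mul_eq_zero.1 h2).resolve_left (by exact_mod_cast hk)
  have hb : b = C (b.coeff 0) + ∑ γ ∈ Finset.range (n + 2),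
      if γ + 1 = m then 0 else C (b.coeff ((γ : ℤ) - m + 1)) * T ((γ : ℤ) - m + 1) := by
    ext k
    rw [AddMonoidAlgebra.coeff_add, Finsupp.add_apply, AddMonoidAlgebra.coeff_sum,
      Finset.sum_apply', LaurentPolynomial.C_apply]
    have hterm : ∀ γ : ℕ, (if γ + 1 = m then (0 : ℝ[T;T⁻¹]) else
        C (b.coeff ((γ : ℤ) - m + 1)) * T ((γ : ℤ) - m + 1)).coeff k =
        if γ + 1 = m then 0 else if (γ : ℤ) - m + 1 = k then b.coeff k else 0 := by
      intro γ
      split_ifs with h1 h2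
      · rfl
      · rw [coeff_C_mul, LaurentPolynomial.T_apply, if_pos h2, mul_one, h2]
      · rw [coeff_C_mul, LaurentPolynomial.T_apply, if_neg h2, mul_zero]
    simp only [hterm]
    by_cases hk : k = 0
    · rw [if_pos hk, Finset.sum_eq_zero, add_zero, hk]
      intro γ _
      split_ifs with h1 h2
      · rfl
      · omega
      · rfl
    · rw [if_neg hk, zero_add]
      by_cases hk' : 0 ≤ k + m - 1 ∧ k + m - 1 ≤ n + 1
      · rw [Finset.sum_eq_single (k + m - 1).toNat, if_neg (by omega), if_pos (by omega)]
        · intro γ _ hγ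
          split_ifs with h1 h2
          · rfl
          · omega
          · rfl
        · intro h
          exact absurd (Finset.mem_range.2 (by omega)) h
      · rw [hz k hk (by omega)]
        simp
  conv_lhs => rw [hb]
  rw [evalAt_add, evalAt_C, evalAt_sum]
  congr 1
  refine Finset.sum_congr rfl fun γ _ => ?_
  split_ifs with h1
  · exact (evalL x).map_zero
  · exact evalAt_C_mul_T _ _ _

section

variable {ζ : ℕ → ℕ → (Fin n → ℝ) → ℝ} {d : ℕ → (Fin n → ℝ) → ℝ} {e : (Fin n → ℝ) → ℝ}
  {c : ℤ → (Fin n → ℝ) → ℝ}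

/-- The factor γ - m + 1 in the time derivative of d_γ cancels the denominator in F, leaving the
coefficients of ψ, and the coefficient of the logarithm is constant in t_r. Only the constant
coefficient of ψ is missing at each of the n nodes; its contribution is a function of t. -/
theorem IsMagneticData.timeDeriv_genF (hdata : IsMagneticData n m ζ d e) (hm : m ≤ n + 1)
    (h : Sector n m r σ) (lam mu' t : Fin n → ℝ) :
    timeDeriv r (genF m d lam mu') t =
      ∑ i, evalAt (phiBar n σ (defCoef n m (fun a b => ζ a b t) r) (magPoly n fun γ => d γ t))
        (lam i) - n * (phiBar n σ (defCoef n m (fun a b => ζ a b t) r)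
          (magPoly n fun γ => d γ t)).coeff 0 := by
  have hz := sector_of_mem h fun a b => ζ a b t
  set b := phiBar n σ (defCoef n m (fun a b => ζ a b t) r) (magPoly n fun γ => d γ t) with hb
  have hd : ∀ γ ≤ n + 1, HasDerivAt (fun s : ℝ => d γ (t + s • timeDir n r))
      (((γ : ℝ) - m + 1) * b.coeff ((γ : ℤ) - m + 1)) 0 := fun γ hγ => by
    have h1 : HasDerivAt (fun s : ℝ => d γ (t + s • timeDir n r)) (timeDeriv r (d γ) t) 0 :=
      (((hdata.contDiff_d γ hγ).differentiable two_ne_zero).differentiableAt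
        (x := t)).lineDifferentiableAt.hasLineDerivAt
    rw [hdata.deriv_d hm h t hγ, coeff_T_mul, coeff_D] at h1
    push_cast at h1
    exact h1
  have hF : HasDerivAt (fun s : ℝ => genF m d lam mu' (t + s • timeDir n r))
      (∑ i, ∑ γ ∈ Finset.range (n + 2), if γ + 1 = m then 0
        else b.coeff ((γ : ℤ) - m + 1) * lam i ^ ((γ : ℤ) - m + 1)) 0 := by
    refine HasDerivAt.fun_sum fun i _ => HasDerivAt.const_add _ (HasDerivAt.fun_sum fun γ hγ => ?_)
    have h2 := hd γ (by have := Finset.mem_range.1 hγ; omega)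
    split_ifs with h1
    · have h3 := h2.mul_const (Real.log (lam i))
      rwa [← h1, show (γ : ℝ) - (γ + 1 : ℕ) + 1 = 0 by push_cast; ring, zero_mul, zero_mul] at h3
    · have h3 : (γ : ℝ) - m + 1 ≠ 0 := fun h3 => h1 (by
        have : (γ : ℝ) + 1 = m := by linarith
        exact_mod_cast this)
      convert! (h2.const_mul (1 / ((γ : ℝ) - m + 1))).mul_const (lam i ^ ((γ : ℤ) - m + 1)) using 1
      field_simp
  have hF' : timeDeriv r (genF m d lam mu') t = _ := HasLineDerivAt.lineDeriv hF
  rw [hF']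
  simp only [evalAt_eq_sum_of_mem (T_mul_D_phiBar_mem_degLE hz hm _) (T_mul_D_phiBar_mem_ordGE hz _),
    Finset.sum_add_distrib, Finset.sum_const, Finset.card_univ, Fintype.card_fin, nsmul_eq_mul, hb]
  ring

/-! ### The magnetic Hamiltonians -/

theorem phi_eq_add (σ : ℝ) (k : ℕ) (p : ℝ[X]) :
    phi σ k p = C (1 - σ) * (T (-(k : ℤ)) * p.toLaurent) + phi 1 k p := by
  ext j
  rw [AddMonoidAlgebra.coeff_add, Finsupp.add_apply, coeff_C_mul, coeff_phi, coeff_phi, coeff_T_mul,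
    sub_neg_eq_add]
  ring

/-- This combination does not depend on `σ`. -/
theorem phi_wronskian_eq (σ : ℝ) (k : ℕ) (p q : ℝ[X]) :
    phi σ k p * D q.toLaurent - p.toLaurent * D (phi σ k q) -
        C (k : ℝ) * phi σ (k + 1) p * q.toLaurent =
      phi 1 k p * D q.toLaurent - p.toLaurent * D (phi 1 k q) -
        C (k : ℝ) * phi 1 (k + 1) p * q.toLaurent := by
  have h1 : (T (-(k : ℤ) - 1) : ℝ[T;T⁻¹]) = T (-((k + 1 : ℕ) : ℤ)) := by
    congr 1; push_cast; ring
  -- Changing σ adds a multiple of x^{-k}pq' - p(x^{-k}q)' = k x^{-k-1}pq, which is what the third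
  -- term compensates.
  rw [phi_eq_add σ k p, phi_eq_add σ k q, phi_eq_add σ (k + 1) p, map_add, D_mul (C _), D_C, D_mul,
    D_T, h1]
  push_cast
  rw [map_neg]
  ring

theorem phi_wronskian_mem_degLE (k : ℕ) (lam : Fin n → ℝ) (d : ℕ → ℝ) :
    phi 1 k (magPoly n d) * D (u lam).toLaurent ∈ degLE (n - 2) ∧
    (magPoly n d).toLaurent * D (phi 1 k (u lam)) ∈ degLE (n - 1) ∧
    C (k : ℝ) * phi 1 (k + 1) (magPoly n d) * (u lam).toLaurent ∈ degLE (n - 1) :=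
  ⟨mul_mem_degLE (by omega) (tau_one_mem_degLE _) (D_mem_degLE le_rfl (toLaurent_u_mem lam)),
    mul_mem_degLE (by omega) (toLaurent_magPoly_mem d) (D_mem_degLE le_rfl (tau_one_mem_degLE _)),
    mul_mem_degLE (by omega) (mul_mem_degLE le_rfl (C_mem_degLE _) (tau_one_mem_degLE _))
      (toLaurent_u_mem lam)⟩

theorem coeff_phi_wronskian {k : ℕ} (hk : 1 ≤ k) (hkn : k ≤ n + 1) (lam : Fin n → ℝ) (d : ℕ → ℝ) :
    (phi 1 k (magPoly n d) * D (u lam).toLaurent - (magPoly n d).toLaurent * D (phi 1 k (u lam)) -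
        C (k : ℝ) * phi 1 (k + 1) (magPoly n d) * (u lam).toLaurent).coeff (n - 1) =
      k * d k - d (n + 1) * (u lam).coeff (k - 1) := by
  have hφ : ∀ k (p : ℝ[X]), phi 1 k p ∈ degLE (-1) := fun k p => tau_one_mem_degLE _
  have h1 := (phi_wronskian_mem_degLE k lam d).1 ((n : ℤ) - 1) (by omega)
  have h2 : ((magPoly n d).toLaurent * D (phi 1 k (u lam))).coeff ((n : ℤ) - 1) =
      d (n + 1) * (u lam).coeff (k - 1) := by
    rw [coeff_mul_degLE (by ring : ((n : ℤ) + 1) + (-1 - 1) = n - 1) (toLaurent_magPoly_mem d)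
      (D_mem_degLE le_rfl (hφ k _)), coeff_D, coeff_phi,
      show (n : ℤ) + 1 = ((n + 1 : ℕ) : ℤ) by push_cast; ring, coeff_toLaurent_magPoly,
      if_pos (by omega), if_neg (by omega),
      show (-1 - 1 + 1 + (k : ℤ)) = ((k - 1 : ℕ) : ℤ) by omega, coeff_toLaurent_natCast]
    push_cast
    ring
  have h3 : (C (k : ℝ) * phi 1 (k + 1) (magPoly n d) * (u lam).toLaurent).coeff ((n : ℤ) - 1) =
      -(k * d k) := by
    rw [mul_assoc, coeff_C_mul, coeff_mul_degLE (by ring : (-1 : ℤ) + n = n - 1)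
      (hφ _ _) (toLaurent_u_mem lam), coeff_toLaurent_u, coeff_phi, if_neg (by omega),
      show (-1 + ((k + 1 : ℕ) : ℤ)) = (k : ℤ) by push_cast; ring, coeff_toLaurent_magPoly,
      if_pos (by omega)]
    ring
  rw [AddMonoidAlgebra.coeff_sub, Finsupp.sub_apply, AddMonoidAlgebra.coeff_sub, Finsupp.sub_apply,
    h1, h2, h3]
  ring

/-- At λᵢ the Laurent polynomial b takes the value ψ(λᵢ)Δᵢ - P(λᵢ)φ'(λᵢ), since the term with u
vanishes and u'(λᵢ) = Δᵢ. So the left side is ∑ b(λᵢ)/Δᵢ, the coefficient of x^{n-1} in b. As b does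
not depend on σ, its degree is bounded with σ = 1 and its regularity at 0 is seen with σ = 0. -/
theorem sum_evalAt_phi (h : Sector n m r σ) (hlam : lam ∈ config n m) (d : ℕ → ℝ) :
    ∑ i, evalAt (phi σ (n + 1 - r) (magPoly n d)) (lam i) -
      ∑ i, (magPoly n d).eval (lam i) *
        (evalAt (phi σ (n + 1 - r) (uE lam i)) (lam i) / Delta lam i) =
    (n + 1 - r : ℕ) * d (n + 1 - r) - d (n + 1) * rho lam r := by
  have hb := h.bounds
  set k := n + 1 - r with hk
  set b := phi 1 k (magPoly n d) * D (u lam).toLaurent -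
    (magPoly n d).toLaurent * D (phi 1 k (u lam)) -
    C (k : ℝ) * phi 1 (k + 1) (magPoly n d) * (u lam).toLaurent with hb'
  obtain ⟨h1, h2, h3⟩ := phi_wronskian_mem_degLE k lam d
  have hd : b ∈ degLE (n - 1) := sub_mem (sub_mem (degLE_mono (by omega) h1) h2) h3
  have ho : b ∈ ordGE 0 := by
    have h0 : (0 : ℤ) ≤ 0 + 0 := (zero_add 0).ge
    rw [hb', ← phi_wronskian_eq 0]
    exact sub_mem (sub_mem
      (mul_mem_ordGE h0 (tau_zero_mem_ordGE _) (D_mem_ordGE_zero (toLaurent_mem_ordGE _)))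
      (mul_mem_ordGE h0 (toLaurent_mem_ordGE _) (D_mem_ordGE_zero (tau_zero_mem_ordGE _))))
      (mul_mem_ordGE h0 (mul_mem_ordGE h0 (C_mem_ordGE _) (tau_zero_mem_ordGE _))
        (toLaurent_mem_ordGE _))
  have hsum := sum_evalAt_div_Delta hlam.1 hd ho (by omega)
  rw [hb', coeff_phi_wronskian (by omega) (by omega), ← hb', show k - 1 = n - r by omega] at hsum
  rw [rho, ← hsum, ← Finset.sum_sub_distrib]
  refine Finset.sum_congr rfl fun i _ => ?_
  have r1 := h.phi_mem_reg (hlam.2 i) k (magPoly n d)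
  have r2 := h.phi_mem_reg (hlam.2 i) k (u lam)
  have r3 := h.phi_mem_reg (hlam.2 i) (k + 1) (magPoly n d)
  have rp := fun p : ℝ[X] => toLaurent_mem_reg p (lam i)
  have hΔ := Delta_ne_zero hlam.1 i
  rw [hb', ← phi_wronskian_eq σ, evalAt_sub, evalAt_sub, evalAt_mul r1 (D_mem_reg (rp _)),
    evalAt_mul (rp _) (D_mem_reg r2), evalAt_mul (mul_mem (C_mem_reg _ _) r3) (rp _),
    D_toLaurent, evalAt_toLaurent, evalAt_toLaurent, evalAt_toLaurent, eval_u, eval_derivative_u,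
    evalAt_D_phi_u h hlam]
  field_simp
  ring

theorem sepSol_add_smul (lam a b : Fin n → ℝ) (x : ℝ) (r : ℕ) :
    sepSol lam (a + x • b) r = sepSol lam a r + x * sepSol lam b r := by
  rw [sepSol, map_add, map_smul, Polynomial.coeff_add, Polynomial.coeff_smul, smul_eq_mul]
  rfl

/-- The polynomial xⁿ - u has degree less than n and takes the values λᵢⁿ at the nodes. -/
theorem sepSol_pow (hlam : lam ∈ config n m) (h1 : 1 ≤ r) (h2 : r ≤ n) :
    sepSol lam (fun i => lam i ^ n) r = -rho lam r := by
  have h3 : (Polynomial.X ^ n - u lam).degree < (n : WithBot ℕ) := by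
    have h := Polynomial.degree_sub_lt_left (p := Polynomial.X ^ n) (q := u lam)
      (by rw [degree_u, Polynomial.degree_X_pow]) (Polynomial.monic_X_pow n).ne_zero
      (by rw [(u_monic lam).leadingCoeff, (Polynomial.monic_X_pow n).leadingCoeff])
    rwa [Polynomial.degree_X_pow] at h
  have h4 : Lagrange.interpolate Finset.univ lam (fun i => lam i ^ n) = Polynomial.X ^ n - u lam :=
    (eq_interpolate_of_eval hlam.1 h3 fun i => by simp [eval_u]).symm
  rw [sepSol, h4, Polynomial.coeff_sub, Polynomial.coeff_X_pow, if_neg (by omega), zero_sub, rho]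

/-- The d_{n+1}λⁿ left over from the potentials contributes d_{n+1}ρ_r, and the shift of W_r
contributes a sum over the nodes. By `sum_evalAt_phi` the two combine to ∑ ψ(λᵢ) and a function of
t. -/
theorem hA_eq_hB_add (h : Sector n m r σ) (hlam : lam ∈ config n m)
    (hc : CoeffRelation n m c d e) (mu' t : Fin n → ℝ) :
    hA m (fun α => c α t) r lam mu' =
      hB m (fun γ => d γ t) (e t) r lam (shiftMu m d lam mu' t) +
        ∑ i, evalAt (phi σ (n + 1 - r) (magPoly n fun γ => d γ t)) (lam i) -
        (n + 1 - r : ℕ) * d (n + 1 - r) t := by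
  have hb := h.bounds
  have hpot := hc.potRelation t
  have hsum := sum_evalAt_phi h hlam fun γ => d γ t
  set P := magPoly n fun γ => d γ t with hP
  -- Completing the square in the momentum: the terms linear in μ' cancel, and -½P²/λᵐ is what N
  -- contains, apart from d_{n+1}.
  have h1 : (fun i => Phi n m (fun γ => d γ t) (e t) (lam i) (shiftMu m d lam mu' t i)) =
      (fun i => Psi n m (fun α => c α t) (fun α : ℤ => lam i ^ α) (mu' i)) +
        (-d (n + 1) t) • fun i => lam i ^ n := by
    funext i
    have hx := hlam.2 i
    have hPe : ∑ γ ∈ Finset.range (n + 2), d γ t * lam i ^ γ = P.eval (lam i) := by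
      rw [hP, magPoly, Polynomial.eval_finsetSum]
      simp
    simp only [Pi.add_apply, Pi.smul_apply, smul_eq_mul]
    rw [Psi_eq hpot hx, Phi, hPe, shiftMu_eq hlam, potPoly]
    simp only [Polynomial.eval_add, Polynomial.eval_mul, Polynomial.eval_C, Polynomial.eval_pow,
      Polynomial.eval_X, pow_add]
    rw [← hP]
    field_simp
    ring
  have h2 : W m r lam (shiftMu m d lam mu' t) = W m r lam mu' - ∑ i, P.eval (lam i) *
      (evalAt (phi σ (n + 1 - r) (uE lam i)) (lam i) / Delta lam i) := by
    rw [W_eq h hlam, W_eq h hlam, ← neg_add', ← Finset.sum_add_distrib]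
    congr 1
    refine Finset.sum_congr rfl fun i _ => ?_
    have hx := hlam.2 i
    rw [shiftMu_eq hlam, ← hP, mul_add, mul_div_cancel₀ _ hx]
    ring
  rw [hA, hB, h1, sepSol_add_smul, sepSol_pow hlam hb.1 hb.2, h2]
  linear_combination -hsum

theorem HB_eq_sum (ζ : ℕ → ℕ → (Fin n → ℝ) → ℝ) (d : ℕ → (Fin n → ℝ) → ℝ) (e : (Fin n → ℝ) → ℝ)
    (h1 : 1 ≤ r) (h2 : r ≤ n) (lam mu t : Fin n → ℝ) :
    HB m ζ d e r lam mu t = ∑ j ∈ Finset.Icc 1 n, defCoef n m (fun a b => ζ a b t) r j *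
      hB m (fun γ => d γ t) (e t) j lam mu := by
  rw [HB, deform_eq_sum _ _ h1 h2]
  rfl

/-- The canonical transformation between the magnetic and the non-magnetic Hamiltonians -/
theorem HA_eq_HB_add (hdata : IsMagneticData n m ζ d e) (hc : CoeffRelation n m c d e)
    (hm : m ≤ n + 1) (h : Sector n m r σ) (hlam : lam ∈ config n m) (mu' t : Fin n → ℝ) :
    HA m ζ c r lam mu' t = HB m ζ d e r lam (shiftMu m d lam mu' t) t +
      timeDeriv r (genF m d lam mu') t +
      (n * (phiBar n σ (defCoef n m (fun a b => ζ a b t) r) (magPoly n fun γ => d γ t)).coeff 0 -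
        ∑ j ∈ Finset.Icc 1 n, defCoef n m (fun a b => ζ a b t) r j *
          ((n + 1 - j : ℕ) * d (n + 1 - j) t)) := by
  have hb := h.bounds
  have hz := sector_of_mem h fun a b => ζ a b t
  have hsum : ∑ i, evalAt (phiBar n σ (defCoef n m (fun a b => ζ a b t) r)
      (magPoly n fun γ => d γ t)) (lam i) =
      ∑ j ∈ Finset.Icc 1 n, defCoef n m (fun a b => ζ a b t) r j *
        ∑ i, evalAt (phi σ (n + 1 - j) (magPoly n fun γ => d γ t)) (lam i) := by
    simp only [phiBar, evalAt_sum, evalAt_smul]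
    rw [Finset.sum_comm]
    simp only [← Finset.mul_sum]
  rw [add_assoc, hdata.timeDeriv_genF hm h, sub_add_sub_cancel, hsum, HA_eq_sum ζ c hb.1 hb.2,
    HB_eq_sum ζ d e hb.1 hb.2, ← add_sub_assoc, ← Finset.sum_add_distrib, ← Finset.sum_sub_distrib]
  refine Finset.sum_congr rfl fun j hj => ?_
  by_cases h0 : defCoef n m (fun a b => ζ a b t) r j = 0
  · rw [h0]; ring
  · rw [hA_eq_hB_add (hz j hj h0) hlam hc]
    ring

end

end PainleveLax
end

/-! ### The theorem -/

theorem mainTheorem2 (n m : ℕ) (hn : 1 ≤ n) (hm : m ≤ n + 1)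
    (ζ : ℕ → ℕ → (Fin n → ℝ) → ℝ) (d : ℕ → (Fin n → ℝ) → ℝ) (e : (Fin n → ℝ) → ℝ)
    (c : ℤ → (Fin n → ℝ) → ℝ)
    (hdata : PainleveLax.IsMagneticData n m ζ d e)
    (hc : PainleveLax.CoeffRelation n m c d e) :
    -- each non-magnetic flow has the isomonodromic Lax representation
    (∀ r : ℕ, 1 ≤ r → r ≤ n → ∀ lam ∈ PainleveLax.config n m, ∀ mu t : Fin n → ℝ,
      -- all derivatives below exist
      DifferentiableAt ℝ (fun ξ : (Fin n → ℝ) × (Fin n → ℝ) =>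
        PainleveLax.HA m ζ c r ξ.1 ξ.2 t) (lam, mu) ∧
      ∀ x : ℝ, x ^ m ≠ 0 →
        (∀ a b : Fin 2, DifferentiableAt ℝ
          (fun p : (Fin n → ℝ) × (Fin n → ℝ) × (Fin n → ℝ) =>
            PainleveLax.L m c x p.1 p.2.1 p.2.2 a b) (lam, mu, t)) ∧
        (∀ a b : Fin 2, DifferentiableAt ℝ
          (fun y : ℝ => PainleveLax.Ubar m ζ c r y lam mu t a b) x) ∧
        -- the Lax equation
        Matrix.of (fun a b : Fin 2 => PainleveLax.evolDeriv r (PainleveLax.HA m ζ c r)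
            (fun l p s => PainleveLax.L m c x l p s a b) lam mu t) =
          PainleveLax.Ubar m ζ c r x lam mu t * PainleveLax.L m c x lam mu t -
            PainleveLax.L m c x lam mu t * PainleveLax.Ubar m ζ c r x lam mu t +
          (2 * x ^ m) • Matrix.of (fun a b : Fin 2 =>
            deriv (fun y : ℝ => PainleveLax.Ubar m ζ c r y lam mu t a b) x)) ∧
    -- the function `F` generates the transformation of momenta
    (∀ lam ∈ PainleveLax.config n m, ∀ mu' t : Fin n → ℝ, ∀ i : Fin n,
      HasLineDerivAt ℝ (fun p => PainleveLax.genF m d lam p t) (lam i) mu' (Pi.single i 1) ∧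
      HasLineDerivAt ℝ (fun l => PainleveLax.genF m d l mu' t)
        (PainleveLax.shiftMu m d lam mu' t i) lam (Pi.single i 1)) ∧
    -- and it relates the non-magnetic and the magnetic Hamiltonians, up to functions of time
    (∃ κ : ℕ → (Fin n → ℝ) → ℝ, ∀ r : ℕ, 1 ≤ r → r ≤ n →
      ∀ lam ∈ PainleveLax.config n m, ∀ mu' t : Fin n → ℝ,
        PainleveLax.HA m ζ c r lam mu' t =
          PainleveLax.HB m ζ d e r lam (PainleveLax.shiftMu m d lam mu' t) t +
            PainleveLax.timeDeriv r (PainleveLax.genF m d lam mu') t + κ r t) := by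
  refine ⟨fun r h1 h2 lam hlam mu t => ⟨PainleveLax.differentiableAt_HA hlam hc h1 h2 mu t,
      fun x hx => ⟨PainleveLax.differentiableAt_L hdata hc hm hlam mu t x,
        PainleveLax.lax_equation hdata hc hm h1 h2 hlam mu t hx⟩⟩,
    fun lam hlam mu' t i => ⟨PainleveLax.hasLineDerivAt_genF_mu d lam mu' t i,
      PainleveLax.hasLineDerivAt_genF_lam hlam d mu' t i⟩, ?_⟩
  -- The function κ may depend only on r and t, so σ is chosen as a function of r alone, with a
  -- dummy value outside 1 ≤ r ≤ n.
  have hσ : ∀ r, ∃ σ, 1 ≤ r → r ≤ n → PainleveLax.Sector n m r σ := fun r => by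
    by_cases h : 1 ≤ r ∧ r ≤ n
    · obtain ⟨σ, hσ⟩ := PainleveLax.exists_sector m h.1 h.2
      exact ⟨σ, fun _ _ => hσ⟩
    · exact ⟨0, fun h1 h2 => absurd ⟨h1, h2⟩ h⟩
  choose σ hσ using hσ
  exact ⟨_, fun r h1 h2 lam hlam mu' t =>
    PainleveLax.HA_eq_HB_add hdata hc hm (hσ r h1 h2) hlam mu' t⟩
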